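/- **Setting.** Let $\lambda_1,\lambda_2,\nu>0$, $\lambda=\lambda_1+\lambda_2$, and let a service time be a random variable with values in $[0,\infty)$, with law $\mu$, mean $b$ and Laplace–Stieltjes transform $B^*(s)=\int e^{-sx}\,d\mu(x)$. Assume $\rho:=\lambda b<1$. Let $R_{B^*}\in[0,\infty]$ be the supremum of the real $t$ with $\int e^{tx}\,d\mu(x)<\infty$, and assume that $\mu$ is of type 1: $R_{B^*}>0$ and $B^*(-t)\to\infty$ as $t\uparrow R_{B^*}$. For $|z|<1$ let $h(z)$ be the unique root $w$, $|w|<1$, of $w=B^*(\lambda_1(1-w)+\lambda_2(1-z))$, and put $$f_1(z)=\frac{1-h(z)}{h(z)-z},\qquad Q(z)=(1-\rho)\exp\Big[-\frac{\lambda}{\nu}\int_z^1 f_1(x)\,dx\Big],\qquad R(z)=\frac{\lambda}{\lambda_2}f_1(z)Q(z),\qquad P_2(z)=Q(z)+R(z).$$ The *dominant singularity* of a function $f$ on the open unit disk is the number $r>0$ such that $f$ has an analytic version on $|z|<r$ and $r$ is the only point of the circle $|z|=r$ across which this version has no analytic continuation. For real $x>1$ in the closed disk of convergence, $f(x)$ is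 the sum at $x$ of the Taylor series of $f$ at $0$ (and $f_1(x)=\frac{1-h(x)}{h(x)-x}$). A relation "as $z\to r$" means that the function has an analytic continuation to a domain $\Delta=\{|z|<S,\ z\ne r,\ |\arg(z-r)|>\varphi\}$ with some $S>r$, $0<\varphi<\pi/2$, for which the relation holds as $z\to r$ in $\Delta$; powers are principal, and $f\sim g$ means that $f-g=o(g)$. **Theorem.** The function $h$ has a dominant singularity $R_h$, and its Taylor series converges there. Let $R^*$ be the smallest zero of $h(x)-x$ in $(1,R_h]$, if there is any. The functions $R$ and $P_2$ have dominant singularities, they coincide, $R_{P_2}=R_R=:r>1$, and exactly one of the following three cases occurs: (1) $r=R^*<R_h$; (2) $R^*$ does not exist and $r=R_h$; (3) $r=R^*=R_h$. As $z\to r$: 1. if $r=R^*<R_h$, then both $P_2$ and $R$ satisfy $$P_2(z)\sim \frac{\lambda}{\lambda_2}c_Q^{(1)}c_{f_1}^{(1)}(r-z)^{-1-\frac{\lambda}{\nu}c_{f_1}^{(1)}},\qquad R(z)\sim \frac{\lambda}{\lambda_2}c_Q^{(1)}c_{f_1}^{(1)}(r-z)^{-1-\frac{\lambda}{\nu}c_{f_1}^{(1)}};$$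 2. if $R^*$ does not exist and $r=R_h$, then the Taylor series of $Q,R,P_2$ converge at $r$ and $$P_2(z)=P_2(r)-\frac{\lambda}{\lambda_2}c_{f_1}^{(2)}Q(r)(r-z)^{1/2}+o\big((r-z)^{1/2}\big),\qquad R(z)=R(r)-\frac{\lambda}{\lambda_2}c_{f_1}^{(2)}Q(r)(r-z)^{1/2}+o\big((r-z)^{1/2}\big);$$ 3. if $r=R^*=R_h$, then the Taylor series of $Q$ converges at $r$ and $$P_2(z)\sim\frac{\lambda}{\lambda_2}\frac{c_{f_1}^{(3)}Q(r)}{(r-z)^{1/2}},\qquad R(z)\sim\frac{\lambda}{\lambda_2}\frac{c_{f_1}^{(3)}Q(r)}{(r-z)^{1/2}}.$$ Here $$c_{f_1}^{(1)}=\frac{(1-r)\big(1+\lambda_1 {B^*}'(\lambda(1-r))\big)}{1+\lambda {B^*}'(\lambda(1-r))},\quad c_{f_1}^{(2)}=\frac{r-1}{(h(r)-r)^2}\,c_h,\quad c_{f_1}^{(3)}=\frac{r-1}{c_h},\quad c_h=\sqrt{\frac{2\lambda_2}{\lambda_1^3{B^*}''(\lambda_1(1-h(R_h))+\lambda_2(1-R_h))}},$$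 $$c_Q^{(1)}=(1-\rho)(r-1)^{\frac{\lambda}{\nu}c_{f_1}^{(1)}}\exp\Big(-\frac{\lambda}{\nu}\int_{r}^1\Big(f_1(x)-\frac{c_{f_1}^{(1)}}{r-x}\Big)dx\Big),$$ and in case 1 the last integrand is integrable on $[1,r]$. -/

import Mathlib

open MeasureTheory ProbabilityTheory Filter Topology Asymptotics

namespace PriorityRetrial

/-! ### Power series, dominant singularities and Delta-domains -/

/-- The `n`-th coefficient of the Taylor expansion at `0` of a generating function `f`
(the generating functions considered here have real coefficients). -/
noncomputable def coeff (f : ℂ → ℂ) (n : ℕ) : ℝ :=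
  (iteratedDeriv n f 0).re / (n.factorial : ℝ)

/-- The Taylor series at `0` of the generating function `f` converges at the real point `x`. -/
def ConvergesAt (f : ℂ → ℂ) (x : ℝ) : Prop :=
  Summable fun n : ℕ => coeff f n * x ^ n

/-- The value `f(x) = ∑ fₙ xⁿ` of the generating function `f` at the real point `x`, where `x` may
lie outside the unit disk (but in the closed disk of convergence). -/
noncomputable def val (f : ℂ → ℂ) (x : ℝ) : ℝ :=
  ∑' n : ℕ, coeff f n * x ^ n

/-- `R > 0` is the dominant singularity of the function `f`, given on the open unit disk: `f`
has an analytic version `F` on the disk `|z| < R`, and among the points of the circle `|z| = R`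
the point `R` is the only one across which `F` has no analytic continuation. -/
def IsDominantSingularity (f : ℂ → ℂ) (R : ℝ) : Prop :=
  0 < R ∧ ∃ F : ℂ → ℂ,
    DifferentiableOn ℂ F (Metric.ball 0 R) ∧
    (∀ z ∈ Metric.ball (0 : ℂ) R, ‖z‖ < 1 → F z = f z) ∧
    ∀ ζ : ℂ, ‖ζ‖ = R →
      ((∃ G : ℂ → ℂ, AnalyticAt ℂ G ζ ∧ ∀ᶠ z in 𝓝[Metric.ball 0 R] ζ, G z = F z) ↔ ζ ≠ (R : ℂ))

/-- The Delta-domain at `R` with outer radius `S` and angle `φ`. -/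
def deltaDomain (R S φ : ℝ) : Set ℂ :=
  {z | ‖z‖ < S ∧ z ≠ (R : ℂ) ∧ φ < |Complex.arg (z - (R : ℂ))|}

/-- `f(z) = g(z) + o(e(z))` as `z → R`: the function `f`, given on the open unit disk, has an
analytic continuation `F` to some Delta-domain at `R`, and `F - g = o(e)` as `z → R` inside this
Delta-domain. -/
def HasDeltaExpansion (f : ℂ → ℂ) (R : ℝ) (g e : ℂ → ℂ) : Prop :=
  ∃ (S φ : ℝ) (F : ℂ → ℂ), R < S ∧ 0 < φ ∧ φ < Real.pi / 2 ∧
    DifferentiableOn ℂ F (deltaDomain R S φ) ∧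
    (∀ z ∈ deltaDomain R S φ, ‖z‖ < 1 → F z = f z) ∧
    (fun z => F z - g z) =o[𝓝[deltaDomain R S φ] (R : ℂ)] e

/-- `f(z) ∼ g(z)` as `z → R` in a Delta-domain at `R`. -/
def DeltaEquivalent (f : ℂ → ℂ) (R : ℝ) (g : ℂ → ℂ) : Prop :=
  HasDeltaExpansion f R g g

/-! ### The service time distribution `μ` -/

/-- The Laplace-Stieltjes transform `B*(s) = ∫ exp(-s x) dμ(x)`, at complex arguments. -/
noncomputable def lst (μ : Measure ℝ) (s : ℂ) : ℂ := complexMGF id μ (-s)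

/-- The Laplace-Stieltjes transform `B*(s) = ∫ exp(-s x) dμ(x)`, at real arguments. -/
noncomputable def lstReal (μ : Measure ℝ) (s : ℝ) : ℝ := mgf id μ (-s)

/-- `R_{B*} ∈ [0, ∞]`: the transform `B*(s)` of a law on `[0, ∞)` converges for
`Re s > -R_{B*}`, and `-R_{B*}` is its dominant singularity. -/
noncomputable def lstRadius (μ : Measure ℝ) : EReal :=
  ⨆ t ∈ integrableExpSet id μ, (t : EReal)

/-- Type-1 laws: `R_{B*} > 0` and `B*(-R_{B*}) = ∞`, that is, `B*(-t) → ∞` as `t ↑ R_{B*}`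
(with `R_{B*} = ∞` allowed). -/
def IsType1 (μ : Measure ℝ) : Prop :=
  0 < lstRadius μ ∧
    Tendsto (fun t : ℝ => lstReal μ (-t))
      (comap (fun t : ℝ => (t : EReal)) (𝓝[<] lstRadius μ)) atTop

/-! ### The generating functions; `l1`, `l2` are the arrival rates, `nu` the retrial rate -/

/-- The load `ρ = (λ₁ + λ₂) b`, with `b` the mean service time. -/
noncomputable def load (μ : Measure ℝ) (l1 l2 : ℝ) : ℝ := (l1 + l2) * ∫ x, x ∂μ

/-- For `|z| < 1`, `h(z)` is the unique root `w` in the open unit disk of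
`w = B*(λ₁(1-w) + λ₂(1-z))`. -/
noncomputable def h (μ : Measure ℝ) (l1 l2 : ℝ) (z : ℂ) : ℂ :=
  Classical.epsilon fun w : ℂ =>
    ‖w‖ < 1 ∧ w = lst μ ((l1 : ℂ) * (1 - w) + (l2 : ℂ) * (1 - z))

/-- `f₁(z) = (1 - h(z)) / (h(z) - z)` for `|z| < 1`. -/
noncomputable def f1 (μ : Measure ℝ) (l1 l2 : ℝ) (z : ℂ) : ℂ :=
  (1 - h μ l1 l2 z) / (h μ l1 l2 z - z)

/-- `Q(z) = (1 - ρ) exp(-(λ/ν) ∫_z^1 f₁(x) dx)` for `|z| < 1`, the integral being taken along the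
segment from `z` to `1`. -/
noncomputable def Q (μ : Measure ℝ) (l1 l2 nu : ℝ) (z : ℂ) : ℂ :=
  (1 - (load μ l1 l2 : ℂ)) *
    Complex.exp (-(((l1 + l2) / nu : ℝ) : ℂ) *
      ∫ t in (0 : ℝ)..1, f1 μ l1 l2 (z + (t : ℂ) * (1 - z)) * (1 - z))

/-- `R(z) = Q(z) (λ/λ₂) (1 - h(z)) / (h(z) - z)` for `|z| < 1`. -/
noncomputable def R (μ : Measure ℝ) (l1 l2 nu : ℝ) (z : ℂ) : ℂ :=
  Q μ l1 l2 nu z * (((l1 + l2) / l2 : ℝ) : ℂ) * f1 μ l1 l2 z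

/-- `P₂(z) = Q(z) + R(z)`. -/
noncomputable def P2 (μ : Measure ℝ) (l1 l2 nu : ℝ) (z : ℂ) : ℂ :=
  Q μ l1 l2 nu z + R μ l1 l2 nu z

/-! ### The zero `R*` and the constants -/

/-- The zeros larger than `1` of `h(z) - z`, where `Rh` is the dominant singularity of `h`;
`R*` is the smallest one, if any. -/
def zerosAboveOne (μ : Measure ℝ) (l1 l2 Rh : ℝ) : Set ℝ :=
  {x | 1 < x ∧ x ≤ Rh ∧ val (h μ l1 l2) x - x = 0}

/-- `f₁` at real points in the closed disk of convergence of `h`, possibly larger than `1`. -/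
noncomputable def f1Real (μ : Measure ℝ) (l1 l2 x : ℝ) : ℝ :=
  (1 - val (h μ l1 l2) x) / (val (h μ l1 l2) x - x)

/-- The constant `c_h`; `Rh` is the dominant singularity of `h`. -/
noncomputable def ch (μ : Measure ℝ) (l1 l2 Rh : ℝ) : ℝ :=
  Real.sqrt (2 * l2 / (l1 ^ 3 *
    iteratedDeriv 2 (lstReal μ) (l1 * (1 - val (h μ l1 l2) Rh) + l2 * (1 - Rh))))

/-- The constant `c_{f₁}^{(1)}`, with `r = R*`. -/
noncomputable def cf1 (μ : Measure ℝ) (l1 l2 r : ℝ) : ℝ :=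
  (1 - r) * (1 + l1 * deriv (lstReal μ) ((l1 + l2) * (1 - r))) /
    (1 + (l1 + l2) * deriv (lstReal μ) ((l1 + l2) * (1 - r)))

/-- The constant `c_{f₁}^{(2)}`, with `r = R_h`. -/
noncomputable def cf2 (μ : Measure ℝ) (l1 l2 r : ℝ) : ℝ :=
  (r - 1) / (val (h μ l1 l2) r - r) ^ 2 * ch μ l1 l2 r

/-- The constant `c_{f₁}^{(3)}`, with `r = R* = R_h`. -/
noncomputable def cf3 (μ : Measure ℝ) (l1 l2 r : ℝ) : ℝ :=
  (r - 1) / ch μ l1 l2 r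

/-- The function integrated in the constant `c_Q^{(1)}`, with `r = R*`. -/
noncomputable def cQ1Integrand (μ : Measure ℝ) (l1 l2 r x : ℝ) : ℝ :=
  f1Real μ l1 l2 x - cf1 μ l1 l2 r / (r - x)

/-- The constant `c_Q^{(1)}`, with `r = R*`. -/
noncomputable def cQ1 (μ : Measure ℝ) (l1 l2 nu r : ℝ) : ℝ :=
  (1 - load μ l1 l2) * (r - 1) ^ ((l1 + l2) / nu * cf1 μ l1 l2 r) *
    Real.exp (-((l1 + l2) / nu) * ∫ x in r..1, cQ1Integrand μ l1 l2 r x)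

/-- Leading term in the first case (`r = R* < R_h`):
`(λ/λ₂) c_Q^{(1)} c_{f₁}^{(1)} (r - z)^{-1 - (λ/ν) c_{f₁}^{(1)}}`. -/
noncomputable def term1 (μ : Measure ℝ) (l1 l2 nu r : ℝ) (z : ℂ) : ℂ :=
  (((l1 + l2) / l2 * cQ1 μ l1 l2 nu r * cf1 μ l1 l2 r : ℝ) : ℂ) *
    ((r : ℂ) - z) ^ ((-1 - (l1 + l2) / nu * cf1 μ l1 l2 r : ℝ) : ℂ)

/-- Singular term in the second case (`r = R_h`, no `R*`):
`(λ/λ₂) c_{f₁}^{(2)} Q(r) (r - z)^{1/2}`. -/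
noncomputable def term2 (μ : Measure ℝ) (l1 l2 nu r : ℝ) (z : ℂ) : ℂ :=
  (((l1 + l2) / l2 * cf2 μ l1 l2 r * val (Q μ l1 l2 nu) r : ℝ) : ℂ) *
    ((r : ℂ) - z) ^ (1 / 2 : ℂ)

/-- Leading term in the third case (`r = R* = R_h`):
`(λ/λ₂) c_{f₁}^{(3)} Q(r) / (r - z)^{1/2}`. -/
noncomputable def term3 (μ : Measure ℝ) (l1 l2 nu r : ℝ) (z : ℂ) : ℂ :=
  (((l1 + l2) / l2 * (cf3 μ l1 l2 r * val (Q μ l1 l2 nu) r) : ℝ) : ℂ) /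
    ((r : ℂ) - z) ^ (1 / 2 : ℂ)

end PriorityRetrial

/-!
Put `λ = λ₁ + λ₂`, `A(u) = B*(λ - u)` and `u = λ₁ h(z) + λ₂ z`. The functional equation of `h`
becomes `u = λ₂ z + λ₁ A(u)`, so that `u` is the inverse function of `ψ(u) = (u - λ₁ A(u)) / λ₂`.
Type 1 makes `A'` blow up at the end of the domain of `A`, hence there is a point `τ > λ` with
`λ₁ A'(τ) = 1`. There `ψ` has a nondegenerate critical point, and `h = A(u)` has a square root
branch point at `R_h = ψ(τ)`. On the rest of the circle `|z| = R_h` one has `Re u < τ`, and `u`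
continues analytically.

With the divided difference `D(u) = (A(u) - 1) / (u - λ)`, the function `f₁` equals
`λ₂ D(u) / (1 - λ D(u))`, and the zeros of `h(x) - x` in `(1, R_h]` are the points `ψ(t)` with
`λ < t ≤ τ` and `λ D(t) = 1`. Since `D` increases on `[λ, τ]` and `λ D(λ) = ρ < 1`, the three cases
are `λ D(τ) > 1`, `< 1` and `= 1`. In these, `f₁` has a simple pole before `R_h`, a square root
singularity at `R_h`, and a pole in `(R_h - z)^{1/2}`, respectively. Since `Q` is the exponential
of a primitive of `f₁`, the expansions pass on to `Q`, `R` and `P₂`.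

All Taylor coefficients in question are nonnegative, so that on the circle of convergence the
limits along the real axis are sums of Taylor series, and the real point dominates the other points
of the circle. The continuations across these other points are glued, together with the one near
`r`, to a function on a slit disk, which contains a domain `Δ`.
-/

namespace RetrialAnalysis

open Metric
open scoped ComplexOrder
open PriorityRetrial (coeff ConvergesAt val IsDominantSingularity deltaDomain HasDeltaExpansion
  DeltaEquivalent lst lstReal lstRadius IsType1 load zerosAboveOne cf1 cQ1Integrand cQ1 term1 term2
  term3)

/-! ### Continuation across boundary points of a disk -/

/-- `F`, given on the disk `|z| < R`, has an analytic continuation across `ζ`. It is the condition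
in `IsDominantSingularity`. -/
def ContinuesAcross (F : ℂ → ℂ) (R : ℝ) (ζ : ℂ) : Prop :=
  ∃ G : ℂ → ℂ, AnalyticAt ℂ G ζ ∧ ∀ᶠ z in 𝓝[ball 0 R] ζ, G z = F z

namespace ContinuesAcross

variable {F F₁ F₂ P : ℂ → ℂ} {R : ℝ} {ζ : ℂ}

theorem of_analyticAt (hF : AnalyticAt ℂ F ζ) : ContinuesAcross F R ζ :=
  ⟨F, hF, Eventually.of_forall fun _ => rfl⟩

theorem add (h₁ : ContinuesAcross F₁ R ζ) (h₂ : ContinuesAcross F₂ R ζ) :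
    ContinuesAcross (fun z => F₁ z + F₂ z) R ζ := by
  obtain ⟨G₁, hG₁, e₁⟩ := h₁
  obtain ⟨G₂, hG₂, e₂⟩ := h₂
  refine ⟨fun z => G₁ z + G₂ z, hG₁.add hG₂, ?_⟩
  filter_upwards [e₁, e₂] with z h1 h2
  rw [h1, h2]

theorem mul (h₁ : ContinuesAcross F₁ R ζ) (h₂ : ContinuesAcross F₂ R ζ) :
    ContinuesAcross (fun z => F₁ z * F₂ z) R ζ := by
  obtain ⟨G₁, hG₁, e₁⟩ := h₁
  obtain ⟨G₂, hG₂, e₂⟩ := h₂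
  refine ⟨fun z => G₁ z * G₂ z, hG₁.mul hG₂, ?_⟩
  filter_upwards [e₁, e₂] with z h1 h2
  rw [h1, h2]

theorem const_mul (c : ℂ) (h : ContinuesAcross F R ζ) :
    ContinuesAcross (fun z => c * F z) R ζ :=
  (of_analyticAt analyticAt_const).mul h

theorem exists_analyticOnNhd_ball (h : ContinuesAcross F R ζ) :
    ∃ δ > 0, ∃ G : ℂ → ℂ, AnalyticOnNhd ℂ G (ball ζ δ) ∧ ∀ z ∈ ball ζ δ, ‖z‖ < R → G z = F z := by
  obtain ⟨G, hG, e⟩ := h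
  obtain ⟨δ, hδ, hball⟩ := Metric.eventually_nhds_iff_ball.1
    (hG.eventually_analyticAt.and (eventually_nhdsWithin_iff.1 e))
  exact ⟨δ, hδ, G, fun z hz => (hball z hz).1,
    fun z hz hzR => (hball z hz).2 (mem_ball_zero_iff.2 hzR)⟩

theorem primitive (hF : ContinuesAcross F R ζ)
    (hP : ∀ z ∈ ball (0 : ℂ) R, HasDerivAt P (F z) z) : ContinuesAcross P R ζ := by
  obtain ⟨δ, hδ, G, hG, hGF⟩ := hF.exists_analyticOnNhd_ball
  obtain ⟨PG, hPG⟩ := hG.differentiableOn.isExactOn_ball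
  have hPG' : DifferentiableOn ℂ PG (ball ζ δ) := fun z hz =>
    (hPG z hz).differentiableAt.differentiableWithinAt
  have hconv : Convex ℝ (ball ζ δ ∩ ball (0 : ℂ) R) := (convex_ball _ _).inter (convex_ball _ _)
  obtain ⟨c, hc⟩ := (isOpen_ball.inter isOpen_ball).exists_eq_add_of_deriv_eq
    hconv.isPreconnected (f := P) (g := PG)
    (fun z hz => (hP z hz.2).differentiableAt.differentiableWithinAt)
    (hPG'.mono Set.inter_subset_left)
    (fun z hz => by
      rw [(hP z hz.2).deriv, (hPG z hz.1).deriv, hGF z hz.1 (mem_ball_zero_iff.1 hz.2)])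
  refine ⟨fun z => PG z + c, (hPG'.analyticAt (ball_mem_nhds _ hδ)).add analyticAt_const, ?_⟩
  filter_upwards [self_mem_nhdsWithin, mem_nhdsWithin_of_mem_nhds (ball_mem_nhds ζ hδ)]
    with z hz hz'
  exact (hc ⟨hz', hz⟩).symm

end ContinuesAcross

theorem tendsto_ofReal_nhdsLT_nhdsWithin_ball {R : ℝ} (hR : 0 < R) :
    Tendsto (fun x : ℝ => (x : ℂ)) (𝓝[<] R) (𝓝[ball 0 R] (R : ℂ)) := by
  refine tendsto_nhdsWithin_iff.2 ⟨?_, ?_⟩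
  · exact (Complex.continuous_ofReal.tendsto R).mono_left nhdsWithin_le_nhds
  · filter_upwards [self_mem_nhdsWithin, mem_nhdsWithin_of_mem_nhds (lt_mem_nhds hR)] with x hx hx0
    rw [mem_ball_zero_iff, Complex.norm_real, Real.norm_of_nonneg (le_of_lt hx0)]
    exact hx

theorem not_continuesAcross_of_tendsto_norm_atTop {F : ℂ → ℂ} {R : ℝ} (hR : 0 < R)
    (hF : Tendsto (fun x : ℝ => ‖F x‖) (𝓝[<] R) atTop) : ¬ ContinuesAcross F R R := by
  rintro ⟨G, hG, e⟩
  have hlim : Tendsto (fun x : ℝ => ‖G x‖) (𝓝[<] R) (𝓝 ‖G R‖) :=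
    (hG.continuousAt.norm.tendsto).comp
      ((tendsto_ofReal_nhdsLT_nhdsWithin_ball hR).mono_right nhdsWithin_le_nhds)
  refine not_tendsto_nhds_of_tendsto_atTop hF _ (hlim.congr' ?_)
  filter_upwards [(tendsto_ofReal_nhdsLT_nhdsWithin_ball hR).eventually e] with x hx
  rw [hx]

/-! ### The square root `(R - z)^{1/2}` -/

/-- The principal square root `(R - z)^{1/2}`, the local parameter at a square root branch
point. -/
noncomputable def sqrtSub (R : ℝ) (z : ℂ) : ℂ := ((R : ℂ) - z) ^ (1 / 2 : ℂ)

theorem sqrtSub_sq (R : ℝ) (z : ℂ) : sqrtSub R z ^ 2 = R - z := by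
  rw [sqrtSub, ← Complex.cpow_nat_mul]
  norm_num

theorem sqrtSub_ofReal {R x : ℝ} (hx : x ≤ R) : sqrtSub R x = (√(R - x) : ℝ) := by
  rw [sqrtSub, Real.sqrt_eq_rpow, Complex.ofReal_cpow (by linarith)]
  push_cast
  rfl

theorem sqrtSub_sub_sq {R s : ℝ} (hs : 0 ≤ s) : sqrtSub R ((R - s ^ 2 : ℝ) : ℂ) = s := by
  rw [sqrtSub_ofReal (by nlinarith), sub_sub_cancel, Real.sqrt_sq hs]

theorem sqrtSub_ne_zero {R : ℝ} {z : ℂ} (hz : z ≠ R) : sqrtSub R z ≠ 0 := by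
  intro h
  have hsq := sqrtSub_sq R z
  rw [h] at hsq
  exact hz (by linear_combination hsq)

theorem tendsto_sqrtSub (R : ℝ) : Tendsto (sqrtSub R) (𝓝 (R : ℂ)) (𝓝 0) := by
  have hnorm (z : ℂ) : ‖sqrtSub R z‖ = √‖(R : ℂ) - z‖ := by
    rw [← sqrtSub_sq, norm_pow, Real.sqrt_sq (norm_nonneg _)]
  have hcont : Continuous fun z : ℂ => √‖(R : ℂ) - z‖ := by fun_prop
  rw [tendsto_zero_iff_norm_tendsto_zero]
  simp_rw [hnorm]
  simpa using hcont.tendsto R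

/-- The plane slit along `[R, ∞)`, on which the principal powers of `R - z` are analytic. -/
def slitPlaneAt (R : ℝ) : Set ℂ := {z | (R : ℂ) - z ∈ Complex.slitPlane}

theorem mem_slitPlaneAt_of_norm_lt {R : ℝ} {z : ℂ} (hz : ‖z‖ < R) : z ∈ slitPlaneAt R :=
  Or.inl (by simpa using (Complex.re_le_norm z).trans_lt hz)

theorem ball_subset_slitPlaneAt (R : ℝ) : ball (0 : ℂ) R ⊆ slitPlaneAt R := fun _ hz =>
  mem_slitPlaneAt_of_norm_lt (mem_ball_zero_iff.1 hz)

theorem mem_slitPlaneAt_of_im_ne_zero {R : ℝ} {z : ℂ} (hz : z.im ≠ 0) : z ∈ slitPlaneAt R :=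
  Or.inr (by simpa using hz)

theorem im_ne_zero_of_mem_slitPlaneAt {R : ℝ} {z : ℂ} (hz : z ∈ slitPlaneAt R) (hzR : R ≤ ‖z‖)
    (hre : 0 < z.re) : z.im ≠ 0 := by
  intro him
  have hz_real : z = (z.re : ℂ) := Complex.ext rfl (by simp [him])
  rcases hz with h | h
  · rw [hz_real, Complex.norm_real, Real.norm_of_nonneg hre.le] at hzR
    have : z.re < R := by simpa using h
    linarith
  · exact h (by simp [him])

theorem ne_of_mem_slitPlaneAt {R : ℝ} {z : ℂ} (hz : z ∈ slitPlaneAt R) : z ≠ R := fun h =>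
  Complex.slitPlane_ne_zero hz (by rw [h, sub_self])

theorem hasDerivAt_cpow_sub {R : ℝ} {z : ℂ} (hz : z ∈ slitPlaneAt R) (c : ℂ) :
    HasDerivAt (fun z : ℂ => ((R : ℂ) - z) ^ c) (-c * ((R : ℂ) - z) ^ (c - 1)) z := by
  have hsub : HasDerivAt (fun z : ℂ => (R : ℂ) - z) (-1) z := by
    simpa using (hasDerivAt_id z).const_sub (R : ℂ)
  convert! hsub.cpow_const hz using 1
  ring

theorem hasDerivAt_sqrtSub {R : ℝ} {z : ℂ} (hz : z ∈ slitPlaneAt R) :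
    HasDerivAt (sqrtSub R) (-(1 / (2 * sqrtSub R z))) z := by
  convert! hasDerivAt_cpow_sub hz (1 / 2 : ℂ) using 1
  have hne := sqrtSub_ne_zero (ne_of_mem_slitPlaneAt hz)
  rw [Complex.cpow_sub _ _ (Complex.slitPlane_ne_zero hz), Complex.cpow_one]
  change _ = -(1 / 2) * (sqrtSub R z / _)
  rw [← sqrtSub_sq R z]
  field_simp

theorem tendsto_sub_sq_nhdsGT (R : ℝ) :
    Tendsto (fun s : ℝ => R - s ^ 2) (𝓝[>] 0) (𝓝[<] R) := by
  refine tendsto_nhdsWithin_iff.2 ⟨?_, ?_⟩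
  · have hcont : Continuous fun s : ℝ => R - s ^ 2 := by fun_prop
    simpa using (hcont.tendsto 0).mono_left nhdsWithin_le_nhds
  · filter_upwards [self_mem_nhdsWithin] with s hs
    exact sub_lt_self R (pow_pos hs 2)

theorem hasDerivAt_unique_of_eventuallyEq_nhdsGT {g H : ℂ → ℂ} {c c' : ℂ}
    (hg : HasDerivAt g c 0) (hH : HasDerivAt H c' 0)
    (h : ∀ᶠ s : ℝ in 𝓝[>] 0, g s = H s) : c = c' := by
  have toReal {f : ℂ → ℂ} {d : ℂ} (hf : HasDerivAt f d 0) :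
      HasDerivWithinAt (fun s : ℝ => f s) d (Set.Ioi 0) 0 :=
    (HasDerivAt.comp_ofReal (z := 0) (by simpa using hf)).hasDerivWithinAt
  have h0 : g (0 : ℝ) = H (0 : ℝ) :=
    tendsto_nhds_unique ((toReal hg).continuousWithinAt.tendsto.congr' h)
      (toReal hH).continuousWithinAt.tendsto
  exact UniqueDiffWithinAt.eq_deriv _ (uniqueDiffWithinAt_Ioi 0) (toReal hg)
    ((toReal hH).congr_of_eventuallyEq h h0)

/-- An analytic `G` gives an even function `s ↦ G (R - s²)`, whereas `H` has nonzero derivative. -/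
theorem not_continuesAcross_of_sqrt {F H : ℂ → ℂ} {R : ℝ} (hR : 0 < R) {c : ℂ} (hc : c ≠ 0)
    (hH : HasDerivAt H c 0) (hF : ∀ᶠ z in 𝓝[ball 0 R] (R : ℂ), F z = H (sqrtSub R z)) :
    ¬ ContinuesAcross F R R := by
  rintro ⟨G, hG, e⟩
  have hG' : HasDerivAt (fun s : ℂ => G ((R : ℂ) - s ^ 2)) 0 0 := by
    have hinner : HasDerivAt (fun s : ℂ => (R : ℂ) - s ^ 2) 0 0 := by
      simpa using ((hasDerivAt_id (0 : ℂ)).pow 2).const_sub (R : ℂ)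
    have houter : HasDerivAt G (deriv G R) ((R : ℂ) - 0 ^ 2) := by
      simpa using hG.differentiableAt.hasDerivAt
    simpa using! houter.comp (0 : ℂ) hinner
  refine hc (hasDerivAt_unique_of_eventuallyEq_nhdsGT hG' hH ?_).symm
  filter_upwards [((tendsto_ofReal_nhdsLT_nhdsWithin_ball hR).comp
    (tendsto_sub_sq_nhdsGT R)).eventually (e.and hF), self_mem_nhdsWithin] with s hs hs0
  have hs0 : (0 : ℝ) < s := hs0
  have h := hs.1.trans hs.2
  rw [Function.comp_apply, sqrtSub_sub_sq hs0.le] at h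
  exact_mod_cast h

/-! ### Extension to a slit disk -/

theorem exists_lt_radius_of_eventually_closedBall {E : Type*} [NormedAddCommGroup E]
    [NormedSpace ℝ E] [ProperSpace E] {p : E → Prop} {R : ℝ} (hR : 0 ≤ R)
    (h : ∀ x, ‖x‖ ≤ R → ∀ᶠ y in 𝓝 x, p y) : ∃ S > R, ∀ x, ‖x‖ < S → p x := by
  have hsub : closedBall (0 : E) R ⊆ interior {x | p x} := fun x hx =>
    mem_interior_iff_mem_nhds.2 (h x (mem_closedBall_zero_iff.1 hx))
  obtain ⟨δ, hδ, hδp⟩ := (isCompact_closedBall (0 : E) R).exists_thickening_subset_open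
    isOpen_interior hsub
  rw [thickening_closedBall hδ hR] at hδp
  exact ⟨δ + R, by linarith, fun x hx => interior_subset (hδp (mem_ball_zero_iff.2 hx))⟩

section RadialProjection

variable {E : Type*} [NormedAddCommGroup E] [NormedSpace ℝ E] {R : ℝ} {z : E}

/-- The radial projection to the sphere `‖z‖ = R` (with value `0` at `0`). -/
noncomputable def radialProj (R : ℝ) (z : E) : E := (R / ‖z‖) • z

theorem norm_radialProj (hR : 0 ≤ R) (hz : z ≠ 0) : ‖radialProj R z‖ = R := by
  have : ‖z‖ ≠ 0 := norm_ne_zero_iff.2 hz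
  rw [radialProj, norm_smul, Real.norm_of_nonneg (by positivity)]
  field_simp

theorem continuousAt_radialProj (R : ℝ) (hz : z ≠ 0) : ContinuousAt (radialProj R) z :=
  (continuousAt_const.div continuous_norm.continuousAt (norm_ne_zero_iff.2 hz)).smul continuousAt_id

theorem radialProj_of_norm_eq (hR : R ≠ 0) (hz : ‖z‖ = R) : radialProj R z = z := by
  rw [radialProj, hz, div_self hR, one_smul]

end RadialProjection

/-- A convex open neighbourhood `U` of `z` and of its radial projection, with an analytic function
`H` on `U` that agrees with `F` on the disk `|w| < R`. Going through the projection makes the value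
`H z` independent of the patch (`RadialPatch.eq`), so that patches can be glued. -/
structure RadialPatch (F : ℂ → ℂ) (R : ℝ) (z : ℂ) (U : Set ℂ) (H : ℂ → ℂ) : Prop where
  isOpen : IsOpen U
  convex : Convex ℝ U
  differentiableOn : DifferentiableOn ℂ H U
  eq_of_norm_lt : ∀ w ∈ U, ‖w‖ < R → H w = F w
  mem : z ∈ U
  radialProj_mem : radialProj R z ∈ U

section RadialPatch

variable {F G₀ H H₁ H₂ : ℂ → ℂ} {R ε : ℝ} {z ζ : ℂ} {U U₁ U₂ : Set ℂ}

theorem RadialPatch.eq (h₁ : RadialPatch F R z U₁ H₁) (h₂ : RadialPatch F R z U₂ H₂)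
    (hR : 0 < R) (hz : z ≠ 0) : H₁ z = H₂ z := by
  have hopen : IsOpen (U₁ ∩ U₂) := h₁.isOpen.inter h₂.isOpen
  have hclosure : radialProj R z ∈ closure (ball (0 : ℂ) R) := by
    rw [closure_ball _ hR.ne', mem_closedBall_zero_iff, norm_radialProj hR.le hz]
  obtain ⟨q, hq, hq_ball⟩ :=
    mem_closure_iff.1 hclosure _ hopen ⟨h₁.radialProj_mem, h₂.radialProj_mem⟩
  have heq : H₁ =ᶠ[𝓝 q] H₂ := by
    filter_upwards [hopen.mem_nhds hq, isOpen_ball.mem_nhds hq_ball] with w hw hw_ball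
    have hw_lt := mem_ball_zero_iff.1 hw_ball
    rw [h₁.eq_of_norm_lt w hw.1 hw_lt, h₂.eq_of_norm_lt w hw.2 hw_lt]
  exact AnalyticOnNhd.eqOn_of_preconnected_of_eventuallyEq
    ((h₁.differentiableOn.mono Set.inter_subset_left).analyticOnNhd hopen)
    ((h₂.differentiableOn.mono Set.inter_subset_right).analyticOnNhd hopen)
    (h₁.convex.inter h₂.convex).isPreconnected hq heq ⟨h₁.mem, h₂.mem⟩

theorem RadialPatch.eventually (h : RadialPatch F R z U H) (hz : z ≠ 0) :
    ∀ᶠ w in 𝓝 z, RadialPatch F R w U H := by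
  filter_upwards [h.isOpen.mem_nhds h.mem, (continuousAt_radialProj R hz).eventually_mem
    (h.isOpen.mem_nhds h.radialProj_mem)] with w hw hw'
  exact { h with mem := hw, radialProj_mem := hw' }

open scoped Classical in
/-- The function glued from `F` on the disk `|z| < R` and the patches outside it; the value is `0`
where there is no patch. -/
noncomputable def radialExtension (F : ℂ → ℂ) (R : ℝ) (z : ℂ) : ℂ :=
  if ‖z‖ < R then F z
  else if h : ∃ p : Set ℂ × (ℂ → ℂ), RadialPatch F R z p.1 p.2 then (Classical.choose h).2 z
  else 0

theorem radialExtension_of_norm_lt (hz : ‖z‖ < R) : radialExtension F R z = F z := if_pos hz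

theorem RadialPatch.radialExtension_eq (h : RadialPatch F R z U H) (hR : 0 < R) (hz : z ≠ 0) :
    radialExtension F R z = H z := by
  rcases lt_or_ge ‖z‖ R with hlt | hge
  · rw [radialExtension_of_norm_lt hlt, h.eq_of_norm_lt z h.mem hlt]
  · have hex : ∃ p : Set ℂ × (ℂ → ℂ), RadialPatch F R z p.1 p.2 := ⟨(U, H), h⟩
    rw [radialExtension, if_neg hge.not_gt, dif_pos hex]
    exact (Classical.choose_spec hex).eq h hR hz

theorem RadialPatch.differentiableAt_radialExtension (h : RadialPatch F R z U H) (hR : 0 < R)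
    (hz : z ≠ 0) : DifferentiableAt ℂ (radialExtension F R) z := by
  refine (h.differentiableOn.differentiableAt (h.isOpen.mem_nhds h.mem)).congr_of_eventuallyEq ?_
  filter_upwards [h.eventually hz, eventually_ne_nhds hz] with w hw hw0
  exact hw.radialExtension_eq hR hw0

theorem differentiableAt_radialExtension_of_norm_lt (hF : DifferentiableOn ℂ F (ball 0 R))
    (hz : ‖z‖ < R) : DifferentiableAt ℂ (radialExtension F R) z := by
  have hz_ball := isOpen_ball.mem_nhds (mem_ball_zero_iff.2 hz)
  refine (hF.differentiableAt hz_ball).congr_of_eventuallyEq ?_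
  filter_upwards [hz_ball] with w hw
  exact radialExtension_of_norm_lt (mem_ball_zero_iff.1 hw)

theorem ContinuesAcross.eventually_exists_radialPatch (h : ContinuesAcross F R ζ) (hR : 0 < R)
    (hζ : ‖ζ‖ = R) : ∀ᶠ z in 𝓝 ζ, ∃ U H, RadialPatch F R z U H := by
  obtain ⟨δ, hδ, G, hG, hGF⟩ := h.exists_analyticOnNhd_ball
  have hpatch : RadialPatch F R ζ (ball ζ δ) G :=
    { isOpen := isOpen_ball
      convex := convex_ball ζ δ
      differentiableOn := hG.differentiableOn
      eq_of_norm_lt := hGF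
      mem := mem_ball_self hδ
      radialProj_mem := by
        rw [radialProj_of_norm_eq hR.ne' hζ]
        exact mem_ball_self hδ }
  have hζ0 : ζ ≠ 0 := norm_ne_zero_iff.1 (hζ.symm ▸ hR.ne')
  filter_upwards [hpatch.eventually hζ0] with z hz
  exact ⟨_, _, hz⟩

/-- The patch is a half disk, bounded by the diameter of the disk that contains the slit. -/
theorem eventually_radialPatch_of_slitPlaneAt (hR : 0 < R) (hε : 0 < ε)
    (hG₀ : DifferentiableOn ℂ G₀ (ball (R : ℂ) ε ∩ slitPlaneAt R))
    (hG₀F : ∀ z ∈ ball (R : ℂ) ε, ‖z‖ < R → G₀ z = F z) :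
    ∀ᶠ z in 𝓝 (R : ℂ), z ∈ slitPlaneAt R → R ≤ ‖z‖ → ∃ U, RadialPatch F R z U G₀ := by
  have hproj : ∀ᶠ z in 𝓝 (R : ℂ), radialProj R z ∈ ball (R : ℂ) ε :=
    (continuousAt_radialProj R (by exact_mod_cast hR.ne')).eventually_mem <| by
      rw [radialProj_of_norm_eq hR.ne' (by simp [hR.le])]
      exact ball_mem_nhds _ hε
  have hre : ∀ᶠ z : ℂ in 𝓝 (R : ℂ), 0 < z.re :=
    Complex.continuous_re.continuousAt.eventually (lt_mem_nhds (by simpa using hR))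
  filter_upwards [hproj, hre, ball_mem_nhds (R : ℂ) hε] with z hz_proj hz_re hz_ball hz_slit hzR
  have him : 0 < z.im * z.im :=
    mul_self_pos.2 (im_ne_zero_of_mem_slitPlaneAt hz_slit hzR hz_re)
  refine ⟨ball (R : ℂ) ε ∩ {w | 0 < z.im * w.im}, ?_⟩
  exact
    { isOpen := isOpen_ball.inter (isOpen_lt continuous_const (by fun_prop))
      convex := (convex_ball _ _).inter (convex_halfSpace_gt (f := fun w : ℂ => z.im * w.im)
        ⟨fun x y => by simp [mul_add], fun c x => by simp; ring⟩ 0)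
      differentiableOn := hG₀.mono fun w hw =>
        ⟨hw.1, mem_slitPlaneAt_of_im_ne_zero (right_ne_zero_of_mul (ne_of_gt hw.2))⟩
      eq_of_norm_lt := fun w hw => hG₀F w hw.1
      mem := ⟨hz_ball, him⟩
      radialProj_mem := by
        refine ⟨hz_proj, ?_⟩
        have : 0 < R / ‖z‖ := div_pos hR (hR.trans_le hzR)
        rw [Set.mem_ofPred_eq, radialProj, Complex.smul_im, smul_eq_mul, mul_left_comm]
        positivity }

theorem exists_slit_extension (hR : 0 < R) (hε : 0 < ε) (hF : DifferentiableOn ℂ F (ball 0 R))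
    (hζ : ∀ ζ : ℂ, ‖ζ‖ = R → ζ ≠ R → ContinuesAcross F R ζ)
    (hG₀ : DifferentiableOn ℂ G₀ (ball (R : ℂ) ε ∩ slitPlaneAt R))
    (hG₀F : ∀ z ∈ ball (R : ℂ) ε, ‖z‖ < R → G₀ z = F z) :
    ∃ S, R < S ∧ ∃ F' : ℂ → ℂ, (∀ z ∈ slitPlaneAt R, ‖z‖ < S → DifferentiableAt ℂ F' z) ∧
      (∀ z, ‖z‖ < R → F' z = F z) ∧ ∀ᶠ z in 𝓝[slitPlaneAt R] (R : ℂ), F' z = G₀ z := by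
  have hne {z : ℂ} (hz : R ≤ ‖z‖) : z ≠ 0 := norm_pos_iff.1 (hR.trans_le hz)
  have hnear := eventually_radialPatch_of_slitPlaneAt hR hε hG₀ hG₀F
  obtain ⟨S, hS, hpatch⟩ := exists_lt_radius_of_eventually_closedBall
    (p := fun z => z ∈ slitPlaneAt R → R ≤ ‖z‖ → ∃ U H, RadialPatch F R z U H) hR.le <| by
    intro ζ hζR
    rcases hζR.lt_or_eq with hlt | heq
    · filter_upwards [continuous_norm.continuousAt.eventually (gt_mem_nhds hlt)] with z hz _ hz'
      exact absurd hz hz'.not_gt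
    · by_cases hζ' : ζ = R
      · rw [hζ']
        filter_upwards [hnear] with z hz hz_slit hzR
        exact (hz hz_slit hzR).imp fun U hU => ⟨G₀, hU⟩
      · filter_upwards [(hζ ζ heq hζ').eventually_exists_radialPatch hR heq] with z hz _ _
        exact hz
  refine ⟨S, hS, radialExtension F R, fun z hz hzS => ?_,
    fun z => radialExtension_of_norm_lt, ?_⟩
  · rcases lt_or_ge ‖z‖ R with hlt | hge
    · exact differentiableAt_radialExtension_of_norm_lt hF hlt
    · obtain ⟨U, H, hp⟩ := hpatch z hzS hz hge
      exact hp.differentiableAt_radialExtension hR (hne hge)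
  · filter_upwards [self_mem_nhdsWithin, mem_nhdsWithin_of_mem_nhds hnear,
      mem_nhdsWithin_of_mem_nhds (ball_mem_nhds (R : ℂ) hε)] with z hz hz_near hz_ball
    rcases lt_or_ge ‖z‖ R with hlt | hge
    · rw [radialExtension_of_norm_lt hlt, hG₀F z hz_ball hlt]
    · obtain ⟨U, hp⟩ := hz_near hz hge
      exact hp.radialExtension_eq hR (hne hge)

end RadialPatch

theorem deltaDomain_subset_slitPlaneAt {R S φ : ℝ} (hφ : 0 ≤ φ) :
    deltaDomain R S φ ⊆ slitPlaneAt R := by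
  rintro z ⟨-, -, hφz⟩
  by_contra h
  obtain ⟨hre, him⟩ : R ≤ z.re ∧ z.im = 0 := by
    simpa [slitPlaneAt, Complex.mem_slitPlane_iff] using h
  have hz : z - R = ((z.re - R : ℝ) : ℂ) := Complex.ext (by simp) (by simpa using him)
  rw [hz, Complex.arg_ofReal_of_nonneg (by linarith), abs_zero] at hφz
  linarith

theorem hasDeltaExpansion_of_slitPlaneAt {f F G₀ g e : ℂ → ℂ} {R ε : ℝ} (hR : 1 ≤ R) (hε : 0 < ε)
    (hF : DifferentiableOn ℂ F (ball 0 R)) (hFf : ∀ z, ‖z‖ < 1 → F z = f z)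
    (hζ : ∀ ζ : ℂ, ‖ζ‖ = R → ζ ≠ R → ContinuesAcross F R ζ)
    (hG₀ : DifferentiableOn ℂ G₀ (ball (R : ℂ) ε ∩ slitPlaneAt R))
    (hG₀F : ∀ z ∈ ball (R : ℂ) ε, ‖z‖ < R → G₀ z = F z)
    (ho : (fun z => G₀ z - g z) =o[𝓝[slitPlaneAt R] (R : ℂ)] e) :
    HasDeltaExpansion f R g e := by
  obtain ⟨S, hS, F', hd, hlt, hev⟩ := exists_slit_extension (by linarith) hε hF hζ hG₀ hG₀F
  have hφ : 0 < Real.pi / 4 := by positivity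
  have hsub := deltaDomain_subset_slitPlaneAt (R := R) (S := S) hφ.le
  refine ⟨S, Real.pi / 4, F', hS, hφ, by linarith [Real.pi_pos], ?_, ?_, ?_⟩
  · exact fun z hz => (hd z (hsub hz) hz.1).differentiableWithinAt
  · exact fun z _ hz => (hlt z (by linarith)).trans (hFf z hz)
  · refine IsLittleO.mono ?_ (nhdsWithin_mono _ hsub)
    exact ho.congr' (by filter_upwards [hev] with z hz; rw [hz]) EventuallyEq.rfl

theorem isDominantSingularity_of_not_continuesAcross {f F : ℂ → ℂ} {R : ℝ} (hR : 0 < R)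
    (hF : DifferentiableOn ℂ F (ball 0 R)) (hFf : ∀ z, ‖z‖ < 1 → F z = f z)
    (hζ : ∀ ζ : ℂ, ‖ζ‖ = R → ζ ≠ R → ContinuesAcross F R ζ) (hRR : ¬ ContinuesAcross F R R) :
    IsDominantSingularity f R := by
  refine ⟨hR, F, hF, fun z _ hz => hFf z hz, fun ζ h => ⟨?_, fun hne => hζ ζ h hne⟩⟩
  rintro hc rfl
  exact hRR hc

/-! ### Nonnegative Taylor coefficients -/

/-- The Taylor coefficients of `f` at `0` up to the order `N` are real and nonnegative, in the
order of `ℂ`. The truncation makes inductions along functional equations possible. -/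
def NonnegCoeffUpTo (f : ℂ → ℂ) (N : ℕ) : Prop := ∀ n ≤ N, 0 ≤ iteratedDeriv n f 0

/-- All Taylor coefficients of `f` at `0` are real and nonnegative. -/
def NonnegCoeff (f : ℂ → ℂ) : Prop := ∀ N, NonnegCoeffUpTo f N

namespace NonnegCoeffUpTo

variable {f g : ℂ → ℂ} {N : ℕ}

theorem congr (hf : NonnegCoeffUpTo f N) (h : f =ᶠ[𝓝 0] g) : NonnegCoeffUpTo g N := fun n hn => by
  rw [← h.iteratedDeriv_eq n]
  exact hf n hn

theorem mono {M : ℕ} (hf : NonnegCoeffUpTo f N) (h : M ≤ N) : NonnegCoeffUpTo f M :=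
  fun n hn => hf n (hn.trans h)

theorem const {c : ℂ} (hc : 0 ≤ c) (N : ℕ) : NonnegCoeffUpTo (fun _ => c) N := by
  intro n _
  rw [iteratedDeriv_const]
  split_ifs
  · exact hc
  · exact le_rfl

theorem of_deriv (h0 : 0 ≤ f 0) (h : NonnegCoeffUpTo (deriv f) N) :
    NonnegCoeffUpTo f (N + 1) := by
  intro n hn
  cases n with
  | zero => simpa using h0
  | succ n => rw [iteratedDeriv_succ']; exact h n (by omega)

theorem add (hf : NonnegCoeffUpTo f N) (hg : NonnegCoeffUpTo g N)
    (af : AnalyticAt ℂ f 0) (ag : AnalyticAt ℂ g 0) :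
    NonnegCoeffUpTo (fun z => f z + g z) N := by
  intro n hn
  rw [iteratedDeriv_fun_add af.contDiffAt ag.contDiffAt]
  exact add_nonneg (hf n hn) (hg n hn)

theorem mul (hf : NonnegCoeffUpTo f N) (hg : NonnegCoeffUpTo g N)
    (af : AnalyticAt ℂ f 0) (ag : AnalyticAt ℂ g 0) :
    NonnegCoeffUpTo (fun z => f z * g z) N := by
  intro n hn
  rw [iteratedDeriv_fun_mul af.contDiffAt ag.contDiffAt]
  refine Finset.sum_nonneg fun i hi => ?_
  have hi := Finset.mem_range.1 hi
  exact mul_nonneg (mul_nonneg (by positivity) (hf i (by omega))) (hg (n - i) (by omega))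

theorem const_mul {c : ℂ} (hc : 0 ≤ c) (hf : NonnegCoeffUpTo f N) (af : AnalyticAt ℂ f 0) :
    NonnegCoeffUpTo (fun z => c * f z) N :=
  (const hc N).mul hf analyticAt_const af

/-- The leading term `g(0) G⁽ⁿ⁾(0)` of the Leibniz formula is moved to the left-hand side; what
remains on the right only involves lower derivatives of `G`. -/
theorem of_eq_add_mul {G p g : ℂ → ℂ} (hp : NonnegCoeffUpTo p N)
    (hg : NonnegCoeffUpTo g N) (hg0 : g 0 < 1) (aG : AnalyticAt ℂ G 0) (ap : AnalyticAt ℂ p 0)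
    (ag : AnalyticAt ℂ g 0) (h : G =ᶠ[𝓝 0] fun z => p z + g z * G z) :
    NonnegCoeffUpTo G N := by
  intro n
  induction n using Nat.strong_induction_on with
  | _ n ih =>
    intro hn
    have hlower : 0 ≤ ∑ k ∈ Finset.range n, (n.choose (k + 1) : ℂ) *
        iteratedDeriv (k + 1) g 0 * iteratedDeriv (n - (k + 1)) G 0 := by
      refine Finset.sum_nonneg fun i hi => ?_
      have hi := Finset.mem_range.1 hi
      exact mul_nonneg (mul_nonneg (by positivity) (hg _ (by omega))) (ih _ (by omega) (by omega))
    have agG : AnalyticAt ℂ (fun z => g z * G z) 0 := ag.mul aG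
    have leibniz := h.iteratedDeriv_eq n
    rw [iteratedDeriv_fun_add ap.contDiffAt agG.contDiffAt,
      iteratedDeriv_fun_mul ag.contDiffAt aG.contDiffAt, Finset.sum_range_succ'] at leibniz
    simp only [Nat.choose_zero_right, Nat.cast_one, iteratedDeriv_zero, one_mul,
      Nat.sub_zero] at leibniz
    have hpos : 0 < 1 - g 0 := sub_pos.2 hg0
    have hmul : 0 ≤ iteratedDeriv n G 0 * (1 - g 0) := by
      convert! add_nonneg (hp n hn) hlower using 1
      linear_combination leibniz
    have hinv : 0 ≤ (1 - g 0)⁻¹ := (RCLike.inv_pos.2 hpos).le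
    simpa [mul_assoc, mul_inv_cancel₀ hpos.ne'] using mul_nonneg hmul hinv

end NonnegCoeffUpTo

theorem NonnegCoeff.of_deriv_eq_mul {G g : ℂ → ℂ} (hg : NonnegCoeff g) (hG0 : 0 ≤ G 0)
    (aG : AnalyticAt ℂ G 0) (ag : AnalyticAt ℂ g 0) (h : deriv G =ᶠ[𝓝 0] fun z => g z * G z) :
    NonnegCoeff G := by
  intro N
  induction N with
  | zero => intro n hn; obtain rfl := Nat.le_zero.1 hn; simpa using hG0
  | succ N ih => exact .of_deriv hG0 (((hg N).mul ih ag aG).congr h.symm)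

theorem coeff_congr {f g : ℂ → ℂ} (h : f =ᶠ[𝓝 0] g) (n : ℕ) :
    coeff f n = coeff g n := by
  rw [coeff, coeff, h.iteratedDeriv_eq n]

namespace NonnegCoeff

variable {f : ℂ → ℂ} {r x : ℝ}

theorem iteratedDeriv_eq_ofReal (h : NonnegCoeff f) (n : ℕ) :
    iteratedDeriv n f 0 = ((iteratedDeriv n f 0).re : ℂ) :=
  Complex.eq_re_of_ofReal_le (r := 0) (by simpa using h n n le_rfl)

theorem iteratedDeriv_eq_factorial_mul_coeff (h : NonnegCoeff f) (n : ℕ) :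
    iteratedDeriv n f 0 = (n.factorial : ℂ) * (coeff f n : ℂ) := by
  have hfact : (n.factorial : ℂ) ≠ 0 := by exact_mod_cast n.factorial_ne_zero
  rw [coeff, Complex.ofReal_div, ← h.iteratedDeriv_eq_ofReal,
    Complex.ofReal_natCast, mul_div_cancel₀ _ hfact]

theorem coeff_nonneg (h : NonnegCoeff f) (n : ℕ) : 0 ≤ coeff f n :=
  div_nonneg (Complex.nonneg_iff.1 (h n n le_rfl)).1 (by positivity)

theorem hasSum_ofReal_coeff (h : NonnegCoeff f) (hf : DifferentiableOn ℂ f (ball 0 r))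
    (hx : 0 ≤ x) (hxr : x < r) :
    HasSum (fun n => ((coeff f n * x ^ n : ℝ) : ℂ)) (f x) := by
  have hxb : (x : ℂ) ∈ ball (0 : ℂ) r := by
    rwa [mem_ball_zero_iff, Complex.norm_real, Real.norm_of_nonneg hx]
  refine (Complex.hasSum_taylorSeries_on_ball hf hxb).congr_fun fun n => ?_
  have hfact : (n.factorial : ℂ) ≠ 0 := by exact_mod_cast n.factorial_ne_zero
  rw [h.iteratedDeriv_eq_factorial_mul_coeff]
  push_cast
  simp only [sub_zero, smul_eq_mul]
  field_simp

theorem hasSum_coeff (h : NonnegCoeff f) (hf : DifferentiableOn ℂ f (ball 0 r))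
    (hx : 0 ≤ x) (hxr : x < r) :
    HasSum (fun n => coeff f n * x ^ n) (f x).re := by
  simpa only [Complex.ofReal_re] using Complex.hasSum_re (h.hasSum_ofReal_coeff hf hx hxr)

theorem eq_ofReal (h : NonnegCoeff f) (hf : DifferentiableOn ℂ f (ball 0 r))
    (hx : 0 ≤ x) (hxr : x < r) : f x = ((f x).re : ℂ) :=
  (h.hasSum_ofReal_coeff hf hx hxr).unique (Complex.hasSum_ofReal.2 (h.hasSum_coeff hf hx hxr))

theorem re_nonneg (h : NonnegCoeff f) (hf : DifferentiableOn ℂ f (ball 0 r))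
    (hx : 0 ≤ x) (hxr : x < r) : 0 ≤ (f x).re :=
  (h.hasSum_coeff hf hx hxr).nonneg fun n => mul_nonneg (h.coeff_nonneg n) (by positivity)

theorem norm_eq_re (h : NonnegCoeff f) (hf : DifferentiableOn ℂ f (ball 0 r))
    (hx : 0 ≤ x) (hxr : x < r) : ‖f x‖ = (f x).re := by
  rw [h.eq_ofReal hf hx hxr, Complex.norm_real, Real.norm_of_nonneg (h.re_nonneg hf hx hxr),
    Complex.ofReal_re]

theorem val_eq_re (h : NonnegCoeff f) (hf : DifferentiableOn ℂ f (ball 0 r))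
    (hx : 0 ≤ x) (hxr : x < r) : val f x = (f x).re :=
  (h.hasSum_coeff hf hx hxr).tsum_eq

/-- A converse of Abel's theorem: for nonnegative coefficients, a radial limit forces
convergence. -/
theorem hasSum_coeff_of_tendsto {L : ℝ} (h : NonnegCoeff f) (hr : 0 < r)
    (hf : DifferentiableOn ℂ f (ball 0 r))
    (hL : Tendsto (fun x : ℝ => (f x).re) (𝓝[<] r) (𝓝 L)) :
    HasSum (fun n => coeff f n * r ^ n) L := by
  have hnear : ∀ᶠ x : ℝ in 𝓝[<] r, 0 ≤ x ∧ x < r := by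
    filter_upwards [self_mem_nhdsWithin, mem_nhdsWithin_of_mem_nhds (lt_mem_nhds hr)] with x hx hx'
    exact ⟨le_of_lt hx', hx⟩
  have hpartial (s : Finset ℕ) : ∑ n ∈ s, coeff f n * r ^ n ≤ L := by
    have hcont : Continuous fun x : ℝ => ∑ n ∈ s, coeff f n * x ^ n := by fun_prop
    refine le_of_tendsto_of_tendsto ((hcont.tendsto r).mono_left nhdsWithin_le_nhds) hL ?_
    filter_upwards [hnear] with x hx
    exact sum_le_hasSum _ (fun n _ => mul_nonneg (h.coeff_nonneg n) (pow_nonneg hx.1 n))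
      (h.hasSum_coeff hf hx.1 hx.2)
  have hsummable : Summable fun n => coeff f n * r ^ n :=
    summable_of_sum_le (fun n => mul_nonneg (h.coeff_nonneg n) (by positivity)) hpartial
  have hge : L ≤ ∑' n, coeff f n * r ^ n := by
    refine le_of_tendsto hL ?_
    filter_upwards [hnear] with x hx
    refine hasSum_le (fun n => ?_) (h.hasSum_coeff hf hx.1 hx.2) hsummable.hasSum
    exact mul_le_mul_of_nonneg_left (pow_le_pow_left₀ hx.1 hx.2.le n) (h.coeff_nonneg n)
  rw [← le_antisymm (hsummable.tsum_le_of_sum_le hpartial) hge]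
  exact hsummable.hasSum

theorem convergesAt_of_tendsto {L : ℂ} (h : NonnegCoeff f) (hr : 0 < r)
    (hf : DifferentiableOn ℂ f (ball 0 r)) (hL : Tendsto (fun x : ℝ => f x) (𝓝[<] r) (𝓝 L)) :
    ConvergesAt f r ∧ (val f r : ℂ) = L := by
  have hre : Tendsto (fun x : ℝ => (f x).re) (𝓝[<] r) (𝓝 L.re) :=
    (Complex.continuous_re.tendsto L).comp hL
  have hsum := h.hasSum_coeff_of_tendsto hr hf hre
  refine ⟨hsum.summable, ?_⟩
  rw [show val f r = L.re from hsum.tsum_eq]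
  refine tendsto_nhds_unique ((Complex.continuous_ofReal.tendsto _).comp hre) (hL.congr' ?_)
  have hpos : ∀ᶠ x : ℝ in 𝓝[<] r, 0 < x := mem_nhdsWithin_of_mem_nhds (lt_mem_nhds hr)
  filter_upwards [hpos, self_mem_nhdsWithin] with x hx hxr
  exact h.eq_ofReal hf hx.le hxr

end NonnegCoeff

/-- The function `η` is `(1 - f(z)) / (1 - z)`, whose coefficients are the tails of those
of `f`. -/
theorem iteratedDeriv_eq_factorial_mul_tail {f η : ℂ → ℂ} (hf : NonnegCoeff f)
    (af : AnalyticAt ℂ f 0) (aη : AnalyticAt ℂ η 0)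
    (e : η =ᶠ[𝓝 0] fun z => (1 - f z) + z * η z) (n : ℕ) :
    iteratedDeriv n η 0 = (n.factorial : ℂ) *
      ((1 - ∑ k ∈ Finset.range (n + 1), coeff f k : ℝ) : ℂ) := by
  induction n with
  | zero =>
    have hη0 : η 0 = 1 - f 0 := by simpa using e.eq_of_nhds
    have hf0 := hf.iteratedDeriv_eq_factorial_mul_coeff 0
    simp only [iteratedDeriv_zero, Nat.factorial_zero, Nat.cast_one, one_mul] at hf0
    simp [hη0, hf0]
  | succ n ih =>
    have af' : AnalyticAt ℂ (fun z => 1 - f z) 0 := analyticAt_const.sub af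
    have aη' : AnalyticAt ℂ (fun z => z * η z) 0 := analyticAt_id.mul aη
    have recursion := e.iteratedDeriv_eq (n + 1)
    rw [iteratedDeriv_fun_add af'.contDiffAt aη'.contDiffAt,
      iteratedDeriv_fun_mul (f := fun z : ℂ => z) analyticAt_id.contDiffAt aη.contDiffAt,
      iteratedDeriv_const_sub (by omega)] at recursion
    simp only [iteratedDeriv_fun_id_zero, iteratedDeriv_neg] at recursion
    rw [Finset.sum_eq_single 1 (fun i _ hi => by simp [hi]) (by simp)] at recursion
    simp only [Nat.choose_one_right, if_true, mul_one, Nat.add_sub_cancel] at recursion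
    rw [recursion, ih, hf.iteratedDeriv_eq_factorial_mul_coeff, Finset.sum_range_succ _ (n + 1),
      Nat.factorial_succ]
    push_cast
    ring

theorem NonnegCoeff.tail {f η : ℂ → ℂ} (hf : NonnegCoeff f) (af : AnalyticAt ℂ f 0)
    (aη : AnalyticAt ℂ η 0) (e : η =ᶠ[𝓝 0] fun z => (1 - f z) + z * η z)
    (hsum : ∀ n, ∑ k ∈ Finset.range (n + 1), coeff f k ≤ 1) :
    NonnegCoeff η := by
  intro N n _
  rw [iteratedDeriv_eq_factorial_mul_tail hf af aη e n]
  exact mul_nonneg (by positivity) (by exact_mod_cast sub_nonneg.2 (hsum n))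

/-! ### The busy period equation `u = λ₂ z + λ₁ A(u)` -/

/-- Edelstein's fixed point theorem: a minimum point of the displacement is fixed. -/
theorem exists_fixedPoint_of_dist_lt {X : Type*} [MetricSpace X] {s : Set X} {T : X → X}
    (hs : IsCompact s) (hne : s.Nonempty) (hT : Set.MapsTo T s s)
    (hdist : ∀ x ∈ s, ∀ y ∈ s, x ≠ y → dist (T x) (T y) < dist x y) : ∃ x ∈ s, T x = x := by
  have hlip : LipschitzOnWith 1 T s := LipschitzOnWith.of_dist_le_mul fun x hx y hy => by
    rcases eq_or_ne x y with rfl | hxy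
    · simp
    · simpa using (hdist x hx y hy hxy).le
  have hcont : ContinuousOn (fun x => dist (T x) x) s :=
    fun x hx => (hlip.continuousOn x hx).dist continuousWithinAt_id
  obtain ⟨x, hx, hmin⟩ := hs.exists_isMinOn hne hcont
  refine ⟨x, hx, ?_⟩
  by_contra hne
  exact (hdist _ (hT hx) x hx hne).not_ge (hmin (hT hx))

theorem eq_ofReal_of_norm_le_re {u : ℂ} {t : ℝ} (hu : ‖u‖ ≤ t) (ht : t ≤ u.re) : u = t := by
  have hre : u.re = t := le_antisymm ((Complex.re_le_norm u).trans hu) ht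
  have him : u.im = 0 := Complex.abs_re_eq_norm.1
    (le_antisymm (Complex.abs_re_le_norm u) (hu.trans (ht.trans (le_abs_self _))))
  exact Complex.ext (by simp [hre]) (by simp [him])

theorem strictMonoOn_Iio_of_hasDerivAt_pos {f f' : ℝ → ℝ} {b : ℝ}
    (hf : ∀ x < b, HasDerivAt f (f' x) x) (hpos : ∀ x < b, 0 < f' x) :
    StrictMonoOn f (Set.Iio b) := by
  refine strictMonoOn_of_deriv_pos (convex_Iio _)
    (fun x hx => (hf x hx).continuousAt.continuousWithinAt) fun x hx => ?_
  rw [interior_Iio] at hx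
  rw [(hf x hx).deriv]
  exact hpos x hx

theorem re_add_smul_sub_lt {u v : ℂ} {s : ℝ} (hu : u.re < s) (hv : v.re < s) {t : ℝ}
    (ht : t ∈ Set.Icc (0 : ℝ) 1) : (v + t • (u - v)).re < s :=
  (convex_halfSpace_re_lt s).add_smul_sub_mem (x := v) (y := u) hv hu ht

/-- The arrival rates `l1`, `l2` and the transform `A(u) = B*(l1 + l2 - u)` of the service time,
analytic for `Re u < σ`, with its real restriction `a` and the derivatives `a1`, `a2` of `a`. In the
variable `u = l1 w + l2 z`, the equation `w = B*(l1 (1 - w) + l2 (1 - z))` reads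
`u = l2 z + l1 A(u)`; its branch point `τ` is the point where `l1 A'(τ) = 1`. -/
structure BusyKernel where
  A : ℂ → ℂ
  a : ℝ → ℝ
  a1 : ℝ → ℝ
  a2 : ℝ → ℝ
  l1 : ℝ
  l2 : ℝ
  σ : ℝ
  τ : ℝ
  l1_pos : 0 < l1
  l2_pos : 0 < l2
  add_lt_tau : l1 + l2 < τ
  tau_lt_sigma : τ < σ
  differentiableOn_A : DifferentiableOn ℂ A {u | u.re < σ}
  iteratedDeriv_nonneg : ∀ (n : ℕ) (x : ℝ), x < σ → 0 ≤ iteratedDeriv n A x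
  A_ofReal : ∀ x : ℝ, x < σ → A x = a x
  deriv_A_ofReal : ∀ x : ℝ, x < σ → deriv A x = a1 x
  norm_A_le : ∀ u : ℂ, u.re < σ → ‖A u‖ ≤ a u.re
  norm_deriv_A_le : ∀ u : ℂ, u.re < σ → ‖deriv A u‖ ≤ a1 u.re
  hasDerivAt_a : ∀ x < σ, HasDerivAt a (a1 x) x
  hasDerivAt_a1 : ∀ x < σ, HasDerivAt a1 (a2 x) x
  a_pos : ∀ x < σ, 0 < a x
  a1_pos : ∀ x < σ, 0 < a1 x
  a2_pos : ∀ x < σ, 0 < a2 x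
  a_add : a (l1 + l2) = 1
  mul_a1_add_lt_one : (l1 + l2) * a1 (l1 + l2) < 1
  l1_mul_a1_tau : l1 * a1 τ = 1

namespace BusyKernel

variable (K : BusyKernel)

/-- The total arrival rate `λ = λ₁ + λ₂`. -/
def lam : ℝ := K.l1 + K.l2

theorem lam_pos : 0 < K.lam := add_pos K.l1_pos K.l2_pos

theorem lam_lt_tau : K.lam < K.τ := K.add_lt_tau

theorem tau_pos : 0 < K.τ := K.lam_pos.trans K.lam_lt_tau

theorem lam_lt_sigma : K.lam < K.σ := K.lam_lt_tau.trans K.tau_lt_sigma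

theorem a_lam : K.a K.lam = 1 := K.a_add

theorem lam_mul_a1_lam_lt_one : K.lam * K.a1 K.lam < 1 := K.mul_a1_add_lt_one

theorem isOpen_halfPlane : IsOpen {u : ℂ | u.re < K.σ} :=
  isOpen_lt Complex.continuous_re continuous_const

theorem analyticAt_A {u : ℂ} (hu : u.re < K.σ) : AnalyticAt ℂ K.A u :=
  K.differentiableOn_A.analyticAt (K.isOpen_halfPlane.mem_nhds hu)

theorem hasDerivAt_A {u : ℂ} (hu : u.re < K.σ) : HasDerivAt K.A (deriv K.A u) u :=
  (K.analyticAt_A hu).differentiableAt.hasDerivAt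

theorem strictMonoOn_a : StrictMonoOn K.a (Set.Iio K.σ) :=
  strictMonoOn_Iio_of_hasDerivAt_pos K.hasDerivAt_a K.a1_pos

theorem strictMonoOn_a1 : StrictMonoOn K.a1 (Set.Iio K.σ) :=
  strictMonoOn_Iio_of_hasDerivAt_pos K.hasDerivAt_a1 K.a2_pos

theorem continuousOn_deriv_A_segment {u v : ℂ} (hu : u.re < K.σ) (hv : v.re < K.σ) :
    ContinuousOn (fun t : ℝ => deriv K.A (v + t • (u - v))) (Set.Icc 0 1) := fun t ht =>
  (ContinuousAt.comp (f := fun t : ℝ => v + t • (u - v))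
    (K.analyticAt_A (re_add_smul_sub_lt hu hv ht)).deriv.continuousAt
    (by fun_prop)).continuousWithinAt

theorem continuousOn_a1_segment {x y : ℝ} (hx : x < K.σ) (hy : y < K.σ) :
    ContinuousOn (fun t : ℝ => K.a1 (y + t * (x - y))) (Set.Icc 0 1) := fun t ht =>
  (ContinuousAt.comp (f := fun t : ℝ => y + t * (x - y))
    (K.hasDerivAt_a1 _ ((convex_Iio K.σ).add_smul_sub_mem (x := y) (y := x) hy hx ht)).continuousAt
    (by fun_prop)).continuousWithinAt

theorem A_sub_A {u v : ℂ} (hu : u.re < K.σ) (hv : v.re < K.σ) :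
    K.A u - K.A v = (u - v) * ∫ t in (0 : ℝ)..1, deriv K.A (v + t • (u - v)) := by
  rw [← smul_eq_mul, intervalIntegral.integral_unitInterval_deriv_eq_sub (f := K.A)
    (K.continuousOn_deriv_A_segment hu hv) fun t ht => K.hasDerivAt_A (re_add_smul_sub_lt hu hv ht),
    add_sub_cancel]

theorem norm_integral_deriv_A_le {u v : ℂ} (hu : u.re < K.σ) (hv : v.re < K.σ) :
    ‖∫ t in (0 : ℝ)..1, deriv K.A (v + t • (u - v))‖ ≤
      ∫ t in (0 : ℝ)..1, K.a1 (v.re + t * (u.re - v.re)) := by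
  refine (intervalIntegral.norm_integral_le_integral_norm zero_le_one).trans ?_
  refine intervalIntegral.integral_mono_on zero_le_one ?_ ?_ fun t ht => ?_
  · exact ((K.continuousOn_deriv_A_segment hu hv).norm).intervalIntegrable_of_Icc zero_le_one
  · exact (K.continuousOn_a1_segment hu hv).intervalIntegrable_of_Icc zero_le_one
  · simpa using K.norm_deriv_A_le _ (re_add_smul_sub_lt hu hv ht)

theorem integral_a1_segment_lt {x y : ℝ} (hx : x ≤ K.τ) (hy : y ≤ K.τ)
    (hxy : x < K.τ ∨ y < K.τ) :
    ∫ t in (0 : ℝ)..1, K.a1 (y + t * (x - y)) < K.a1 K.τ := by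
  have hσ := K.tau_lt_sigma
  suffices ∫ t in (0 : ℝ)..1, K.a1 (y + t * (x - y)) < ∫ _ in (0 : ℝ)..1, K.a1 K.τ by
    simpa using this
  refine intervalIntegral.integral_lt_integral_of_continuousOn_of_le_of_exists_lt zero_lt_one
    (K.continuousOn_a1_segment (hx.trans_lt hσ) (hy.trans_lt hσ)) continuousOn_const
    (fun t ht => ?_) ⟨1 / 2, by norm_num, ?_⟩
  · have hle : y + t * (x - y) ≤ K.τ :=
      (convex_Iic K.τ).add_smul_sub_mem (x := y) (y := x) hy hx ⟨ht.1.le, ht.2⟩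
    exact K.strictMonoOn_a1.monotoneOn (hle.trans_lt hσ) hσ hle
  · have hlt : y + 1 / 2 * (x - y) < K.τ := by
      rcases hxy with h | h <;> linarith
    exact K.strictMonoOn_a1 (hlt.trans hσ) hσ hlt

theorem re_le_tau {u : ℂ} (hu : ‖u‖ ≤ K.τ) : u.re ≤ K.τ := (Complex.re_le_norm u).trans hu

theorem re_lt_sigma {u : ℂ} (hu : ‖u‖ ≤ K.τ) : u.re < K.σ :=
  (K.re_le_tau hu).trans_lt K.tau_lt_sigma

theorem l1_mul_norm_A_sub_A_lt {u v : ℂ} (hu : ‖u‖ ≤ K.τ) (hv : ‖v‖ ≤ K.τ) (huv : u ≠ v) :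
    K.l1 * ‖K.A u - K.A v‖ < ‖u - v‖ := by
  have hre : u.re < K.τ ∨ v.re < K.τ := by
    by_contra! h
    exact huv ((eq_ofReal_of_norm_le_re hu h.1).trans (eq_ofReal_of_norm_le_re hv h.2).symm)
  have hslope : ‖∫ t in (0 : ℝ)..1, deriv K.A (v + t • (u - v))‖ < K.a1 K.τ :=
    (K.norm_integral_deriv_A_le (K.re_lt_sigma hu) (K.re_lt_sigma hv)).trans_lt
      (K.integral_a1_segment_lt (K.re_le_tau hu) (K.re_le_tau hv) hre)
  have hnorm : 0 < ‖u - v‖ := norm_pos_iff.2 (sub_ne_zero.2 huv)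
  have hl1 := K.l1_pos
  calc K.l1 * ‖K.A u - K.A v‖
      = K.l1 * (‖u - v‖ * ‖∫ t in (0 : ℝ)..1, deriv K.A (v + t • (u - v))‖) := by
        rw [K.A_sub_A (K.re_lt_sigma hu) (K.re_lt_sigma hv), norm_mul]
    _ < K.l1 * (‖u - v‖ * K.a1 K.τ) := by gcongr
    _ = ‖u - v‖ := by rw [mul_left_comm, K.l1_mul_a1_tau, mul_one]

theorem dist_l2_mul_add_l1_mul_A (z u v : ℂ) :
    dist (K.l2 * z + K.l1 * K.A u) (K.l2 * z + K.l1 * K.A v) = K.l1 * ‖K.A u - K.A v‖ := by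
  rw [dist_add_left, dist_eq_norm, ← mul_sub, norm_mul, Complex.norm_real,
    Real.norm_of_nonneg K.l1_pos.le]

theorem norm_l2_mul_add_l1_mul_A_le {s : ℝ} (hs : s < K.σ) (z : ℂ) {u : ℂ} (hu : ‖u‖ ≤ s) :
    ‖K.l2 * z + K.l1 * K.A u‖ ≤ K.l2 * ‖z‖ + K.l1 * K.a s := by
  have hre : u.re ≤ s := (Complex.re_le_norm u).trans hu
  have hA : ‖K.A u‖ ≤ K.a s := (K.norm_A_le u (hre.trans_lt hs)).trans
    (K.strictMonoOn_a.monotoneOn (hre.trans_lt hs) hs hre)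
  have hl1 := K.l1_pos.le
  calc ‖K.l2 * z + K.l1 * K.A u‖ ≤ ‖(K.l2 : ℂ) * z‖ + ‖(K.l1 : ℂ) * K.A u‖ := norm_add_le _ _
    _ = K.l2 * ‖z‖ + K.l1 * ‖K.A u‖ := by
      rw [norm_mul, norm_mul, Complex.norm_real, Complex.norm_real,
        Real.norm_of_nonneg K.l1_pos.le, Real.norm_of_nonneg K.l2_pos.le]
    _ ≤ K.l2 * ‖z‖ + K.l1 * K.a s := by gcongr

theorem exists_root {s : ℝ} (hs0 : 0 ≤ s) (hs : s ≤ K.τ) {z : ℂ}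
    (hz : K.l2 * ‖z‖ + K.l1 * K.a s ≤ s) :
    ∃ u : ℂ, ‖u‖ ≤ s ∧ u = K.l2 * z + K.l1 * K.A u := by
  have hτ {u : ℂ} (hu : u ∈ closedBall (0 : ℂ) s) : ‖u‖ ≤ K.τ :=
    (mem_closedBall_zero_iff.1 hu).trans hs
  obtain ⟨u, hu, hfix⟩ := exists_fixedPoint_of_dist_lt
    (T := fun u => K.l2 * z + K.l1 * K.A u) (isCompact_closedBall (0 : ℂ) s)
    ⟨0, mem_closedBall_self hs0⟩
    (fun u hu => mem_closedBall_zero_iff.2 ((K.norm_l2_mul_add_l1_mul_A_le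
      (hs.trans_lt K.tau_lt_sigma) z (mem_closedBall_zero_iff.1 hu)).trans hz))
    (fun u hu v hv huv => by
      rw [K.dist_l2_mul_add_l1_mul_A, dist_eq_norm]
      exact K.l1_mul_norm_A_sub_A_lt (hτ hu) (hτ hv) huv)
  exact ⟨u, mem_closedBall_zero_iff.1 hu, hfix.symm⟩

theorem root_unique {u v z : ℂ} (hu : ‖u‖ ≤ K.τ) (hv : ‖v‖ ≤ K.τ)
    (eu : u = K.l2 * z + K.l1 * K.A u) (ev : v = K.l2 * z + K.l1 * K.A v) : u = v := by
  by_contra huv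
  have hlt := K.l1_mul_norm_A_sub_A_lt hu hv huv
  rw [← K.dist_l2_mul_add_l1_mul_A z, ← eu, ← ev, dist_eq_norm] at hlt
  exact lt_irrefl _ hlt

/-- The real inverse function `ψ(u) = (u - λ₁ A(u)) / λ₂` of the root `u` of the busy period
equation. -/
noncomputable def psi (x : ℝ) : ℝ := (x - K.l1 * K.a x) / K.l2

/-- The image `ψ(τ)` of the branch point, which will be the dominant singularity `R_h`. -/
noncomputable def Rh : ℝ := K.psi K.τ

theorem hasDerivAt_psi {x : ℝ} (hx : x < K.σ) :
    HasDerivAt K.psi ((1 - K.l1 * K.a1 x) / K.l2) x :=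
  ((hasDerivAt_id x).sub ((K.hasDerivAt_a x hx).const_mul K.l1)).div_const K.l2

theorem l1_mul_a1_lt_one {x : ℝ} (hx : x < K.τ) : K.l1 * K.a1 x < 1 := by
  rw [← K.l1_mul_a1_tau]
  exact mul_lt_mul_of_pos_left
    (K.strictMonoOn_a1 (hx.trans K.tau_lt_sigma) K.tau_lt_sigma hx) K.l1_pos

theorem strictMonoOn_psi : StrictMonoOn K.psi (Set.Iic K.τ) := by
  refine strictMonoOn_of_deriv_pos (convex_Iic _) (fun x hx =>
    (K.hasDerivAt_psi (lt_of_le_of_lt hx K.tau_lt_sigma)).continuousAt.continuousWithinAt)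
    fun x hx => ?_
  rw [interior_Iic] at hx
  rw [(K.hasDerivAt_psi (lt_trans hx K.tau_lt_sigma)).deriv]
  exact div_pos (sub_pos.2 (K.l1_mul_a1_lt_one hx)) K.l2_pos

theorem l2_mul_psi_add (x : ℝ) : K.l2 * K.psi x + K.l1 * K.a x = x := by
  rw [psi, mul_div_cancel₀ _ K.l2_pos.ne', sub_add_cancel]

theorem psi_lam : K.psi K.lam = 1 := by
  rw [psi, K.a_lam, lam, mul_one, add_sub_cancel_left, div_self K.l2_pos.ne']

theorem one_lt_psi {t : ℝ} (h : K.lam < t) (ht : t ≤ K.τ) : 1 < K.psi t := by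
  rw [← K.psi_lam]
  exact K.strictMonoOn_psi K.lam_lt_tau.le ht h

theorem psi_le_Rh {t : ℝ} (ht : t ≤ K.τ) : K.psi t ≤ K.Rh :=
  K.strictMonoOn_psi.monotoneOn ht Set.self_mem_Iic ht

theorem one_lt_Rh : 1 < K.Rh := K.one_lt_psi K.lam_lt_tau le_rfl

theorem Rh_pos : 0 < K.Rh := zero_lt_one.trans K.one_lt_Rh

theorem ofReal_l2_ne_zero : (K.l2 : ℂ) ≠ 0 := Complex.ofReal_ne_zero.2 K.l2_pos.ne'

/-- The complex version `Ψ(w) = (w - λ₁ A(w)) / λ₂` of `ψ`. -/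
noncomputable def psiC (w : ℂ) : ℂ := (w - K.l1 * K.A w) / K.l2

theorem psiC_eq_iff {w z : ℂ} : K.psiC w = z ↔ w = K.l2 * z + K.l1 * K.A w := by
  rw [psiC, div_eq_iff K.ofReal_l2_ne_zero, sub_eq_iff_eq_add, mul_comm z]

theorem hasDerivAt_psiC {w : ℂ} (hw : w.re < K.σ) :
    HasDerivAt K.psiC ((1 - K.l1 * deriv K.A w) / K.l2) w :=
  ((hasDerivAt_id w).sub ((K.hasDerivAt_A hw).const_mul (K.l1 : ℂ))).div_const (K.l2 : ℂ)

theorem analyticAt_psiC {w : ℂ} (hw : w.re < K.σ) : AnalyticAt ℂ K.psiC w :=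
  (analyticAt_id.sub (analyticAt_const.mul (K.analyticAt_A hw))).div analyticAt_const
    K.ofReal_l2_ne_zero

theorem psiC_ofReal {t : ℝ} (ht : t < K.σ) : K.psiC t = K.psi t := by
  rw [psiC, psi, K.A_ofReal t ht]
  push_cast
  rfl

/-- The root `u` of `u = λ₂ z + λ₁ A(u)` in the disk `|u| ≤ τ`, which is unique for
`|z| ≤ R_h`. -/
noncomputable def root (z : ℂ) : ℂ :=
  Classical.epsilon fun u : ℂ => ‖u‖ ≤ K.τ ∧ u = K.l2 * z + K.l1 * K.A u

theorem exists_root_of_norm_le_psi {z : ℂ} {t : ℝ} (ht0 : 0 ≤ t) (ht : t ≤ K.τ)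
    (hz : ‖z‖ ≤ K.psi t) : ∃ u : ℂ, ‖u‖ ≤ t ∧ u = K.l2 * z + K.l1 * K.A u := by
  refine K.exists_root ht0 ht ?_
  have hmul := mul_le_mul_of_nonneg_left hz K.l2_pos.le
  linarith [K.l2_mul_psi_add t]

theorem root_spec {z : ℂ} (hz : ‖z‖ ≤ K.Rh) :
    ‖K.root z‖ ≤ K.τ ∧ K.root z = K.l2 * z + K.l1 * K.A (K.root z) :=
  Classical.epsilon_spec (p := fun u : ℂ => ‖u‖ ≤ K.τ ∧ u = K.l2 * z + K.l1 * K.A u)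
    (K.exists_root_of_norm_le_psi K.tau_pos.le le_rfl hz)

theorem root_eq {z w : ℂ} (hz : ‖z‖ ≤ K.Rh) (hw : ‖w‖ ≤ K.τ)
    (e : w = K.l2 * z + K.l1 * K.A w) : K.root z = w :=
  K.root_unique (K.root_spec hz).1 hw (K.root_spec hz).2 e

theorem psiC_root {z : ℂ} (hz : ‖z‖ ≤ K.Rh) : K.psiC (K.root z) = z :=
  K.psiC_eq_iff.2 (K.root_spec hz).2

theorem norm_root_le {z : ℂ} {t : ℝ} (ht0 : 0 ≤ t) (ht : t ≤ K.τ) (hz : ‖z‖ ≤ K.psi t) :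
    ‖K.root z‖ ≤ t := by
  obtain ⟨w, hw, e⟩ := K.exists_root_of_norm_le_psi ht0 ht hz
  rwa [K.root_eq (hz.trans (K.psi_le_Rh ht)) (hw.trans ht) e]

theorem re_root_lt_sigma {z : ℂ} (hz : ‖z‖ ≤ K.Rh) : (K.root z).re < K.σ :=
  K.re_lt_sigma (K.root_spec hz).1

theorem root_eq_root_iff {z w : ℂ} (hz : ‖z‖ ≤ K.Rh) (hw : ‖w‖ ≤ K.Rh) :
    K.root z = K.root w ↔ z = w :=
  ⟨fun h => by rw [← K.psiC_root hz, h, K.psiC_root hw], fun h => by rw [h]⟩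

theorem root_psi {t : ℝ} (ht0 : 0 ≤ t) (ht : t ≤ K.τ) (hψ : 0 ≤ K.psi t) :
    K.root (K.psi t) = t := by
  refine K.root_eq ?_ ?_ (K.psiC_eq_iff.1 (K.psiC_ofReal (ht.trans_lt K.tau_lt_sigma)))
  · rw [Complex.norm_real, Real.norm_of_nonneg hψ]
    exact K.psi_le_Rh ht
  · rwa [Complex.norm_real, Real.norm_of_nonneg ht0]

theorem one_le_psi {t : ℝ} (h : K.lam ≤ t) (ht : t ≤ K.τ) : 1 ≤ K.psi t := by
  rw [← K.psi_lam]
  exact K.strictMonoOn_psi.monotoneOn K.lam_lt_tau.le ht h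

theorem root_psi_of_lam_le {t : ℝ} (ht0 : K.lam ≤ t) (ht : t ≤ K.τ) : K.root (K.psi t) = t :=
  K.root_psi (K.lam_pos.le.trans ht0) ht (zero_le_one.trans (K.one_le_psi ht0 ht))

theorem root_Rh : K.root K.Rh = K.τ := K.root_psi_of_lam_le K.lam_lt_tau.le le_rfl

theorem exists_root_ofReal {x : ℝ} (hx0 : 0 ≤ x) (hx : x ≤ K.Rh) :
    ∃ y : ℝ, 0 < y ∧ y ≤ K.τ ∧ K.psi y = x ∧ K.root x = y := by
  have hcont : ContinuousOn K.psi (Set.Icc 0 K.τ) := fun y hy =>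
    (K.hasDerivAt_psi (hy.2.trans_lt K.tau_lt_sigma)).continuousAt.continuousWithinAt
  have hψ0 : K.psi 0 < 0 := by
    have hmul := mul_pos K.l1_pos (K.a_pos 0 (K.tau_pos.trans K.tau_lt_sigma))
    exact div_neg_of_neg_of_pos (by linarith) K.l2_pos
  obtain ⟨y, ⟨hy0, hyτ⟩, rfl⟩ :=
    intermediate_value_Icc K.tau_pos.le hcont ⟨hψ0.le.trans hx0, hx⟩
  refine ⟨y, hy0.lt_of_ne ?_, hyτ, rfl, K.root_psi hy0 hyτ hx0⟩
  rintro rfl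
  exact hψ0.not_ge hx0

theorem re_root_lt {z : ℂ} {t : ℝ} (ht0 : K.lam ≤ t) (ht : t ≤ K.τ) (hz : ‖z‖ ≤ K.psi t)
    (hne : z ≠ K.psi t) : (K.root z).re < t := by
  by_contra! h
  have hroot := eq_ofReal_of_norm_le_re (K.norm_root_le (K.lam_pos.le.trans ht0) ht hz) h
  rw [← K.root_psi_of_lam_le ht0 ht] at hroot
  refine hne ((K.root_eq_root_iff (hz.trans (K.psi_le_Rh ht)) ?_).1 hroot)
  rw [Complex.norm_real, Real.norm_of_nonneg ((norm_nonneg z).trans hz)]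
  exact K.psi_le_Rh ht

theorem re_root_lt_tau {z : ℂ} (hz : ‖z‖ ≤ K.Rh) (hne : z ≠ K.Rh) : (K.root z).re < K.τ :=
  K.re_root_lt K.lam_lt_tau.le le_rfl hz hne

theorem ne_ofReal_Rh_of_norm_lt {z : ℂ} (hz : ‖z‖ < K.Rh) : z ≠ K.Rh := by
  rintro rfl
  rw [Complex.norm_real, Real.norm_of_nonneg K.Rh_pos.le] at hz
  exact lt_irrefl _ hz

/-- The values of `root` stay in a compact set, and every cluster point at `z₀` is a root of the
equation at `z₀`, hence equal to `root z₀`. -/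
theorem continuousOn_root : ContinuousOn K.root (closedBall 0 K.Rh) := by
  intro z₀ hz₀
  refine (isCompact_closedBall (0 : ℂ) K.τ).tendsto_nhds_of_unique_mapClusterPt ?_ ?_
  · filter_upwards [self_mem_nhdsWithin] with z hz
    exact mem_closedBall_zero_iff.2 (K.root_spec (mem_closedBall_zero_iff.1 hz)).1
  · intro w hw hcluster
    have hwτ := mem_closedBall_zero_iff.1 hw
    have hlim : Tendsto (K.psiC ∘ K.root) (𝓝[closedBall 0 K.Rh] z₀) (𝓝 z₀) := by
      refine (tendsto_id.mono_left nhdsWithin_le_nhds).congr' ?_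
      filter_upwards [self_mem_nhdsWithin] with z hz
      exact (K.psiC_root (mem_closedBall_zero_iff.1 hz)).symm
    have hclusterΨ : MapClusterPt (K.psiC w) (𝓝[closedBall 0 K.Rh] z₀) (K.psiC ∘ K.root) :=
      hcluster.continuousAt_comp (K.analyticAt_psiC (K.re_lt_sigma hwτ)).continuousAt
    have hΨw : K.psiC w = z₀ := eq_of_nhds_neBot (hclusterΨ.neBot.mono (inf_le_inf_left _ hlim))
    exact (K.root_eq (mem_closedBall_zero_iff.1 hz₀) hwτ (K.psiC_eq_iff.1 hΨw)).symm

theorem l1_mul_norm_deriv_A_lt_one {w : ℂ} (hw : w.re < K.τ) : K.l1 * ‖deriv K.A w‖ < 1 :=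
  (mul_le_mul_of_nonneg_left (K.norm_deriv_A_le w (hw.trans K.tau_lt_sigma)) K.l1_pos.le).trans_lt
    (K.l1_mul_a1_lt_one hw)

theorem one_sub_l1_mul_deriv_A_ne_zero {w : ℂ} (hw : w.re < K.τ) :
    1 - K.l1 * deriv K.A w ≠ 0 := by
  intro h
  have hnorm : K.l1 * ‖deriv K.A w‖ = 1 := by
    rw [← Real.norm_of_nonneg K.l1_pos.le, ← Complex.norm_real, ← norm_mul, ← sub_eq_zero.1 h,
      norm_one]
  exact (K.l1_mul_norm_deriv_A_lt_one hw).ne hnorm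

/-- Off the branch point, `root` is locally a branch of the inverse function of `Ψ`. -/
theorem exists_continuation_root {ζ : ℂ} (hζ : ‖ζ‖ ≤ K.Rh) (hne : ζ ≠ K.Rh) :
    ∃ g : ℂ → ℂ, AnalyticAt ℂ g ζ ∧ g ζ = K.root ζ ∧
      ∀ᶠ z in 𝓝[closedBall 0 K.Rh] ζ, g z = K.root z := by
  have hre := K.re_root_lt_tau hζ hne
  have hreσ := hre.trans K.tau_lt_sigma
  have hΨ := K.analyticAt_psiC hreσ
  have hderiv : deriv K.psiC (K.root ζ) ≠ 0 := by
    rw [(K.hasDerivAt_psiC hreσ).deriv]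
    exact div_ne_zero (K.one_sub_l1_mul_deriv_A_ne_zero hre) K.ofReal_l2_ne_zero
  have hanalytic := hΨ.analyticAt_localInverse hderiv
  have hleft := HasStrictDerivAt.eventually_left_inverse hΨ.hasStrictDerivAt hderiv
  refine ⟨_, K.psiC_root hζ ▸ hanalytic, ?_, ?_⟩
  · simpa only [K.psiC_root hζ] using hleft.self_of_nhds
  · have hcont : Tendsto K.root (𝓝[closedBall 0 K.Rh] ζ) (𝓝 (K.root ζ)) :=
      K.continuousOn_root ζ (mem_closedBall_zero_iff.2 hζ)
    filter_upwards [hcont.eventually hleft, self_mem_nhdsWithin] with z hz hzb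
    rwa [K.psiC_root (mem_closedBall_zero_iff.1 hzb)] at hz

theorem analyticAt_root {z : ℂ} (hz : ‖z‖ < K.Rh) : AnalyticAt ℂ K.root z := by
  obtain ⟨g, hg, -, e⟩ := K.exists_continuation_root hz.le (K.ne_ofReal_Rh_of_norm_lt hz)
  refine hg.congr ?_
  rwa [nhdsWithin_eq_nhds.2 (closedBall_mem_nhds_of_mem (mem_ball_zero_iff.2 hz))] at e

theorem hasDerivAt_root {z : ℂ} (hz : ‖z‖ < K.Rh) :
    HasDerivAt K.root (K.l2 / (1 - K.l1 * deriv K.A (K.root z))) z := by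
  have hroot := (K.analyticAt_root hz).differentiableAt.hasDerivAt
  have hcomp : HasDerivAt (K.psiC ∘ K.root)
      ((1 - K.l1 * deriv K.A (K.root z)) / K.l2 * deriv K.root z) z :=
    (K.hasDerivAt_psiC (K.re_root_lt_sigma hz.le)).comp z hroot
  have hid : HasDerivAt (K.psiC ∘ K.root) 1 z := by
    refine (hasDerivAt_id z).congr_of_eventuallyEq ?_
    filter_upwards [isOpen_ball.mem_nhds (mem_ball_zero_iff.2 hz)] with w hw
    exact K.psiC_root (mem_ball_zero_iff.1 hw).le
  have hne := K.one_sub_l1_mul_deriv_A_ne_zero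
    (K.re_root_lt_tau hz.le (K.ne_ofReal_Rh_of_norm_lt hz))
  have hl2 := K.ofReal_l2_ne_zero
  convert! hroot using 1
  have hprod := hcomp.unique hid
  field_simp at hprod ⊢
  exact hprod.symm

theorem norm_zero_lt_Rh : ‖(0 : ℂ)‖ < K.Rh := by simpa using K.Rh_pos

end BusyKernel

/-! ### Nonnegativity of the coefficients of `u` and `h` -/

namespace BusyKernel

variable (K : BusyKernel)

theorem eventually_norm_lt_Rh : ∀ᶠ z in 𝓝 (0 : ℂ), ‖z‖ < K.Rh :=
  continuous_norm.continuousAt.eventually (gt_mem_nhds K.norm_zero_lt_Rh)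

theorem analyticAt_iteratedDeriv_A {w : ℂ} (hw : w.re < K.σ) (k : ℕ) :
    AnalyticAt ℂ (iteratedDeriv k K.A) w := by
  induction k with
  | zero => simpa using K.analyticAt_A hw
  | succ k ih => rw [iteratedDeriv_succ]; exact ih.deriv

theorem analyticAt_iteratedDeriv_A_root (k : ℕ) :
    AnalyticAt ℂ (fun z => iteratedDeriv k K.A (K.root z)) 0 :=
  (K.analyticAt_iteratedDeriv_A (K.re_root_lt_sigma K.norm_zero_lt_Rh.le) k).comp
    (K.analyticAt_root K.norm_zero_lt_Rh)

theorem exists_root_zero : ∃ y : ℝ, 0 < y ∧ y < K.τ ∧ K.root 0 = y := by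
  obtain ⟨y, hy, -, -, hroot⟩ := K.exists_root_ofReal le_rfl K.Rh_pos.le
  rw [Complex.ofReal_zero] at hroot
  have hre := K.re_root_lt_tau K.norm_zero_lt_Rh.le
    (K.ne_ofReal_Rh_of_norm_lt K.norm_zero_lt_Rh)
  rw [hroot, Complex.ofReal_re] at hre
  exact ⟨y, hy, hre, hroot⟩

theorem iteratedDeriv_A_root_zero_nonneg (k : ℕ) : 0 ≤ iteratedDeriv k K.A (K.root 0) := by
  obtain ⟨y, -, hyτ, hroot⟩ := K.exists_root_zero
  rw [hroot]
  exact K.iteratedDeriv_nonneg k y (hyτ.trans K.tau_lt_sigma)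

theorem l1_mul_deriv_A_root_zero_lt_one : K.l1 * deriv K.A (K.root 0) < 1 := by
  obtain ⟨y, -, hyτ, hroot⟩ := K.exists_root_zero
  rw [hroot, K.deriv_A_ofReal y (hyτ.trans K.tau_lt_sigma)]
  exact_mod_cast K.l1_mul_a1_lt_one hyτ

/-- The derivative is `u' = λ₂ / (1 - λ₁ A'(u))`, a geometric series in `λ₁ A'(u)`. -/
theorem nonnegCoeffUpTo_deriv_root {N : ℕ}
    (hA : NonnegCoeffUpTo (fun z => deriv K.A (K.root z)) N) :
    NonnegCoeffUpTo (deriv K.root) N := by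
  have hl1 : (0 : ℂ) ≤ K.l1 := by exact_mod_cast K.l1_pos.le
  have hl2 : (0 : ℂ) ≤ K.l2 := by exact_mod_cast K.l2_pos.le
  have aA : AnalyticAt ℂ (fun z => deriv K.A (K.root z)) 0 := by
    simpa only [iteratedDeriv_one] using K.analyticAt_iteratedDeriv_A_root 1
  have ag : AnalyticAt ℂ (fun z => K.l1 * deriv K.A (K.root z)) 0 := analyticAt_const.mul aA
  have hne : ∀ᶠ z in 𝓝 (0 : ℂ), 1 - K.l1 * deriv K.A (K.root z) ≠ 0 := by
    filter_upwards [K.eventually_norm_lt_Rh] with z hz using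
      K.one_sub_l1_mul_deriv_A_ne_zero (K.re_root_lt_tau hz.le (K.ne_ofReal_Rh_of_norm_lt hz))
  have aG : AnalyticAt ℂ (fun z => (1 - K.l1 * deriv K.A (K.root z))⁻¹) 0 :=
    (analyticAt_const.sub ag).inv hne.self_of_nhds
  have hgeom : NonnegCoeffUpTo (fun z => (1 - K.l1 * deriv K.A (K.root z))⁻¹) N := by
    refine .of_eq_add_mul (.const zero_le_one N) (hA.const_mul hl1 aA)
      K.l1_mul_deriv_A_root_zero_lt_one aG analyticAt_const ag ?_
    filter_upwards [hne] with z hz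
    field_simp
    ring
  refine (hgeom.const_mul hl2 aG).congr ?_
  filter_upwards [K.eventually_norm_lt_Rh] with z hz
  rw [(K.hasDerivAt_root hz).deriv, div_eq_mul_inv]

theorem deriv_iteratedDeriv_A_root (k : ℕ) :
    deriv (fun z => iteratedDeriv k K.A (K.root z)) =ᶠ[𝓝 0]
      fun z => iteratedDeriv (k + 1) K.A (K.root z) * deriv K.root z := by
  filter_upwards [K.eventually_norm_lt_Rh] with z hz
  have hA := (K.analyticAt_iteratedDeriv_A (K.re_root_lt_sigma hz.le) k).differentiableAt.hasDerivAt
  rw [iteratedDeriv_succ]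
  exact (hA.comp z (K.analyticAt_root hz).differentiableAt.hasDerivAt).deriv

theorem nonnegCoeff_iteratedDeriv_A_root (k : ℕ) :
    NonnegCoeff fun z => iteratedDeriv k K.A (K.root z) := by
  intro N
  induction N generalizing k with
  | zero =>
    intro n hn
    obtain rfl := Nat.le_zero.1 hn
    simpa only [iteratedDeriv_zero] using K.iteratedDeriv_A_root_zero_nonneg k
  | succ N ih =>
    have hroot : NonnegCoeffUpTo (deriv K.root) N :=
      K.nonnegCoeffUpTo_deriv_root (by simpa only [iteratedDeriv_one] using ih 1)
    exact .of_deriv (K.iteratedDeriv_A_root_zero_nonneg k)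
      (((ih (k + 1)).mul hroot (K.analyticAt_iteratedDeriv_A_root (k + 1))
        (K.analyticAt_root K.norm_zero_lt_Rh).deriv).congr (K.deriv_iteratedDeriv_A_root k).symm)

/-- The busy period transform `h = A ∘ u`, extended to the disk `|z| ≤ R_h`. -/
noncomputable def hExt (z : ℂ) : ℂ := K.A (K.root z)

theorem nonnegCoeff_hExt : NonnegCoeff K.hExt := by
  simpa only [iteratedDeriv_zero] using! K.nonnegCoeff_iteratedDeriv_A_root 0

theorem analyticAt_hExt {z : ℂ} (hz : ‖z‖ < K.Rh) : AnalyticAt ℂ K.hExt z :=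
  (K.analyticAt_A (K.re_root_lt_sigma hz.le)).comp (K.analyticAt_root hz)

theorem differentiableOn_hExt : DifferentiableOn ℂ K.hExt (ball 0 K.Rh) := fun _ hz =>
  (K.analyticAt_hExt (mem_ball_zero_iff.1 hz)).differentiableAt.differentiableWithinAt

theorem l1_mul_hExt {z : ℂ} (hz : ‖z‖ ≤ K.Rh) : K.l1 * K.hExt z = K.root z - K.l2 * z := by
  have hroot := (K.root_spec hz).2
  rw [hExt]
  linear_combination -hroot

theorem hExt_psi {t : ℝ} (ht0 : K.lam ≤ t) (ht : t ≤ K.τ) : K.hExt (K.psi t) = K.a t := by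
  rw [hExt, K.root_psi_of_lam_le ht0 ht, K.A_ofReal t (ht.trans_lt K.tau_lt_sigma)]

theorem hExt_one : K.hExt 1 = 1 := by
  simpa only [K.psi_lam, K.a_lam, Complex.ofReal_one] using K.hExt_psi le_rfl K.lam_lt_tau.le

theorem norm_lt_Rh_of_lt_one {z : ℂ} (hz : ‖z‖ < 1) : ‖z‖ < K.Rh := hz.trans K.one_lt_Rh

theorem re_root_lt_lam {z : ℂ} (hz : ‖z‖ < 1) : (K.root z).re < K.lam := by
  refine K.re_root_lt le_rfl K.lam_lt_tau.le (by rw [K.psi_lam]; exact hz.le) ?_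
  rintro rfl
  simp [K.psi_lam] at hz

theorem norm_hExt_lt_one {z : ℂ} (hz : ‖z‖ < 1) : ‖K.hExt z‖ < 1 := by
  have hre := K.re_root_lt_lam hz
  rw [← K.a_lam]
  exact (K.norm_A_le (K.root z) (hre.trans K.lam_lt_sigma)).trans_lt
    (K.strictMonoOn_a (hre.trans K.lam_lt_sigma) K.lam_lt_sigma hre)

theorem hExt_eq_A {z : ℂ} (hz : ‖z‖ < 1) :
    K.hExt z = K.A (K.l1 * K.hExt z + K.l2 * z) := by
  rw [K.l1_mul_hExt (K.norm_lt_Rh_of_lt_one hz).le, sub_add_cancel]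
  rfl

theorem eq_hExt_of_eq_A {z w : ℂ} (hz : ‖z‖ < 1) (hw : ‖w‖ < 1)
    (e : w = K.A (K.l1 * w + K.l2 * z)) : w = K.hExt z := by
  have hnorm : ‖(K.l1 : ℂ) * w + K.l2 * z‖ ≤ K.τ := by
    have hl1 := K.l1_pos.le
    have hl2 := K.l2_pos.le
    calc ‖(K.l1 : ℂ) * w + K.l2 * z‖ ≤ ‖(K.l1 : ℂ) * w‖ + ‖(K.l2 : ℂ) * z‖ := norm_add_le _ _
      _ = K.l1 * ‖w‖ + K.l2 * ‖z‖ := by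
        rw [norm_mul, norm_mul, Complex.norm_real, Complex.norm_real,
          Real.norm_of_nonneg hl1, Real.norm_of_nonneg hl2]
      _ ≤ K.l1 * 1 + K.l2 * 1 := by gcongr
      _ ≤ K.τ := by linarith [K.add_lt_tau]
  rw [hExt, K.root_eq (K.norm_lt_Rh_of_lt_one hz).le hnorm (by rw [← e]; ring)]
  exact e

/-! ### The divided difference of `A` at `λ` -/

/-- The divided difference of `A` at the total rate `λ`: it equals `(A(w) - 1) / (w - λ)` off `λ`
and `A'(λ)` at `λ`. -/
noncomputable def slopeA : ℂ → ℂ := dslope K.A (K.lam : ℂ)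

/-- The restriction of `slopeA` to the real line, written as an average of `a'` over the segment
from `λ` to `x`. -/
noncomputable def realSlope (x : ℝ) : ℝ := ∫ t in (0 : ℝ)..1, K.a1 (K.lam + t * (x - K.lam))

theorem lam_add_mul_sub_lt {x : ℝ} (hx : x < K.σ) {t : ℝ} (ht : t ∈ Set.Icc (0 : ℝ) 1) :
    K.lam + t * (x - K.lam) < K.σ :=
  (convex_Iio K.σ).add_smul_sub_mem (x := K.lam) (y := x) K.lam_lt_sigma hx ht

theorem A_lam : K.A (K.lam : ℂ) = 1 := by
  rw [K.A_ofReal _ K.lam_lt_sigma, K.a_lam, Complex.ofReal_one]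

theorem analyticAt_slopeA {w : ℂ} (hw : w.re < K.σ) : AnalyticAt ℂ K.slopeA w := by
  have hdiff : DifferentiableOn ℂ K.slopeA {u : ℂ | u.re < K.σ} :=
    (Complex.differentiableOn_dslope
      (K.isOpen_halfPlane.mem_nhds (by simpa using K.lam_lt_sigma))).2 K.differentiableOn_A
  exact hdiff.analyticAt (K.isOpen_halfPlane.mem_nhds hw)

theorem sub_lam_mul_slopeA (w : ℂ) : (w - K.lam) * K.slopeA w = K.A w - 1 := by
  rw [← K.A_lam, slopeA, ← smul_eq_mul]
  exact sub_smul_dslope _ _ _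

theorem slopeA_eq_integral {w : ℂ} (hw : w.re < K.σ) :
    K.slopeA w = ∫ t in (0 : ℝ)..1, deriv K.A ((K.lam : ℂ) + t • (w - K.lam)) := by
  rcases eq_or_ne w K.lam with rfl | hne
  · simp [slopeA]
  · refine mul_left_cancel₀ (sub_ne_zero.2 hne) ?_
    rw [K.sub_lam_mul_slopeA, ← K.A_lam]
    exact K.A_sub_A hw (by simpa using K.lam_lt_sigma)

theorem norm_slopeA_le {w : ℂ} (hw : w.re < K.σ) : ‖K.slopeA w‖ ≤ K.realSlope w.re := by
  rw [K.slopeA_eq_integral hw]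
  simpa [realSlope] using
    K.norm_integral_deriv_A_le (v := K.lam) hw (by simpa using K.lam_lt_sigma)

theorem slopeA_ofReal {x : ℝ} (hx : x < K.σ) : K.slopeA x = K.realSlope x := by
  rw [K.slopeA_eq_integral (by simpa using hx), realSlope, ← intervalIntegral.integral_ofReal]
  refine intervalIntegral.integral_congr fun t ht => ?_
  rw [Set.uIcc_of_le zero_le_one] at ht
  simp only [← K.deriv_A_ofReal _ (K.lam_add_mul_sub_lt hx ht)]
  simp

theorem strictMonoOn_realSlope : StrictMonoOn K.realSlope (Set.Iio K.σ) := by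
  intro x hx y hy hxy
  refine intervalIntegral.integral_lt_integral_of_continuousOn_of_le_of_exists_lt zero_lt_one
    (K.continuousOn_a1_segment hx K.lam_lt_sigma) (K.continuousOn_a1_segment hy K.lam_lt_sigma)
    (fun t ht => ?_) ⟨1, by simp, ?_⟩
  · have ht' : t ∈ Set.Icc (0 : ℝ) 1 := ⟨ht.1.le, ht.2⟩
    refine K.strictMonoOn_a1.monotoneOn (K.lam_add_mul_sub_lt hx ht')
      (K.lam_add_mul_sub_lt hy ht') ?_
    linarith [mul_le_mul_of_nonneg_left hxy.le ht'.1]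
  · refine K.strictMonoOn_a1 (K.lam_add_mul_sub_lt hx (by simp))
      (K.lam_add_mul_sub_lt hy (by simp)) ?_
    linarith

theorem lam_mul_realSlope_lam_lt_one : K.lam * K.realSlope K.lam < 1 := by
  simpa [realSlope] using K.lam_mul_a1_lam_lt_one

theorem realSlope_pos {x : ℝ} (hx : x < K.σ) : 0 < K.realSlope x :=
  intervalIntegral.intervalIntegral_pos_of_pos_on
    ((K.continuousOn_a1_segment hx K.lam_lt_sigma).intervalIntegrable_of_Icc zero_le_one)
    (fun _ ht => K.a1_pos _ (K.lam_add_mul_sub_lt hx ⟨ht.1.le, ht.2.le⟩)) zero_lt_one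

theorem continuousOn_realSlope : ContinuousOn K.realSlope (Set.Iio K.σ) := by
  intro x hx
  have hcont : ContinuousAt (fun x : ℝ => (K.slopeA x).re) x :=
    Complex.continuous_re.continuousAt.comp
      ((K.analyticAt_slopeA (w := (x : ℂ)) (by simpa using hx)).continuousAt.comp
        Complex.continuous_ofReal.continuousAt)
  refine (hcont.congr ?_).continuousWithinAt
  filter_upwards [Iio_mem_nhds hx] with y hy
  rw [K.slopeA_ofReal hy, Complex.ofReal_re]

theorem l2_mul_hExt_sub {z : ℂ} (hz : ‖z‖ ≤ K.Rh) :
    K.l2 * (K.hExt z - z) = (K.root z - K.lam) * (K.lam * K.slopeA (K.root z) - 1) := by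
  have hh := K.l1_mul_hExt hz
  have hslope : (K.root z - K.lam) * K.slopeA (K.root z) = K.hExt z - 1 := K.sub_lam_mul_slopeA _
  have hlam : (K.lam : ℂ) = K.l1 + K.l2 := by simp [lam]
  linear_combination -hh - K.lam * hslope - K.hExt z * hlam

/-! ### The function `f₁` -/

/-- The function `f₁ = (1 - h) / (h - z)`, without the removable singularity at `1`. -/
noncomputable def f1Ext (z : ℂ) : ℂ :=
  K.l2 * K.slopeA (K.root z) / (1 - K.lam * K.slopeA (K.root z))

theorem hExt_sub_mul_f1Ext {z : ℂ} (hz : ‖z‖ ≤ K.Rh)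
    (hne : 1 - K.lam * K.slopeA (K.root z) ≠ 0) :
    (K.hExt z - z) * K.f1Ext z = 1 - K.hExt z := by
  have hsub := K.l2_mul_hExt_sub hz
  have hslope : (K.root z - K.lam) * K.slopeA (K.root z) = K.hExt z - 1 := K.sub_lam_mul_slopeA _
  rw [f1Ext, mul_div_assoc', div_eq_iff hne]
  linear_combination K.slopeA (K.root z) * hsub - (1 - K.lam * K.slopeA (K.root z)) * hslope

theorem root_one : K.root 1 = K.lam := by
  simpa only [K.psi_lam, Complex.ofReal_one] using K.root_psi_of_lam_le le_rfl K.lam_lt_tau.le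

theorem hExt_sub_ne_zero {z : ℂ} (hz : ‖z‖ ≤ K.Rh) (hz1 : z ≠ 1)
    (hne : 1 - K.lam * K.slopeA (K.root z) ≠ 0) : K.hExt z - z ≠ 0 := by
  intro h
  have hsub := K.l2_mul_hExt_sub hz
  rw [h, mul_zero, ← K.root_one] at hsub
  rcases mul_eq_zero.1 hsub.symm with hroot | hslope
  · exact hz1 ((K.root_eq_root_iff hz (by simpa using K.one_lt_Rh.le)).1 (sub_eq_zero.1 hroot))
  · rw [K.root_one] at hslope
    exact hne (by linear_combination -hslope)

theorem f1Ext_eq {z : ℂ} (hz : ‖z‖ ≤ K.Rh) (hz1 : z ≠ 1)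
    (hne : 1 - K.lam * K.slopeA (K.root z) ≠ 0) :
    K.f1Ext z = (1 - K.hExt z) / (K.hExt z - z) := by
  rw [eq_div_iff (K.hExt_sub_ne_zero hz hz1 hne), mul_comm]
  exact K.hExt_sub_mul_f1Ext hz hne

theorem norm_lam_mul_slopeA_lt_one {t : ℝ} (ht : t ≤ K.τ) (hslope : K.lam * K.realSlope t ≤ 1)
    {w : ℂ} (hw : w.re < t) : ‖K.lam * K.slopeA w‖ < 1 := by
  have htσ := ht.trans_lt K.tau_lt_sigma
  rw [norm_mul, Complex.norm_real, Real.norm_of_nonneg K.lam_pos.le]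
  calc K.lam * ‖K.slopeA w‖ ≤ K.lam * K.realSlope w.re :=
        mul_le_mul_of_nonneg_left (K.norm_slopeA_le (hw.trans htσ)) K.lam_pos.le
    _ < K.lam * K.realSlope t :=
        mul_lt_mul_of_pos_left (K.strictMonoOn_realSlope (hw.trans htσ) htσ hw) K.lam_pos
    _ ≤ 1 := hslope

theorem one_sub_ne_zero_of_norm_lt_one {w : ℂ} (h : ‖w‖ < 1) : 1 - w ≠ 0 := by
  rw [sub_ne_zero]
  rintro rfl
  simp at h

theorem one_sub_lam_mul_slopeA_ne_zero {t : ℝ} (ht0 : K.lam ≤ t) (ht : t ≤ K.τ)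
    (hslope : K.lam * K.realSlope t ≤ 1) {z : ℂ} (hz : ‖z‖ ≤ K.psi t) (hne : z ≠ K.psi t) :
    1 - K.lam * K.slopeA (K.root z) ≠ 0 :=
  one_sub_ne_zero_of_norm_lt_one
    (K.norm_lam_mul_slopeA_lt_one ht hslope (K.re_root_lt ht0 ht hz hne))

theorem one_sub_lam_mul_slopeA_ne_zero_of_lt_one {z : ℂ} (hz : ‖z‖ < 1) :
    1 - K.lam * K.slopeA (K.root z) ≠ 0 :=
  one_sub_ne_zero_of_norm_lt_one (K.norm_lam_mul_slopeA_lt_one K.lam_lt_tau.le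
    K.lam_mul_realSlope_lam_lt_one.le (K.re_root_lt_lam hz))

theorem f1Ext_eq_of_lt_one {z : ℂ} (hz : ‖z‖ < 1) :
    K.f1Ext z = (1 - K.hExt z) / (K.hExt z - z) := by
  refine K.f1Ext_eq (K.norm_lt_Rh_of_lt_one hz).le ?_
    (K.one_sub_lam_mul_slopeA_ne_zero_of_lt_one hz)
  rintro rfl
  simp at hz

theorem analyticAt_f1Ext {z : ℂ} (hz : ‖z‖ < K.Rh)
    (hne : 1 - K.lam * K.slopeA (K.root z) ≠ 0) : AnalyticAt ℂ K.f1Ext z := by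
  have hslope : AnalyticAt ℂ (fun z => K.slopeA (K.root z)) z :=
    (K.analyticAt_slopeA (K.re_root_lt_sigma hz.le)).comp (K.analyticAt_root hz)
  exact (analyticAt_const.mul hslope).div
    (analyticAt_const.sub (analyticAt_const.mul hslope)) hne

/-- The generating function `η = (1 - h) / (1 - z)` of the tails of the distribution with
generating function `h`. It satisfies `f₁ = η / (1 - η)`. -/
noncomputable def hTail (z : ℂ) : ℂ := (1 - K.hExt z) / (1 - z)

theorem eventually_norm_lt_one : ∀ᶠ z : ℂ in 𝓝 0, ‖z‖ < 1 :=
  continuous_norm.continuousAt.eventually (gt_mem_nhds (by simp))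

theorem analyticAt_hTail_zero : AnalyticAt ℂ K.hTail 0 :=
  (analyticAt_const.sub (K.analyticAt_hExt K.norm_zero_lt_Rh)).div
    (analyticAt_const.sub analyticAt_id) (by simp)

theorem nonnegCoeff_hTail : NonnegCoeff K.hTail := by
  refine K.nonnegCoeff_hExt.tail (K.analyticAt_hExt K.norm_zero_lt_Rh) K.analyticAt_hTail_zero
    ?_ fun n => ?_
  · filter_upwards [eventually_norm_lt_one] with z hz
    have hne := one_sub_ne_zero_of_norm_lt_one hz
    simp only [hTail]
    field_simp
    ring
  · have hsum := K.nonnegCoeff_hExt.hasSum_coeff K.differentiableOn_hExt zero_le_one K.one_lt_Rh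
    have hpartial := sum_le_hasSum (Finset.range (n + 1))
      (fun k _ => mul_nonneg (K.nonnegCoeff_hExt.coeff_nonneg k) (by positivity)) hsum
    simpa [K.hExt_one] using hpartial

theorem hTail_zero_lt_one : K.hTail 0 < 1 := by
  obtain ⟨y, -, hyτ, hroot⟩ := K.exists_root_zero
  have hyσ := hyτ.trans K.tau_lt_sigma
  have hval : K.hTail 0 = ((1 - K.a y : ℝ) : ℂ) := by
    simp [hTail, hExt, hroot, K.A_ofReal y hyσ]
  rw [hval]
  exact_mod_cast sub_lt_self 1 (K.a_pos y hyσ)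

theorem nonnegCoeff_f1Ext : NonnegCoeff K.f1Ext := by
  intro N
  have hf1 : AnalyticAt ℂ K.f1Ext 0 := K.analyticAt_f1Ext K.norm_zero_lt_Rh
    (K.one_sub_lam_mul_slopeA_ne_zero_of_lt_one (by simp))
  refine .of_eq_add_mul (K.nonnegCoeff_hTail N) (K.nonnegCoeff_hTail N) K.hTail_zero_lt_one hf1
    K.analyticAt_hTail_zero K.analyticAt_hTail_zero ?_
  filter_upwards [eventually_norm_lt_one] with z hz
  have hne := one_sub_ne_zero_of_norm_lt_one hz
  have hmul := K.hExt_sub_mul_f1Ext (K.norm_lt_Rh_of_lt_one hz).le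
    (K.one_sub_lam_mul_slopeA_ne_zero_of_lt_one hz)
  simp only [hTail]
  field_simp
  linear_combination hmul

end BusyKernel

/-! ### The functions `Q`, `R` and `P₂` -/

/-- A kernel with a point `t ∈ (λ, τ]`, at whose image `ψ(t)` the dominant singularity of `R` and
`P₂` will be located, the exponent factor `c = λ/ν` and the value `q0` of `Q` at `1`. -/
structure RetrialModel extends BusyKernel where
  t : ℝ
  c : ℝ
  q0 : ℝ
  lam_lt_t : toBusyKernel.lam < t
  t_le_tau : t ≤ τ
  lam_mul_realSlope_t_le_one : toBusyKernel.lam * toBusyKernel.realSlope t ≤ 1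
  c_pos : 0 < c
  q0_pos : 0 < q0

namespace RetrialModel

variable (S : RetrialModel)

/-- The dominant singularity `ψ(t)` of `R` and `P₂`. -/
noncomputable def r : ℝ := S.psi S.t

theorem one_lt_r : 1 < S.r := S.one_lt_psi S.lam_lt_t S.t_le_tau

theorem r_pos : 0 < S.r := zero_lt_one.trans S.one_lt_r

theorem r_le_Rh : S.r ≤ S.Rh := S.psi_le_Rh S.t_le_tau

theorem t_lt_sigma : S.t < S.σ := S.t_le_tau.trans_lt S.tau_lt_sigma

theorem root_r : S.root S.r = S.t := S.root_psi_of_lam_le S.lam_lt_t.le S.t_le_tau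

theorem norm_r : ‖(S.r : ℂ)‖ = S.r := by
  rw [Complex.norm_real, Real.norm_of_nonneg S.r_pos.le]

theorem ne_ofReal_r_of_norm_lt {z : ℂ} (hz : ‖z‖ < S.r) : z ≠ S.r := by
  rintro rfl
  rw [S.norm_r] at hz
  exact lt_irrefl _ hz

theorem ball_subset_closedBall_Rh : ball (0 : ℂ) S.r ⊆ closedBall 0 S.Rh :=
  (ball_subset_ball S.r_le_Rh).trans ball_subset_closedBall

theorem norm_zero_lt_r : ‖(0 : ℂ)‖ < S.r := by simpa using S.r_pos

theorem eventually_norm_lt_r {z : ℂ} (hz : ‖z‖ < S.r) : ∀ᶠ w in 𝓝 z, ‖w‖ < S.r :=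
  continuous_norm.continuousAt.eventually (gt_mem_nhds hz)

theorem one_sub_lam_mul_slopeA_root_ne_zero {z : ℂ} (hz : ‖z‖ ≤ S.r) (hne : z ≠ S.r) :
    1 - S.lam * S.slopeA (S.root z) ≠ 0 :=
  S.one_sub_lam_mul_slopeA_ne_zero S.lam_lt_t.le S.t_le_tau S.lam_mul_realSlope_t_le_one hz hne

theorem analyticAt_f1Ext_of_norm_lt_r {z : ℂ} (hz : ‖z‖ < S.r) : AnalyticAt ℂ S.f1Ext z :=
  S.analyticAt_f1Ext (hz.trans_le S.r_le_Rh)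
    (S.one_sub_lam_mul_slopeA_root_ne_zero hz.le (S.ne_ofReal_r_of_norm_lt hz))

theorem differentiableOn_f1Ext : DifferentiableOn ℂ S.f1Ext (ball 0 S.r) := fun _ hz =>
  (S.analyticAt_f1Ext_of_norm_lt_r
    (mem_ball_zero_iff.1 hz)).differentiableAt.differentiableWithinAt

theorem continuesAcross_f1Ext {ζ : ℂ} (hζ : ‖ζ‖ = S.r) (hne : ζ ≠ S.r) :
    ContinuesAcross S.f1Ext S.r ζ := by
  have hζR : ‖ζ‖ ≤ S.Rh := hζ.le.trans S.r_le_Rh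
  have hneR : ζ ≠ S.Rh := by
    rintro rfl
    rw [Complex.norm_real, Real.norm_of_nonneg S.Rh_pos.le] at hζ
    exact hne (by rw [hζ])
  obtain ⟨g, hg, hgζ, e⟩ := S.exists_continuation_root hζR hneR
  have hslope : AnalyticAt ℂ (fun z => S.slopeA (g z)) ζ := by
    refine AnalyticAt.fun_comp ?_ hg
    rw [hgζ]
    exact S.analyticAt_slopeA (S.re_root_lt_sigma hζR)
  refine ⟨fun z => S.l2 * S.slopeA (g z) / (1 - S.lam * S.slopeA (g z)),
    (analyticAt_const.mul hslope).div (analyticAt_const.sub (analyticAt_const.mul hslope)) ?_, ?_⟩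
  · rw [hgζ]
    exact S.one_sub_lam_mul_slopeA_root_ne_zero hζ.le hne
  · filter_upwards [nhdsWithin_mono _ S.ball_subset_closedBall_Rh e] with z hz
    rw [hz, BusyKernel.f1Ext]

theorem exists_f1Primitive :
    ∃ P : ℂ → ℂ, P 0 = 0 ∧ ∀ z ∈ ball (0 : ℂ) S.r, HasDerivAt P (S.f1Ext z) z := by
  obtain ⟨P, hP⟩ := S.differentiableOn_f1Ext.isExactOn_ball
  refine ⟨fun z => P z - P 0, sub_self _, fun z hz => ?_⟩
  simpa using! (hP z hz).sub_const (P 0)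

/-- The primitive of `f₁` on the disk `|z| < r` that vanishes at `0`. -/
noncomputable def f1Primitive : ℂ → ℂ := Classical.choose S.exists_f1Primitive

theorem f1Primitive_zero : S.f1Primitive 0 = 0 := (Classical.choose_spec S.exists_f1Primitive).1

theorem hasDerivAt_f1Primitive {z : ℂ} (hz : ‖z‖ < S.r) :
    HasDerivAt S.f1Primitive (S.f1Ext z) z :=
  (Classical.choose_spec S.exists_f1Primitive).2 z (mem_ball_zero_iff.2 hz)

theorem differentiableOn_f1Primitive : DifferentiableOn ℂ S.f1Primitive (ball 0 S.r) :=
  fun _ hz => (S.hasDerivAt_f1Primitive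
    (mem_ball_zero_iff.1 hz)).differentiableAt.differentiableWithinAt

theorem nonnegCoeff_f1Primitive : NonnegCoeff S.f1Primitive := by
  intro N
  have hderiv : NonnegCoeffUpTo (deriv S.f1Primitive) N := by
    refine (S.nonnegCoeff_f1Ext N).congr ?_
    filter_upwards [S.eventually_norm_lt_r S.norm_zero_lt_r] with z hz
    exact (S.hasDerivAt_f1Primitive hz).deriv.symm
  exact (NonnegCoeffUpTo.of_deriv (by rw [S.f1Primitive_zero]) hderiv).mono (Nat.le_succ N)

theorem f1Primitive_one : S.f1Primitive 1 = ((S.f1Primitive 1).re : ℂ) := by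
  simpa only [Complex.ofReal_one] using
    S.nonnegCoeff_f1Primitive.eq_ofReal S.differentiableOn_f1Primitive zero_le_one S.one_lt_r

/-- The function `Q`, extended to the disk `|z| < r`. -/
noncomputable def Q (z : ℂ) : ℂ :=
  S.q0 * Complex.exp (S.c * (S.f1Primitive z - S.f1Primitive 1))

/-- The function `R = (λ/λ₂) f₁ Q`, extended to the disk `|z| < r`. -/
noncomputable def R (z : ℂ) : ℂ := (S.lam / S.l2 : ℝ) * (S.f1Ext z * S.Q z)

/-- The function `P₂ = Q + R`, extended to the disk `|z| < r`. -/
noncomputable def P2 (z : ℂ) : ℂ := S.Q z + S.R z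

theorem hasDerivAt_Q {z : ℂ} (hz : ‖z‖ < S.r) :
    HasDerivAt S.Q (S.c * S.f1Ext z * S.Q z) z := by
  refine (((((S.hasDerivAt_f1Primitive hz).sub_const (S.f1Primitive 1)).const_mul
    (S.c : ℂ)).cexp).const_mul (S.q0 : ℂ)).congr_deriv ?_
  rw [Q]
  ring

theorem differentiableOn_Q : DifferentiableOn ℂ S.Q (ball 0 S.r) := fun _ hz =>
  (S.hasDerivAt_Q (mem_ball_zero_iff.1 hz)).differentiableAt.differentiableWithinAt

theorem differentiableOn_R : DifferentiableOn ℂ S.R (ball 0 S.r) :=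
  (S.differentiableOn_f1Ext.mul S.differentiableOn_Q).const_mul _

theorem differentiableOn_P2 : DifferentiableOn ℂ S.P2 (ball 0 S.r) :=
  S.differentiableOn_Q.add S.differentiableOn_R

theorem analyticAt_f1Ext_zero : AnalyticAt ℂ S.f1Ext 0 :=
  S.analyticAt_f1Ext_of_norm_lt_r S.norm_zero_lt_r

theorem analyticAt_Q_zero : AnalyticAt ℂ S.Q 0 :=
  S.differentiableOn_Q.analyticAt (ball_mem_nhds _ S.r_pos)

theorem analyticAt_R_zero : AnalyticAt ℂ S.R 0 :=
  S.differentiableOn_R.analyticAt (ball_mem_nhds _ S.r_pos)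

theorem Q_zero_nonneg : 0 ≤ S.Q 0 := by
  have hval : S.Q 0 = ((S.q0 * Real.exp (S.c * (0 - (S.f1Primitive 1).re)) : ℝ) : ℂ) := by
    rw [Q, S.f1Primitive_zero, S.f1Primitive_one]
    push_cast
    rfl
  rw [hval]
  exact_mod_cast mul_nonneg S.q0_pos.le (Real.exp_pos _).le

theorem nonnegCoeff_Q : NonnegCoeff S.Q := by
  have hc : (0 : ℂ) ≤ S.c := by exact_mod_cast S.c_pos.le
  refine .of_deriv_eq_mul (g := fun z => S.c * S.f1Ext z)
    (fun N => (S.nonnegCoeff_f1Ext N).const_mul hc S.analyticAt_f1Ext_zero) S.Q_zero_nonneg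
    S.analyticAt_Q_zero (analyticAt_const.mul S.analyticAt_f1Ext_zero) ?_
  filter_upwards [S.eventually_norm_lt_r S.norm_zero_lt_r] with z hz
  exact (S.hasDerivAt_Q hz).deriv

theorem lam_div_l2_pos : 0 < S.lam / S.l2 := div_pos S.lam_pos S.l2_pos

theorem nonnegCoeff_R : NonnegCoeff S.R := fun N =>
  ((S.nonnegCoeff_f1Ext N).mul (S.nonnegCoeff_Q N) S.analyticAt_f1Ext_zero
    S.analyticAt_Q_zero).const_mul (by exact_mod_cast S.lam_div_l2_pos.le)
    (S.analyticAt_f1Ext_zero.mul S.analyticAt_Q_zero)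

theorem nonnegCoeff_P2 : NonnegCoeff S.P2 := fun N =>
  (S.nonnegCoeff_Q N).add (S.nonnegCoeff_R N) S.analyticAt_Q_zero S.analyticAt_R_zero

theorem continuesAcross_Q {ζ : ℂ} (hζ : ‖ζ‖ = S.r) (hne : ζ ≠ S.r) :
    ContinuesAcross S.Q S.r ζ := by
  obtain ⟨G, hG, e⟩ := (S.continuesAcross_f1Ext hζ hne).primitive (P := S.f1Primitive)
    fun z hz => S.hasDerivAt_f1Primitive (mem_ball_zero_iff.1 hz)
  refine ⟨fun z => S.q0 * Complex.exp (S.c * (G z - S.f1Primitive 1)),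
    analyticAt_const.mul (analyticAt_const.mul (hG.sub analyticAt_const)).cexp, ?_⟩
  filter_upwards [e] with z hz
  rw [hz, Q]

theorem continuesAcross_R {ζ : ℂ} (hζ : ‖ζ‖ = S.r) (hne : ζ ≠ S.r) :
    ContinuesAcross S.R S.r ζ :=
  ((S.continuesAcross_f1Ext hζ hne).mul (S.continuesAcross_Q hζ hne)).const_mul _

theorem continuesAcross_P2 {ζ : ℂ} (hζ : ‖ζ‖ = S.r) (hne : ζ ≠ S.r) :
    ContinuesAcross S.P2 S.r ζ :=
  (S.continuesAcross_Q hζ hne).add (S.continuesAcross_R hζ hne)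

/-! ### Blow-up at `r` when `λ` times the divided difference is `1` at `t` -/

theorem eventually_nhdsLT_r : ∀ᶠ x : ℝ in 𝓝[<] S.r, 0 ≤ x ∧ x < S.r := by
  filter_upwards [self_mem_nhdsWithin,
    mem_nhdsWithin_of_mem_nhds (lt_mem_nhds S.r_pos)] with x hx hx'
  exact ⟨le_of_lt hx', hx⟩

theorem tendsto_root_nhdsLT_r : Tendsto (fun x : ℝ => S.root x) (𝓝[<] S.r) (𝓝 (S.t : ℂ)) := by
  have hcont : Tendsto S.root (𝓝[ball 0 S.r] (S.r : ℂ)) (𝓝 (S.root S.r)) :=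
    (S.continuousOn_root S.r (mem_closedBall_zero_iff.2 (S.norm_r.le.trans S.r_le_Rh))).mono_left
      (nhdsWithin_mono _ S.ball_subset_closedBall_Rh)
  rw [S.root_r] at hcont
  exact hcont.comp (tendsto_ofReal_nhdsLT_nhdsWithin_ball S.r_pos)

theorem tendsto_slopeA_root_nhdsLT_r :
    Tendsto (fun x : ℝ => S.slopeA (S.root x)) (𝓝[<] S.r) (𝓝 (S.realSlope S.t : ℂ)) := by
  rw [← S.slopeA_ofReal S.t_lt_sigma]
  exact (S.analyticAt_slopeA (by simpa using S.t_lt_sigma)).continuousAt.tendsto.comp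
    S.tendsto_root_nhdsLT_r

theorem tendsto_norm_f1Ext (h : S.lam * S.realSlope S.t = 1) :
    Tendsto (fun x : ℝ => ‖S.f1Ext x‖) (𝓝[<] S.r) atTop := by
  have hnum : Tendsto (fun x : ℝ => ‖(S.l2 : ℂ) * S.slopeA (S.root x)‖) (𝓝[<] S.r)
      (𝓝 ‖(S.l2 : ℂ) * S.realSlope S.t‖) := (S.tendsto_slopeA_root_nhdsLT_r.const_mul _).norm
  have hnum_pos : 0 < ‖(S.l2 : ℂ) * S.realSlope S.t‖ := norm_pos_iff.2
    (mul_ne_zero S.ofReal_l2_ne_zero (by exact_mod_cast (S.realSlope_pos S.t_lt_sigma).ne'))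
  have hden : Tendsto (fun x : ℝ => ‖1 - (S.lam : ℂ) * S.slopeA (S.root x)‖) (𝓝[<] S.r)
      (𝓝[>] 0) := by
    refine tendsto_nhdsWithin_iff.2 ⟨?_, ?_⟩
    · have hlim := ((S.tendsto_slopeA_root_nhdsLT_r.const_mul (S.lam : ℂ)).const_sub 1).norm
      have hone : (S.lam : ℂ) * S.realSlope S.t = 1 := by exact_mod_cast h
      simpa only [hone, sub_self, norm_zero] using hlim
    · filter_upwards [S.eventually_nhdsLT_r] with x hx
      have hxr : ‖(x : ℂ)‖ < S.r := by
        rw [Complex.norm_real, Real.norm_of_nonneg hx.1]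
        exact hx.2
      exact norm_pos_iff.2
        (S.one_sub_lam_mul_slopeA_root_ne_zero hxr.le (S.ne_ofReal_r_of_norm_lt hxr))
  refine (hnum.pos_mul_atTop hnum_pos hden.inv_tendsto_nhdsGT_zero).congr fun x => ?_
  rw [BusyKernel.f1Ext, norm_div, div_eq_mul_inv]
  rfl

theorem norm_Q_ge {x : ℝ} (hx : 0 ≤ x) (hxr : x < S.r) :
    S.q0 * Real.exp (-(S.c * (S.f1Primitive 1).re)) ≤ ‖S.Q x‖ := by
  have hre := S.nonnegCoeff_f1Primitive.re_nonneg S.differentiableOn_f1Primitive hx hxr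
  have hq0 := S.q0_pos.le
  rw [Q, norm_mul, Complex.norm_real, Real.norm_of_nonneg hq0, Complex.norm_exp,
    Complex.re_ofReal_mul, Complex.sub_re]
  gcongr
  linarith [mul_nonneg S.c_pos.le hre]

theorem tendsto_norm_R (h : S.lam * S.realSlope S.t = 1) :
    Tendsto (fun x : ℝ => ‖S.R x‖) (𝓝[<] S.r) atTop := by
  have hpos : 0 < S.lam / S.l2 * (S.q0 * Real.exp (-(S.c * (S.f1Primitive 1).re))) :=
    mul_pos S.lam_div_l2_pos (mul_pos S.q0_pos (Real.exp_pos _))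
  refine tendsto_atTop_mono' _ ?_ ((S.tendsto_norm_f1Ext h).const_mul_atTop hpos)
  filter_upwards [S.eventually_nhdsLT_r] with x hx
  have hQ := S.norm_Q_ge hx.1 hx.2
  have hratio := S.lam_div_l2_pos
  rw [R, norm_mul, norm_mul, Complex.norm_real, Real.norm_of_nonneg hratio.le, mul_assoc,
    mul_comm ‖S.f1Ext x‖]
  gcongr

theorem tendsto_norm_P2 (h : S.lam * S.realSlope S.t = 1) :
    Tendsto (fun x : ℝ => ‖S.P2 x‖) (𝓝[<] S.r) atTop := by
  refine tendsto_atTop_mono' _ ?_ (S.tendsto_norm_R h)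
  filter_upwards [S.eventually_nhdsLT_r] with x hx
  have hQ := S.nonnegCoeff_Q.re_nonneg S.differentiableOn_Q hx.1 hx.2
  rw [S.nonnegCoeff_P2.norm_eq_re S.differentiableOn_P2 hx.1 hx.2,
    S.nonnegCoeff_R.norm_eq_re S.differentiableOn_R hx.1 hx.2, P2, Complex.add_re]
  linarith

end RetrialModel

/-! ### Square root expansions -/

theorem analyticAt_dslope {f : ℂ → ℂ} {c : ℂ} (hf : AnalyticAt ℂ f c) :
    AnalyticAt ℂ (dslope f c) c := by
  obtain ⟨p, hp⟩ := hf
  exact ⟨_, hp.has_fpower_series_dslope_fslope⟩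

theorem eq_sub_mul_dslope {f : ℂ → ℂ} {c : ℂ} (hf : f c = 0) (w : ℂ) :
    f w = (w - c) * dslope f c w := by
  rw [← smul_eq_mul, sub_smul_dslope, hf, sub_zero]

theorem exists_eq_sub_sq_mul {θ : ℂ → ℂ} {c : ℂ} (hθ : AnalyticAt ℂ θ c) (h0 : θ c = 0)
    (h1 : deriv θ c = 0) :
    ∃ χ : ℂ → ℂ, AnalyticAt ℂ χ c ∧ (∀ w, θ w = (w - c) ^ 2 * χ w) ∧
      χ c = deriv (deriv θ) c / 2 := by
  set η := dslope θ c
  have aη : AnalyticAt ℂ η c := analyticAt_dslope hθ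
  have hη0 : η c = 0 := (dslope_same θ c).trans h1
  have hθη : ∀ w, θ w = (w - c) * η w := eq_sub_mul_dslope h0
  refine ⟨dslope η c, analyticAt_dslope aη, fun w => ?_, ?_⟩
  · rw [hθη, eq_sub_mul_dslope hη0]
    ring
  · have hderiv : deriv θ =ᶠ[𝓝 c] fun w => η w + (w - c) * deriv η w := by
      filter_upwards [aη.eventually_analyticAt] with w hw
      rw [show θ = fun w => (w - c) * η w from funext hθη, ← one_mul (η w)]
      exact (((hasDerivAt_id w).sub_const c).mul hw.differentiableAt.hasDerivAt).deriv
    have hderiv2 := aη.differentiableAt.hasDerivAt.add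
      (((hasDerivAt_id c).sub_const c).mul aη.deriv.differentiableAt.hasDerivAt)
    rw [hderiv.deriv_eq, dslope_same]
    refine (eq_div_iff two_ne_zero).2 (Eq.symm (hderiv2.deriv.trans ?_))
    simp only [id_eq, sub_self]
    ring

theorem exists_eq_sub_mul_sq {θ : ℂ → ℂ} {c : ℂ} {s : ℝ} (hs : 0 < s) (hθ : AnalyticAt ℂ θ c)
    (h0 : θ c = 0) (h1 : deriv θ c = 0) (h2 : deriv (deriv θ) c = 2 * s) :
    ∃ q : ℂ → ℂ, AnalyticAt ℂ q c ∧ q c = (√s : ℝ) ∧ ∀ w, θ w = ((c - w) * q w) ^ 2 := by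
  obtain ⟨χ, aχ, hχ, hχc⟩ := exists_eq_sub_sq_mul hθ h0 h1
  rw [h2, mul_div_cancel_left₀ _ two_ne_zero] at hχc
  refine ⟨fun w => χ w ^ (1 / 2 : ℂ), aχ.cpow analyticAt_const ?_, ?_, fun w => ?_⟩
  · rw [hχc]
    exact Complex.ofReal_mem_slitPlane.2 hs
  · simp only [hχc]
    rw [Real.sqrt_eq_rpow, Complex.ofReal_cpow hs.le]
    push_cast
    rfl
  · have hsq : (χ w ^ (1 / 2 : ℂ)) ^ 2 = χ w := by
      rw [← Complex.cpow_nat_mul]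
      norm_num
    rw [mul_pow, hsq, hχ]
    ring

theorem exists_analyticAt_leftInverse {g : ℂ → ℂ} {c g' : ℂ} (hg : AnalyticAt ℂ g c)
    (hg' : HasDerivAt g g' c) (hne : g' ≠ 0) :
    ∃ G : ℂ → ℂ, AnalyticAt ℂ G (g c) ∧ HasDerivAt G g'⁻¹ (g c) ∧ ∀ᶠ w in 𝓝 c, G (g w) = w := by
  have hne' : deriv g c ≠ 0 := hg'.deriv ▸ hne
  refine ⟨_, hg.analyticAt_localInverse hne', ?_,
    HasStrictDerivAt.eventually_left_inverse hg.hasStrictDerivAt hne'⟩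
  rw [← hg'.deriv]
  exact (HasStrictDerivAt.to_localInverse hg.hasStrictDerivAt hne').hasDerivAt

theorem eqOn_sqrtSub_of_sq_eq {f : ℂ → ℂ} {R x : ℝ} {U : Set ℂ} (hU : IsPreconnected U)
    (hUR : U ⊆ slitPlaneAt R) (hf : ContinuousOn f U) (hsq : ∀ z ∈ U, f z ^ 2 = R - z)
    (hx : (x : ℂ) ∈ U) (hpos : 0 < (f x).re) : Set.EqOn f (sqrtSub R) U := by
  have hsqrt : ContinuousOn (sqrtSub R) U := fun z hz =>
    (hasDerivAt_sqrtSub (hUR hz)).continuousAt.continuousWithinAt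
  have hsq' : Set.EqOn (f ^ 2) (sqrtSub R ^ 2) U := fun z hz => by
    simp only [Pi.pow_apply, hsq z hz, sqrtSub_sq]
  refine (hU.eq_or_eq_neg_of_sq_eq hf hsqrt hsq'
    (fun {z} hz => sqrtSub_ne_zero (ne_of_mem_slitPlaneAt (hUR hz)))).resolve_right fun hneg => ?_
  have hxR : x < R := by
    have hmem : ((R - x : ℝ) : ℂ) ∈ Complex.slitPlane := by
      rw [Complex.ofReal_sub]
      exact hUR hx
    exact sub_pos.1 (Complex.ofReal_mem_slitPlane.1 hmem)
  rw [hneg hx, Pi.neg_apply, sqrtSub_ofReal hxR.le, Complex.neg_re, Complex.ofReal_re] at hpos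
  exact (neg_pos.1 hpos).not_ge (Real.sqrt_nonneg _)

theorem tendsto_sqrtSub_slitPlaneAt (R : ℝ) :
    Tendsto (sqrtSub R) (𝓝[slitPlaneAt R] (R : ℂ)) (𝓝[≠] 0) :=
  tendsto_nhdsWithin_iff.2 ⟨(tendsto_sqrtSub R).mono_left nhdsWithin_le_nhds, by
    filter_upwards [self_mem_nhdsWithin] with z hz using sqrtSub_ne_zero (ne_of_mem_slitPlaneAt hz)⟩

theorem tendsto_sqrtSub_ball (R : ℝ) : Tendsto (sqrtSub R) (𝓝[ball 0 R] (R : ℂ)) (𝓝[≠] 0) :=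
  (tendsto_sqrtSub_slitPlaneAt R).mono_left (nhdsWithin_mono _ (ball_subset_slitPlaneAt R))

theorem hasDeltaExpansion_of_sqrt {f F H g e : ℂ → ℂ} {R : ℝ} (hR : 1 ≤ R)
    (hF : DifferentiableOn ℂ F (ball 0 R)) (hFf : ∀ z, ‖z‖ < 1 → F z = f z)
    (hζ : ∀ ζ : ℂ, ‖ζ‖ = R → ζ ≠ R → ContinuesAcross F R ζ)
    (hH : ∀ᶠ s in 𝓝[≠] (0 : ℂ), AnalyticAt ℂ H s)
    (hFH : ∀ᶠ z in 𝓝[ball 0 R] (R : ℂ), F z = H (sqrtSub R z))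
    (ho : (fun s => H s - g s) =o[𝓝[≠] 0] e) :
    HasDeltaExpansion f R (fun z => g (sqrtSub R z))
      (fun z => e (sqrtSub R z)) := by
  obtain ⟨ε₁, hε₁, hball₁⟩ := Metric.eventually_nhds_iff_ball.1
    (eventually_nhdsWithin_iff.1 ((tendsto_sqrtSub_slitPlaneAt R).eventually hH))
  obtain ⟨ε₂, hε₂, hball₂⟩ := Metric.eventually_nhds_iff_ball.1 (eventually_nhdsWithin_iff.1 hFH)
  refine hasDeltaExpansion_of_slitPlaneAt (G₀ := fun z => H (sqrtSub R z)) (ε := min ε₁ ε₂) hR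
    (lt_min hε₁ hε₂) hF hFf hζ ?_ ?_ (ho.comp_tendsto (tendsto_sqrtSub_slitPlaneAt R))
  · intro z hz
    have hHz := hball₁ z (ball_subset_ball (min_le_left _ _) hz.1) hz.2
    exact (hHz.differentiableAt.comp z
      (hasDerivAt_sqrtSub hz.2).differentiableAt).differentiableWithinAt
  · intro z hz hzR
    exact (hball₂ z (ball_subset_ball (min_le_right _ _) hz) (mem_ball_zero_iff.2 hzR)).symm

theorem tendsto_of_sqrt {F H : ℂ → ℂ} {R : ℝ} (hR : 0 < R) (hH : ContinuousAt H 0)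
    (hFH : ∀ᶠ z in 𝓝[ball 0 R] (R : ℂ), F z = H (sqrtSub R z)) :
    Tendsto (fun x : ℝ => F x) (𝓝[<] R) (𝓝 (H 0)) := by
  have hlim : Tendsto (fun z => H (sqrtSub R z)) (𝓝[ball 0 R] (R : ℂ)) (𝓝 (H 0)) :=
    hH.tendsto.comp ((tendsto_sqrtSub_ball R).mono_right nhdsWithin_le_nhds)
  exact (hlim.congr' (hFH.mono fun z hz => hz.symm)).comp
    (tendsto_ofReal_nhdsLT_nhdsWithin_ball hR)

theorem isLittleO_sub_linear {H : ℂ → ℂ} {c : ℂ} (hc : c ≠ 0) (hH : HasDerivAt H (-c) 0) :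
    (fun s => H s - (H 0 - c * s)) =o[𝓝[≠] 0] fun s => c * s := by
  refine IsLittleO.mono (l' := 𝓝 (0 : ℂ)) ?_ nhdsWithin_le_nhds
  refine ((isLittleO_const_mul_right_iff hc).2 (hasDerivAt_iff_isLittleO.1 hH)).congr
    (fun s => ?_) (fun s => ?_)
  · simp only [sub_zero, smul_eq_mul]
    ring
  · rw [sub_zero]

theorem isLittleO_div_sub {m : ℂ → ℂ} (hm : ContinuousAt m 0) (h0 : m 0 ≠ 0) :
    (fun s => m s / s - m 0 / s) =o[𝓝[≠] 0] fun s => m 0 / s := by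
  have hlim : (fun s => m s - m 0) =o[𝓝[≠] 0] fun _ => m 0 := by
    rw [isLittleO_const_iff h0]
    exact ((tendsto_sub_nhds_zero_iff.2 hm.tendsto).mono_left nhdsWithin_le_nhds)
  refine (hlim.mul_isBigO (isBigO_refl (fun s : ℂ => s⁻¹) (𝓝[≠] 0))).congr (fun s => ?_)
    (fun s => ?_)
  · rw [← sub_div, div_eq_mul_inv]
  · rw [div_eq_mul_inv]

namespace BusyKernel

variable (K : BusyKernel)

theorem hasDerivAt_deriv_A {x : ℝ} (hx : x < K.σ) : HasDerivAt (deriv K.A) (K.a2 x) x := by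
  have hA : AnalyticAt ℂ (deriv K.A) x := (K.analyticAt_A (by simpa using hx)).deriv
  have ha1 : HasDerivAt (fun y : ℝ => deriv K.A y) (K.a2 x : ℂ) x := by
    refine (K.hasDerivAt_a1 x hx).ofReal_comp.congr_of_eventuallyEq ?_
    filter_upwards [Iio_mem_nhds hx] with y hy using K.deriv_A_ofReal y hy
  have hderiv := hA.differentiableAt.hasDerivAt
  rwa [← hderiv.comp_ofReal.unique ha1]

theorem psiC_tau : K.psiC K.τ = K.Rh := K.psiC_ofReal K.tau_lt_sigma

theorem ofReal_tau_re_lt_sigma : (K.τ : ℂ).re < K.σ := by simpa using K.tau_lt_sigma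

theorem deriv_psiC_tau : deriv K.psiC K.τ = 0 := by
  have hτ : (K.l1 : ℂ) * K.a1 K.τ = 1 := by exact_mod_cast K.l1_mul_a1_tau
  rw [(K.hasDerivAt_psiC K.ofReal_tau_re_lt_sigma).deriv, K.deriv_A_ofReal _ K.tau_lt_sigma, hτ,
    sub_self, zero_div]

theorem deriv_deriv_psiC_tau :
    deriv (deriv K.psiC) K.τ = -(K.l1 * K.a2 K.τ / K.l2) := by
  have hderiv : deriv K.psiC =ᶠ[𝓝 (K.τ : ℂ)] fun w => (1 - K.l1 * deriv K.A w) / K.l2 := by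
    filter_upwards [K.isOpen_halfPlane.mem_nhds K.ofReal_tau_re_lt_sigma] with w hw
    exact (K.hasDerivAt_psiC hw).deriv
  rw [hderiv.deriv_eq, ← neg_div]
  exact ((((K.hasDerivAt_deriv_A K.tau_lt_sigma).const_mul (K.l1 : ℂ)).const_sub 1).div_const
    (K.l2 : ℂ)).deriv

/-- At `τ` the function `R_h - Ψ` has a double zero, so it is the square of a local coordinate. -/
theorem exists_Rh_sub_psiC_eq_sq :
    ∃ q : ℂ → ℂ, AnalyticAt ℂ q K.τ ∧ q K.τ = (√(K.l1 * K.a2 K.τ / (2 * K.l2)) : ℝ) ∧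
      ∀ w, K.Rh - K.psiC w = ((K.τ - w) * q w) ^ 2 := by
  have ha2 := K.a2_pos K.τ K.tau_lt_sigma
  have hl1 := K.l1_pos
  have hl2 := K.l2_pos
  refine exists_eq_sub_mul_sq (by positivity)
    (analyticAt_const.sub (K.analyticAt_psiC K.ofReal_tau_re_lt_sigma)) ?_ ?_ ?_
  · rw [K.psiC_tau, sub_self]
  · rw [deriv_const_sub, K.deriv_psiC_tau, neg_zero]
  · rw [deriv_const_sub', deriv.fun_neg, K.deriv_deriv_psiC_tau]
    push_cast
    field_simp

theorem tendsto_root_Rh : Tendsto K.root (𝓝[ball 0 K.Rh] (K.Rh : ℂ)) (𝓝 (K.τ : ℂ)) := by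
  rw [← K.root_Rh]
  refine (K.continuousOn_root K.Rh (mem_closedBall_zero_iff.2 ?_)).mono_left
    (nhdsWithin_mono _ ball_subset_closedBall)
  rw [Complex.norm_real, Real.norm_of_nonneg K.Rh_pos.le]

/-- Both sides are square roots of `R_h - z`; the sign is read off on the real axis, where
`root x < τ`. -/
theorem eventually_tau_sub_root_mul_eq_sqrtSub {q : ℂ → ℂ} (hq : AnalyticAt ℂ q K.τ)
    (hpos : 0 < (q K.τ).re) (hsq : ∀ w, K.Rh - K.psiC w = ((K.τ - w) * q w) ^ 2) :
    ∀ᶠ z in 𝓝[ball 0 K.Rh] (K.Rh : ℂ), (K.τ - K.root z) * q (K.root z) = sqrtSub K.Rh z := by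
  have hre : ∀ᶠ w in 𝓝 (K.τ : ℂ), 0 < (q w).re :=
    (Complex.continuous_re.continuousAt.comp hq.continuousAt).eventually (lt_mem_nhds hpos)
  obtain ⟨ε, hε, hball⟩ := Metric.eventually_nhds_iff_ball.1 (eventually_nhdsWithin_iff.1
    (K.tendsto_root_Rh.eventually (hq.eventually_continuousAt.and hre)))
  set U : Set ℂ := ball (K.Rh : ℂ) ε ∩ ball 0 K.Rh
  have hUR : ∀ z ∈ U, ‖z‖ < K.Rh := fun z hz => mem_ball_zero_iff.1 hz.2
  have hU : U ∈ 𝓝[ball 0 K.Rh] (K.Rh : ℂ) :=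
    inter_mem (mem_nhdsWithin_of_mem_nhds (ball_mem_nhds _ hε)) self_mem_nhdsWithin
  have hpos_lt : ∀ᶠ x : ℝ in 𝓝[<] K.Rh, 0 < x ∧ x < K.Rh := Ioo_mem_nhdsLT K.Rh_pos
  obtain ⟨x, hxU, hx0, hxR⟩ :=
    (((tendsto_ofReal_nhdsLT_nhdsWithin_ball K.Rh_pos).eventually hU).and hpos_lt).exists
  have hcont : ContinuousOn (fun z => (K.τ - K.root z) * q (K.root z)) U := fun z hz => by
    have hroot := (K.analyticAt_root (hUR z hz)).continuousAt
    exact ((continuousAt_const.sub hroot).mul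
      ((hball z hz.1 hz.2).1.comp hroot)).continuousWithinAt
  have hxpos : 0 < ((K.τ - K.root x) * q (K.root x)).re := by
    obtain ⟨y, -, hyτ, hyx, hroot⟩ := K.exists_root_ofReal hx0.le hxR.le
    have hyτ' : y < K.τ := hyτ.lt_of_ne fun h => hxR.ne (by rw [← hyx, h, Rh])
    have hqx := (hball x hxU.1 hxU.2).2
    rw [hroot] at hqx ⊢
    rw [← Complex.ofReal_sub, Complex.re_ofReal_mul]
    exact mul_pos (sub_pos.2 hyτ') hqx
  filter_upwards [hU] with z hz
  refine eqOn_sqrtSub_of_sq_eq ((convex_ball _ _).inter (convex_ball _ _)).isPreconnected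
    (fun z hz => ball_subset_slitPlaneAt _ hz.2) hcont (fun z hz => ?_) hxU hxpos hz
  rw [← hsq, K.psiC_root (hUR z hz).le]

theorem exists_root_eq_sqrt :
    ∃ G : ℂ → ℂ, AnalyticAt ℂ G 0 ∧ G 0 = K.τ ∧
      HasDerivAt G (-(√(2 * K.l2 / (K.l1 * K.a2 K.τ)) : ℝ)) 0 ∧
      ∀ᶠ z in 𝓝[ball 0 K.Rh] (K.Rh : ℂ), K.root z = G (sqrtSub K.Rh z) := by
  have ha2 := K.a2_pos K.τ K.tau_lt_sigma
  have hl1 := K.l1_pos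
  have hl2 := K.l2_pos
  obtain ⟨q, aq, hqτ, hsq⟩ := K.exists_Rh_sub_psiC_eq_sq
  set s := K.l1 * K.a2 K.τ / (2 * K.l2)
  have hs : 0 < √s := Real.sqrt_pos.2 (by positivity)
  have hcoord : HasDerivAt (fun w => (K.τ - w) * q w) (-(√s : ℝ)) K.τ := by
    refine (((hasDerivAt_id (K.τ : ℂ)).const_sub (K.τ : ℂ)).mul
      aq.differentiableAt.hasDerivAt).congr_deriv ?_
    simp [hqτ]
  obtain ⟨G, aG, hG', hleft⟩ := exists_analyticAt_leftInverse
    (g := fun w => (K.τ - w) * q w) ((analyticAt_const.sub analyticAt_id).mul aq) hcoord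
    (neg_ne_zero.2 (Complex.ofReal_ne_zero.2 hs.ne'))
  have hGτ := hleft.self_of_nhds
  simp only [sub_self, zero_mul] at aG hG' hGτ
  refine ⟨G, aG, hGτ, hG'.congr_deriv ?_, ?_⟩
  · rw [← neg_inv, ← Complex.ofReal_inv, ← Real.sqrt_inv, inv_div]
  · have hpos : 0 < (q K.τ).re := by rwa [hqτ, Complex.ofReal_re]
    filter_upwards [K.eventually_tau_sub_root_mul_eq_sqrtSub aq hpos hsq,
      K.tendsto_root_Rh.eventually hleft] with z hz hGz
    rw [← hz]
    exact hGz.symm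

end BusyKernel

/-! ### Expansions at `R_h` -/

theorem exists_analyticAt_primitive {k : ℂ → ℂ} {c : ℂ} (hk : AnalyticAt ℂ k c) :
    ∃ Ψ : ℂ → ℂ, AnalyticAt ℂ Ψ c ∧ ∀ᶠ s in 𝓝 c, HasDerivAt Ψ (k s) s := by
  obtain ⟨δ, hδ, hball⟩ := Metric.eventually_nhds_iff_ball.1 hk.eventually_analyticAt
  have hdiff : DifferentiableOn ℂ k (ball c δ) := fun s hs =>
    (hball s hs).differentiableAt.differentiableWithinAt
  obtain ⟨Ψ, hΨ⟩ := hdiff.isExactOn_ball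
  have hΨdiff : DifferentiableOn ℂ Ψ (ball c δ) := fun s hs =>
    (hΨ s hs).differentiableAt.differentiableWithinAt
  refine ⟨Ψ, hΨdiff.analyticAt (ball_mem_nhds _ hδ), ?_⟩
  filter_upwards [ball_mem_nhds c hδ] with s hs using hΨ s hs

namespace BusyKernel

variable (K : BusyKernel)

theorem convergesAt_hExt_Rh : ConvergesAt K.hExt K.Rh ∧
    (val K.hExt K.Rh : ℂ) = K.a K.τ := by
  refine K.nonnegCoeff_hExt.convergesAt_of_tendsto K.Rh_pos K.differentiableOn_hExt ?_
  rw [← K.A_ofReal K.τ K.tau_lt_sigma]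
  exact (K.analyticAt_A K.ofReal_tau_re_lt_sigma).continuousAt.tendsto.comp
    (K.tendsto_root_Rh.comp (tendsto_ofReal_nhdsLT_nhdsWithin_ball K.Rh_pos))

theorem val_hExt_psi {t : ℝ} (ht0 : K.lam ≤ t) (ht : t ≤ K.τ) :
    val K.hExt (K.psi t) = K.a t := by
  rcases ht.eq_or_lt with rfl | hlt
  · exact_mod_cast K.convergesAt_hExt_Rh.2
  · have hnonneg : 0 ≤ K.psi t := zero_le_one.trans (K.one_le_psi ht0 ht)
    have hltR : K.psi t < K.Rh := K.strictMonoOn_psi ht Set.self_mem_Iic hlt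
    rw [K.nonnegCoeff_hExt.val_eq_re K.differentiableOn_hExt hnonneg hltR, K.hExt_psi ht0 ht,
      Complex.ofReal_re]

/-- The constant `c_h`: minus the coefficient of `(R_h - z)^{1/2}` in the expansion of `h` at
`R_h`. -/
noncomputable def ch : ℝ := √(2 * K.l2 / (K.l1 ^ 3 * K.a2 K.τ))

theorem ch_pos : 0 < K.ch := by
  have hl1 := K.l1_pos
  have hl2 := K.l2_pos
  have ha2 := K.a2_pos K.τ K.tau_lt_sigma
  exact Real.sqrt_pos.2 (by positivity)

theorem ch_eq_div : K.ch = √(2 * K.l2 / (K.l1 * K.a2 K.τ)) / K.l1 := by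
  have hl1 := K.l1_pos
  have hsplit : 2 * K.l2 / (K.l1 ^ 3 * K.a2 K.τ) =
      2 * K.l2 / (K.l1 * K.a2 K.τ) / K.l1 ^ 2 := by
    rw [div_div]
    congr 1
    ring
  rw [ch, hsplit, Real.sqrt_div' _ (by positivity), Real.sqrt_sq hl1.le]

theorem exists_hExt_eq_sqrt :
    ∃ w : ℂ → ℂ, AnalyticAt ℂ w 0 ∧ w 0 = K.a K.τ ∧ HasDerivAt w (-(K.ch : ℂ)) 0 ∧
      ∀ᶠ z in 𝓝[ball 0 K.Rh] (K.Rh : ℂ), K.hExt z = w (sqrtSub K.Rh z) := by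
  obtain ⟨G, hG, hG0, hG', hev⟩ := K.exists_root_eq_sqrt
  have hAτ : AnalyticAt ℂ K.A (G 0) := hG0 ▸ K.analyticAt_A K.ofReal_tau_re_lt_sigma
  have hA' : HasDerivAt K.A (K.a1 K.τ) (G 0) := by
    rw [hG0, ← K.deriv_A_ofReal K.τ K.tau_lt_sigma]
    exact K.hasDerivAt_A K.ofReal_tau_re_lt_sigma
  have ha1 : K.a1 K.τ = 1 / K.l1 :=
    eq_div_of_mul_eq K.l1_pos.ne' ((mul_comm _ _).trans K.l1_mul_a1_tau)
  refine ⟨fun s => K.A (G s), hAτ.fun_comp hG, ?_, (hA'.comp (0 : ℂ) hG').congr_deriv ?_, ?_⟩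
  · simp only [hG0, K.A_ofReal K.τ K.tau_lt_sigma]
  · rw [ha1, K.ch_eq_div]
    push_cast
    ring
  · filter_upwards [hev] with z hz
    rw [hExt, hz]

theorem continuesAcross_hExt {ζ : ℂ} (hζ : ‖ζ‖ = K.Rh) (hne : ζ ≠ K.Rh) :
    ContinuesAcross K.hExt K.Rh ζ := by
  obtain ⟨g, hg, hgζ, hev⟩ := K.exists_continuation_root hζ.le hne
  refine ⟨fun z => K.A (g z), ?_, ?_⟩
  · refine AnalyticAt.fun_comp ?_ hg
    rw [hgζ]
    exact K.analyticAt_A (K.re_root_lt_sigma hζ.le)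
  · filter_upwards [nhdsWithin_mono _ ball_subset_closedBall hev] with z hz
    rw [hz, hExt]

theorem not_continuesAcross_hExt : ¬ ContinuesAcross K.hExt K.Rh K.Rh := by
  obtain ⟨w, -, -, hw', hev⟩ := K.exists_hExt_eq_sqrt
  exact not_continuesAcross_of_sqrt K.Rh_pos
    (neg_ne_zero.2 (Complex.ofReal_ne_zero.2 K.ch_pos.ne')) hw' hev

theorem l2_mul_a_sub_psi {t : ℝ} (ht0 : K.lam ≤ t) (ht : t ≤ K.τ) :
    K.l2 * (K.a t - K.psi t) = (t - K.lam) * (K.lam * K.realSlope t - 1) := by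
  have hpsi0 : 0 ≤ K.psi t := zero_le_one.trans (K.one_le_psi ht0 ht)
  have hsub := K.l2_mul_hExt_sub (z := K.psi t) (by
    rw [Complex.norm_real, Real.norm_of_nonneg hpsi0]
    exact K.psi_le_Rh ht)
  rw [K.hExt_psi ht0 ht, K.root_psi_of_lam_le ht0 ht,
    K.slopeA_ofReal (ht.trans_lt K.tau_lt_sigma)] at hsub
  exact_mod_cast hsub

end BusyKernel

namespace RetrialModel

variable (S : RetrialModel)

theorem r_eq_Rh (ht : S.t = S.τ) : S.r = S.Rh := by rw [r, ht, BusyKernel.Rh]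

theorem exists_f1Primitive_eq_add_const {P : ℂ → ℂ}
    (hP : ∀ᶠ z in 𝓝[ball 0 S.r] (S.r : ℂ), HasDerivAt P (S.f1Ext z) z) :
    ∃ C : ℂ, ∀ᶠ z in 𝓝[ball 0 S.r] (S.r : ℂ), S.f1Primitive z = P z + C := by
  obtain ⟨ε, hε, hball⟩ := Metric.eventually_nhds_iff_ball.1 (eventually_nhdsWithin_iff.1 hP)
  set U : Set ℂ := ball (S.r : ℂ) ε ∩ ball 0 S.r
  have hderivP : ∀ z ∈ U, HasDerivAt P (S.f1Ext z) z := fun z hz => hball z hz.1 hz.2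
  have hderiv : ∀ z ∈ U, HasDerivAt S.f1Primitive (S.f1Ext z) z := fun z hz =>
    S.hasDerivAt_f1Primitive (mem_ball_zero_iff.1 hz.2)
  obtain ⟨C, hC⟩ := (isOpen_ball.inter isOpen_ball : IsOpen U).exists_eq_add_of_deriv_eq
    ((convex_ball _ _).inter (convex_ball _ _)).isPreconnected
    (fun z hz => (hderiv z hz).differentiableAt.differentiableWithinAt)
    (fun z hz => (hderivP z hz).differentiableAt.differentiableWithinAt)
    (fun z hz => (hderiv z hz).deriv.trans (hderivP z hz).deriv.symm)
  refine ⟨C, ?_⟩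
  filter_upwards [self_mem_nhdsWithin, mem_nhdsWithin_of_mem_nhds (ball_mem_nhds _ hε)]
    with z hz hzε using hC ⟨hzε, hz⟩

/-- The substitution `z = r - s²` turns `f₁(z) dz` into `-2 k(s) ds`, whose primitive is analytic
in `s`. -/
theorem exists_Q_eq_sqrt {k : ℂ → ℂ} (hk : AnalyticAt ℂ k 0)
    (hf : ∀ᶠ z in 𝓝[ball 0 S.r] (S.r : ℂ), S.f1Ext z = k (sqrtSub S.r z) / sqrtSub S.r z) :
    ∃ q : ℂ → ℂ, AnalyticAt ℂ q 0 ∧ q 0 ≠ 0 ∧ HasDerivAt q (-2 * S.c * k 0 * q 0) 0 ∧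
      ∀ᶠ z in 𝓝[ball 0 S.r] (S.r : ℂ), S.Q z = q (sqrtSub S.r z) := by
  obtain ⟨Ψ, aΨ, hΨ⟩ := exists_analyticAt_primitive (k := fun s => -2 * k s)
    (analyticAt_const.mul hk)
  have hP : ∀ᶠ z in 𝓝[ball 0 S.r] (S.r : ℂ),
      HasDerivAt (fun z => Ψ (sqrtSub S.r z)) (S.f1Ext z) z := by
    filter_upwards [hf, self_mem_nhdsWithin,
      ((tendsto_sqrtSub_ball S.r).mono_right nhdsWithin_le_nhds).eventually hΨ] with z hz hzr hΨz
    have hslit := ball_subset_slitPlaneAt _ hzr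
    refine (hΨz.comp z (hasDerivAt_sqrtSub hslit)).congr_deriv ?_
    have hne := sqrtSub_ne_zero (ne_of_mem_slitPlaneAt hslit)
    rw [hz]
    field_simp
  obtain ⟨C, hC⟩ := S.exists_f1Primitive_eq_add_const hP
  refine ⟨fun s => S.q0 * Complex.exp (S.c * (Ψ s + C - S.f1Primitive 1)), ?_, ?_, ?_, ?_⟩
  · exact analyticAt_const.mul
      (analyticAt_const.mul ((aΨ.add analyticAt_const).sub analyticAt_const)).cexp
  · exact mul_ne_zero (Complex.ofReal_ne_zero.2 S.q0_pos.ne') (Complex.exp_ne_zero _)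
  · refine (((((hΨ.self_of_nhds.add_const C).sub_const (S.f1Primitive 1)).const_mul
      (S.c : ℂ)).cexp).const_mul (S.q0 : ℂ)).congr_deriv ?_
    ring
  · filter_upwards [hC] with z hz
    rw [Q, hz]

theorem convergesAt_Q_of_sqrt {q : ℂ → ℂ} (hq : AnalyticAt ℂ q 0)
    (hQ : ∀ᶠ z in 𝓝[ball 0 S.r] (S.r : ℂ), S.Q z = q (sqrtSub S.r z)) :
    ConvergesAt S.Q S.r ∧ (val S.Q S.r : ℂ) = q 0 :=
  S.nonnegCoeff_Q.convergesAt_of_tendsto S.r_pos S.differentiableOn_Q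
    (tendsto_of_sqrt S.r_pos hq.continuousAt hQ)

theorem val_Q_ne_zero_of_sqrt {q : ℂ → ℂ} (hq : AnalyticAt ℂ q 0) (hq0 : q 0 ≠ 0)
    (hQ : ∀ᶠ z in 𝓝[ball 0 S.r] (S.r : ℂ), S.Q z = q (sqrtSub S.r z)) :
    val S.Q S.r ≠ 0 := by
  rwa [← Complex.ofReal_ne_zero, (S.convergesAt_Q_of_sqrt hq hQ).2]

theorem exists_f1Ext_eq_sqrt_quotient (ht : S.t = S.τ) :
    ∃ w e : ℂ → ℂ, AnalyticAt ℂ w 0 ∧ w 0 = S.a S.τ ∧ HasDerivAt w (-(S.ch : ℂ)) 0 ∧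
      AnalyticAt ℂ e 0 ∧ e 0 = S.a S.τ - S.r ∧ HasDerivAt e (-(S.ch : ℂ)) 0 ∧
      ∀ᶠ z in 𝓝[ball 0 S.r] (S.r : ℂ),
        S.f1Ext z = (1 - w (sqrtSub S.r z)) / e (sqrtSub S.r z) := by
  obtain ⟨w, aw, w0, w', hev⟩ := S.exists_hExt_eq_sqrt
  rw [← S.r_eq_Rh ht] at hev
  refine ⟨w, fun s => w s - S.r + s ^ 2, aw, w0, w',
    (aw.sub analyticAt_const).add (analyticAt_id.pow 2), by simp [w0], ?_, ?_⟩
  · refine ((w'.sub_const (S.r : ℂ)).add ((hasDerivAt_id (0 : ℂ)).pow 2)).congr_deriv ?_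
    simp
  · have hne : ∀ᶠ z in 𝓝[ball 0 S.r] (S.r : ℂ), z ≠ 1 :=
      mem_nhdsWithin_of_mem_nhds (eventually_ne_nhds (by exact_mod_cast S.one_lt_r.ne'))
    filter_upwards [hev, hne, self_mem_nhdsWithin] with z hz hz1 hzb
    have hzr := mem_ball_zero_iff.1 hzb
    rw [S.f1Ext_eq (hzr.le.trans S.r_le_Rh) hz1
      (S.one_sub_lam_mul_slopeA_root_ne_zero hzr.le (S.ne_ofReal_r_of_norm_lt hzr)), hz,
      sqrtSub_sq]
    congr 1
    ring

theorem a_tau_ne_r (ht : S.t = S.τ) (hd : S.lam * S.realSlope S.τ < 1) : S.a S.τ ≠ S.r := by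
  intro heq
  have hid := S.l2_mul_a_sub_psi S.lam_lt_tau.le le_rfl
  rw [heq, r, ht, sub_self, mul_zero] at hid
  have hτ : 0 < S.τ - S.lam := sub_pos.2 S.lam_lt_tau
  exact (mul_neg_of_pos_of_neg hτ (by linarith)).ne hid.symm

theorem a_tau_eq_r (ht : S.t = S.τ) (hd : S.lam * S.realSlope S.τ = 1) : S.a S.τ = S.r := by
  have hid := S.l2_mul_a_sub_psi S.lam_lt_tau.le le_rfl
  rw [hd, sub_self, mul_zero] at hid
  rw [r, ht]
  exact sub_eq_zero.1 ((mul_eq_zero.1 hid).resolve_left S.l2_pos.ne')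

theorem exists_f1Ext_eq_sqrt (ht : S.t = S.τ) (hd : S.lam * S.realSlope S.τ < 1) :
    ∃ Φ : ℂ → ℂ, AnalyticAt ℂ Φ 0 ∧
      HasDerivAt Φ (-((S.r - 1) / (S.a S.τ - S.r) ^ 2 * S.ch : ℝ)) 0 ∧
      ∀ᶠ z in 𝓝[ball 0 S.r] (S.r : ℂ), S.f1Ext z = Φ (sqrtSub S.r z) := by
  obtain ⟨w, e, aw, w0, w', ae, e0, e', hev⟩ := S.exists_f1Ext_eq_sqrt_quotient ht
  have hne : (S.a S.τ - S.r : ℂ) ≠ 0 := by exact_mod_cast sub_ne_zero.2 (S.a_tau_ne_r ht hd)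
  have he0 : e 0 ≠ 0 := e0 ▸ hne
  refine ⟨fun s => (1 - w s) / e s, (analyticAt_const.sub aw).div ae he0,
    ((w'.const_sub 1).div e' he0).congr_deriv ?_, hev⟩
  rw [e0, w0]
  push_cast
  field_simp
  ring

theorem exists_f1Ext_eq_div_sqrt (ht : S.t = S.τ) (hd : S.lam * S.realSlope S.τ = 1) :
    ∃ k : ℂ → ℂ, AnalyticAt ℂ k 0 ∧ k 0 = ((S.r - 1) / S.ch : ℝ) ∧
      ∀ᶠ z in 𝓝[ball 0 S.r] (S.r : ℂ), S.f1Ext z = k (sqrtSub S.r z) / sqrtSub S.r z := by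
  obtain ⟨w, e, aw, w0, -, ae, e0, e', hev⟩ := S.exists_f1Ext_eq_sqrt_quotient ht
  have hslope0 : dslope e 0 0 = -(S.ch : ℂ) := (dslope_same e 0).trans e'.deriv
  have hslope_ne : dslope e 0 0 ≠ 0 := by
    rw [hslope0]
    exact neg_ne_zero.2 (Complex.ofReal_ne_zero.2 S.ch_pos.ne')
  rw [S.a_tau_eq_r ht hd, sub_self] at e0
  refine ⟨fun s => (1 - w s) / dslope e 0 s,
    (analyticAt_const.sub aw).div (analyticAt_dslope ae) hslope_ne, ?_, ?_⟩
  · simp only [hslope0, w0, S.a_tau_eq_r ht hd]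
    push_cast
    rw [div_neg, ← neg_div, neg_sub]
  · filter_upwards [hev] with z hz
    rw [hz, eq_sub_mul_dslope e0, sub_zero, div_div, mul_comm]

/-- Minus the coefficient of `(r - z)^{1/2}` in the expansions of `R` and `P₂` at `r = R_h` when
`h(r) ≠ r`. -/
noncomputable def sqrtCoeff : ℝ :=
  S.lam / S.l2 * ((S.r - 1) / (S.a S.τ - S.r) ^ 2 * S.ch * val S.Q S.r)

/-- The coefficient of `(r - z)^{-1/2}` in the expansions of `R` and `P₂` at `r = R_h` when
`h(r) = r`. -/
noncomputable def invSqrtCoeff : ℝ :=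
  S.lam / S.l2 * ((S.r - 1) / S.ch * val S.Q S.r)

theorem sqrtCoeff_ne_zero (ht : S.t = S.τ) (hd : S.lam * S.realSlope S.τ < 1)
    (hQ : val S.Q S.r ≠ 0) : S.sqrtCoeff ≠ 0 :=
  mul_ne_zero S.lam_div_l2_pos.ne' (mul_ne_zero (mul_ne_zero
    (div_ne_zero (sub_pos.2 S.one_lt_r).ne' (pow_ne_zero 2 (sub_ne_zero.2 (S.a_tau_ne_r ht hd))))
    S.ch_pos.ne') hQ)

theorem invSqrtCoeff_ne_zero (hQ : val S.Q S.r ≠ 0) : S.invSqrtCoeff ≠ 0 :=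
  mul_ne_zero S.lam_div_l2_pos.ne'
    (mul_ne_zero (div_ne_zero (sub_pos.2 S.one_lt_r).ne' S.ch_pos.ne') hQ)

theorem exists_Q_R_eq_sqrt (ht : S.t = S.τ) (hd : S.lam * S.realSlope S.τ < 1) :
    ∃ q H : ℂ → ℂ, AnalyticAt ℂ q 0 ∧ AnalyticAt ℂ H 0 ∧ q 0 ≠ 0 ∧ HasDerivAt q 0 0 ∧
      HasDerivAt H (-(S.sqrtCoeff : ℂ)) 0 ∧
      (∀ᶠ z in 𝓝[ball 0 S.r] (S.r : ℂ), S.Q z = q (sqrtSub S.r z)) ∧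
      ∀ᶠ z in 𝓝[ball 0 S.r] (S.r : ℂ), S.R z = H (sqrtSub S.r z) := by
  obtain ⟨Φ, aΦ, Φ', hf⟩ := S.exists_f1Ext_eq_sqrt ht hd
  have hk : ∀ᶠ z in 𝓝[ball 0 S.r] (S.r : ℂ),
      S.f1Ext z = sqrtSub S.r z * Φ (sqrtSub S.r z) / sqrtSub S.r z := by
    filter_upwards [hf, self_mem_nhdsWithin] with z hz hzb
    rw [hz, mul_div_cancel_left₀ _
      (sqrtSub_ne_zero (ne_of_mem_slitPlaneAt (ball_subset_slitPlaneAt _ hzb)))]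
  obtain ⟨q, aq, q0, q', hq⟩ :=
    S.exists_Q_eq_sqrt (k := fun s => s * Φ s) (analyticAt_id.mul aΦ) hk
  replace q' : HasDerivAt q 0 0 := q'.congr_deriv (by simp)
  refine ⟨q, fun s => (S.lam / S.l2 : ℝ) * (Φ s * q s), aq, analyticAt_const.mul (aΦ.mul aq), q0,
    q', ((Φ'.mul q').const_mul ((S.lam / S.l2 : ℝ) : ℂ)).congr_deriv ?_, hq, ?_⟩
  · rw [sqrtCoeff, Complex.ofReal_mul (S.lam / S.l2),
      Complex.ofReal_mul _ (val _ _), (S.convergesAt_Q_of_sqrt aq hq).2]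
    ring
  · filter_upwards [hf, hq] with z hz hz'
    rw [R, hz, hz']

theorem eventually_P2_eq_sqrt {q H : ℂ → ℂ}
    (hq : ∀ᶠ z in 𝓝[ball 0 S.r] (S.r : ℂ), S.Q z = q (sqrtSub S.r z))
    (hH : ∀ᶠ z in 𝓝[ball 0 S.r] (S.r : ℂ), S.R z = H (sqrtSub S.r z)) :
    ∀ᶠ z in 𝓝[ball 0 S.r] (S.r : ℂ), S.P2 z = q (sqrtSub S.r z) + H (sqrtSub S.r z) := by
  filter_upwards [hq, hH] with z hz hz'
  rw [P2, hz, hz']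

theorem exists_Q_R_eq_div_sqrt (ht : S.t = S.τ) (hd : S.lam * S.realSlope S.τ = 1) :
    ∃ q m : ℂ → ℂ, AnalyticAt ℂ q 0 ∧ AnalyticAt ℂ m 0 ∧ q 0 ≠ 0 ∧ m 0 = S.invSqrtCoeff ∧
      (∀ᶠ z in 𝓝[ball 0 S.r] (S.r : ℂ), S.Q z = q (sqrtSub S.r z)) ∧
      ∀ᶠ z in 𝓝[ball 0 S.r] (S.r : ℂ), S.R z = m (sqrtSub S.r z) / sqrtSub S.r z := by
  obtain ⟨k, ak, k0, hk⟩ := S.exists_f1Ext_eq_div_sqrt ht hd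
  obtain ⟨q, aq, q0, -, hq⟩ := S.exists_Q_eq_sqrt ak hk
  refine ⟨q, fun s => (S.lam / S.l2 : ℝ) * (k s * q s), aq, analyticAt_const.mul (ak.mul aq), q0,
    ?_, hq, ?_⟩
  · simp only [k0]
    rw [invSqrtCoeff, Complex.ofReal_mul (S.lam / S.l2),
      Complex.ofReal_mul _ (val _ _), (S.convergesAt_Q_of_sqrt aq hq).2]
  · filter_upwards [hk, hq] with z hz hz'
    rw [R, hz, hz', div_mul_eq_mul_div, ← mul_div_assoc]

end RetrialModel

/-! ### A pole of `f₁` at `r < R_h` -/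

theorem deltaEquivalent_of_cpow {f F m : ℂ → ℂ} {R : ℝ} {β : ℂ} (hR : 1 ≤ R)
    (hF : DifferentiableOn ℂ F (ball 0 R)) (hFf : ∀ z, ‖z‖ < 1 → F z = f z)
    (hζ : ∀ ζ : ℂ, ‖ζ‖ = R → ζ ≠ R → ContinuesAcross F R ζ) (hm : AnalyticAt ℂ m R)
    (h0 : m R ≠ 0) (hFm : ∀ᶠ z in 𝓝[ball 0 R] (R : ℂ), F z = m z * ((R : ℂ) - z) ^ β) :
    DeltaEquivalent f R (fun z => m R * ((R : ℂ) - z) ^ β) := by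
  obtain ⟨ε₁, hε₁, hball₁⟩ := Metric.eventually_nhds_iff_ball.1 hm.eventually_analyticAt
  obtain ⟨ε₂, hε₂, hball₂⟩ := Metric.eventually_nhds_iff_ball.1 (eventually_nhdsWithin_iff.1 hFm)
  refine hasDeltaExpansion_of_slitPlaneAt (G₀ := fun z => m z * ((R : ℂ) - z) ^ β)
    (ε := min ε₁ ε₂) hR (lt_min hε₁ hε₂) hF hFf hζ ?_ ?_ ?_
  · intro z hz
    exact ((hball₁ z (ball_subset_ball (min_le_left _ _) hz.1)).differentiableAt.mul
      (hasDerivAt_cpow_sub hz.2 β).differentiableAt).differentiableWithinAt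
  · intro z hz hzR
    exact (hball₂ z (ball_subset_ball (min_le_right _ _) hz) (mem_ball_zero_iff.2 hzR)).symm
  · have hlim : (fun z => m z - m R) =o[𝓝[slitPlaneAt R] (R : ℂ)] fun _ => m R :=
      (isLittleO_const_iff h0).2 ((tendsto_sub_nhds_zero_iff.2 hm.continuousAt.tendsto).mono_left
        nhdsWithin_le_nhds)
    refine (hlim.mul_isBigO (isBigO_refl (fun z : ℂ => ((R : ℂ) - z) ^ β) _)).congr_left
      fun z => ?_
    rw [sub_mul]

theorem hasDerivAt_log_sub {R : ℝ} (c : ℂ) {z : ℂ} (hz : z ∈ slitPlaneAt R) :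
    HasDerivAt (fun z : ℂ => -(c * Complex.log (R - z))) (c / (R - z)) z := by
  refine ((((hasDerivAt_id z).const_sub (R : ℂ)).clog hz).const_mul c).neg.congr_deriv ?_
  simp only [id_eq]
  ring

namespace BusyKernel

variable (K : BusyKernel)

theorem realSlope_lt_a1 {x : ℝ} (hx : K.lam < x) (hxσ : x < K.σ) : K.realSlope x < K.a1 x := by
  have hconst : ∫ _ in (0 : ℝ)..1, K.a1 x = K.a1 x := by simp
  rw [← hconst]
  refine intervalIntegral.integral_lt_integral_of_continuousOn_of_le_of_exists_lt zero_lt_one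
    (K.continuousOn_a1_segment hxσ K.lam_lt_sigma) continuousOn_const (fun t ht => ?_)
    ⟨0, by simp, ?_⟩
  · have hle : K.lam + t * (x - K.lam) ≤ x := by nlinarith [ht.2]
    exact K.strictMonoOn_a1.monotoneOn (hle.trans_lt hxσ) hxσ hle
  · simpa using K.strictMonoOn_a1 K.lam_lt_sigma hxσ hx

theorem hasDerivAt_slopeA {x : ℝ} (hx : K.lam < x) (hxσ : x < K.σ) :
    HasDerivAt K.slopeA (((K.a1 x - K.realSlope x) / (x - K.lam) : ℝ) : ℂ) x := by
  have hre : ((x : ℂ)).re < K.σ := by simpa using hxσ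
  have hslope := (K.analyticAt_slopeA hre).differentiableAt.hasDerivAt
  have hprod : HasDerivAt (fun w => (w - K.lam) * K.slopeA w) (deriv K.A x) x := by
    rw [funext K.sub_lam_mul_slopeA]
    exact (K.hasDerivAt_A hre).sub_const 1
  have hleibniz := (((hasDerivAt_id (x : ℂ)).sub_const (K.lam : ℂ)).mul hslope).unique hprod
  rw [K.deriv_A_ofReal x hxσ, K.slopeA_ofReal hxσ, id, one_mul] at hleibniz
  refine hslope.congr_deriv ?_
  have hne : (x : ℂ) - K.lam ≠ 0 := sub_ne_zero.2 (by exact_mod_cast hx.ne')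
  push_cast
  rw [eq_div_iff hne]
  linear_combination hleibniz

end BusyKernel

namespace RetrialModel

variable (S : RetrialModel)

/-- The constant `c_{f₁}^{(1)}`: minus the residue of `f₁` at `r`. -/
noncomputable def residueConst : ℝ :=
  (1 - S.r) * (1 - S.l1 * S.a1 S.t) / (1 - S.lam * S.a1 S.t)

/-- The function `f₁(x) - c_{f₁}^{(1)} / (r - x)`, whose integral enters `c_Q^{(1)}`. -/
noncomputable def integrand (x : ℝ) : ℝ :=
  (1 - val S.hExt x) / (val S.hExt x - x) -
    S.residueConst / (S.r - x)

/-- The constant `c_Q^{(1)}`. -/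
noncomputable def cQ : ℝ :=
  S.q0 * (S.r - 1) ^ (S.c * S.residueConst) * Real.exp (-S.c * ∫ x in S.r..1, S.integrand x)

theorem one_lt_lam_mul_a1 (hd : S.lam * S.realSlope S.t = 1) : 1 < S.lam * S.a1 S.t := by
  rw [← hd]
  exact mul_lt_mul_of_pos_left (S.realSlope_lt_a1 S.lam_lt_t S.t_lt_sigma) S.lam_pos

theorem residueConst_pos (ht : S.t < S.τ) (hd : S.lam * S.realSlope S.t = 1) :
    0 < S.residueConst := by
  have hlam := S.one_lt_lam_mul_a1 hd
  have hl1 := S.l1_mul_a1_lt_one ht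
  have hr := S.one_lt_r
  rw [residueConst, ← neg_div_neg_eq]
  exact div_pos (by nlinarith) (by linarith)

theorem cQ_pos : 0 < S.cQ := by
  have hr : 0 < S.r - 1 := sub_pos.2 S.one_lt_r
  have hq0 := S.q0_pos
  rw [cQ]
  positivity

theorem r_lt_Rh (ht : S.t < S.τ) : S.r < S.Rh :=
  S.strictMonoOn_psi ht.le Set.self_mem_Iic ht

theorem a_t_eq_r (hd : S.lam * S.realSlope S.t = 1) : S.a S.t = S.r := by
  have hid := S.l2_mul_a_sub_psi S.lam_lt_t.le S.t_le_tau
  rw [hd, sub_self, mul_zero] at hid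
  exact sub_eq_zero.1 ((mul_eq_zero.1 hid).resolve_left S.l2_pos.ne')

theorem lam_mul_r (hd : S.lam * S.realSlope S.t = 1) : S.lam * S.r = S.t := by
  have hpsi : S.l2 * S.r + S.l1 * S.a S.t = S.t := S.l2_mul_psi_add S.t
  rw [S.a_t_eq_r hd] at hpsi
  rw [BusyKernel.lam]
  linarith

/-- The function `z ↦ λ D(u(z))`, with `D` the divided difference `slopeA`; where it equals `1`,
`f₁` has its poles. -/
noncomputable def lamSlope (z : ℂ) : ℂ := S.lam * S.slopeA (S.root z)

/-- The function `(r - z) f₁(z)`, extended analytically to `z = r`. -/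
noncomputable def f1Numerator (z : ℂ) : ℂ :=
  S.l2 * S.slopeA (S.root z) / dslope S.lamSlope S.r z

theorem analyticAt_slopeA_root {z : ℂ} (hz : ‖z‖ < S.Rh) :
    AnalyticAt ℂ (fun z => S.slopeA (S.root z)) z :=
  (S.analyticAt_slopeA (S.re_root_lt_sigma hz.le)).comp (S.analyticAt_root hz)

theorem sub_mul_dslope_lamSlope (hd : S.lam * S.realSlope S.t = 1) (z : ℂ) :
    (S.r - z) * dslope S.lamSlope S.r z = 1 - S.lam * S.slopeA (S.root z) := by
  have hr : S.lamSlope S.r = 1 := by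
    rw [lamSlope, S.root_r, S.slopeA_ofReal S.t_lt_sigma]
    exact_mod_cast hd
  have hslope := sub_smul_dslope S.lamSlope S.r z
  rw [smul_eq_mul, hr, lamSlope] at hslope
  linear_combination -hslope

theorem f1Ext_eq_f1Numerator_div (hd : S.lam * S.realSlope S.t = 1) (z : ℂ) :
    S.f1Ext z = S.f1Numerator z / (S.r - z) := by
  rw [BusyKernel.f1Ext, f1Numerator, ← S.sub_mul_dslope_lamSlope hd, div_div, mul_comm (_ - _)]

theorem analyticAt_f1Numerator_of_norm_lt (hd : S.lam * S.realSlope S.t = 1) {z : ℂ}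
    (hz : ‖z‖ < S.r) : AnalyticAt ℂ S.f1Numerator z := by
  refine ((analyticAt_const.sub analyticAt_id).mul
    (S.analyticAt_f1Ext_of_norm_lt_r hz) : AnalyticAt ℂ (fun z => (S.r - z) * S.f1Ext z) z).congr ?_
  filter_upwards [S.eventually_norm_lt_r hz] with w hw
  change (S.r - w) * S.f1Ext w = S.f1Numerator w
  rw [S.f1Ext_eq_f1Numerator_div hd,
    mul_div_cancel₀ _ (sub_ne_zero.2 (S.ne_ofReal_r_of_norm_lt hw).symm)]

theorem deriv_lamSlope (ht : S.t < S.τ) :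
    deriv S.lamSlope S.r = ((S.lam * ((S.a1 S.t - S.realSlope S.t) / (S.t - S.lam) *
      (S.l2 / (1 - S.l1 * S.a1 S.t))) : ℝ) : ℂ) := by
  have hroot := S.hasDerivAt_root (z := S.r) (by rw [S.norm_r]; exact S.r_lt_Rh ht)
  rw [S.root_r, S.deriv_A_ofReal _ S.t_lt_sigma] at hroot
  have hslope := S.hasDerivAt_slopeA S.lam_lt_t S.t_lt_sigma
  rw [← S.root_r] at hslope
  refine (HasDerivAt.deriv ((hslope.comp (S.r : ℂ) hroot).const_mul (S.lam : ℂ))).trans ?_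
  push_cast
  rfl

theorem dslope_lamSlope_ne_zero (ht : S.t < S.τ) : dslope S.lamSlope S.r S.r ≠ 0 := by
  have hslope : 0 < S.a1 S.t - S.realSlope S.t :=
    sub_pos.2 (S.realSlope_lt_a1 S.lam_lt_t S.t_lt_sigma)
  have hl1 : 0 < 1 - S.l1 * S.a1 S.t := sub_pos.2 (S.l1_mul_a1_lt_one ht)
  have ht' : 0 < S.t - S.lam := sub_pos.2 S.lam_lt_t
  have hl2 := S.l2_pos
  have hlam := S.lam_pos
  rw [dslope_same, S.deriv_lamSlope ht]
  exact Complex.ofReal_ne_zero.2 (by positivity)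

theorem analyticAt_f1Numerator_r (ht : S.t < S.τ) : AnalyticAt ℂ S.f1Numerator S.r := by
  have hr : ‖(S.r : ℂ)‖ < S.Rh := by
    rw [S.norm_r]
    exact S.r_lt_Rh ht
  have hslope := S.analyticAt_slopeA_root hr
  exact (analyticAt_const.mul hslope).div (analyticAt_dslope (analyticAt_const.mul hslope))
    (S.dslope_lamSlope_ne_zero ht)

theorem residueConst_eq (hd : S.lam * S.realSlope S.t = 1) :
    S.residueConst = S.realSlope S.t * (S.t - S.lam) * (1 - S.l1 * S.a1 S.t) /
      (S.lam * (S.a1 S.t - S.realSlope S.t)) := by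
  have hnum : S.realSlope S.t * (S.t - S.lam) = -(1 - S.r) := by
    linear_combination S.realSlope S.t * (-S.lam_mul_r hd) - (1 - S.r) * hd
  have hden : S.lam * (S.a1 S.t - S.realSlope S.t) = -(1 - S.lam * S.a1 S.t) := by linarith
  rw [residueConst, hnum, hden, neg_mul, neg_div_neg_eq]

theorem f1Numerator_r (ht : S.t < S.τ) (hd : S.lam * S.realSlope S.t = 1) :
    S.f1Numerator S.r = S.residueConst := by
  have hslope : S.a1 S.t - S.realSlope S.t ≠ 0 :=
    (sub_pos.2 (S.realSlope_lt_a1 S.lam_lt_t S.t_lt_sigma)).ne'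
  have ht' : S.t - S.lam ≠ 0 := (sub_pos.2 S.lam_lt_t).ne'
  have hl2 := S.l2_pos.ne'
  have hlam := S.lam_pos.ne'
  rw [f1Numerator, dslope_same, S.deriv_lamSlope ht, S.root_r, S.slopeA_ofReal S.t_lt_sigma,
    ← Complex.ofReal_mul, ← Complex.ofReal_div, S.residueConst_eq hd]
  congr 1
  field_simp

/-- The function `f₁(z) - c_{f₁}^{(1)} / (r - z)`, extended analytically to `z = r`. -/
noncomputable def regularPart (z : ℂ) : ℂ := -dslope S.f1Numerator S.r z

theorem analyticAt_regularPart_r (ht : S.t < S.τ) : AnalyticAt ℂ S.regularPart S.r :=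
  (analyticAt_dslope (S.analyticAt_f1Numerator_r ht)).neg

theorem differentiableAt_regularPart (hd : S.lam * S.realSlope S.t = 1) {z : ℂ}
    (hz : ‖z‖ < S.r) : DifferentiableAt ℂ S.regularPart z :=
  ((differentiableAt_dslope_of_ne (S.ne_ofReal_r_of_norm_lt hz)).2
    (S.analyticAt_f1Numerator_of_norm_lt hd hz).differentiableAt).neg

theorem f1Ext_eq_add_regularPart (ht : S.t < S.τ) (hd : S.lam * S.realSlope S.t = 1) {z : ℂ}
    (hz : z ≠ S.r) : S.f1Ext z = S.residueConst / (S.r - z) + S.regularPart z := by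
  have hslope := sub_smul_dslope S.f1Numerator S.r z
  rw [S.f1Numerator_r ht hd, smul_eq_mul] at hslope
  rw [S.f1Ext_eq_f1Numerator_div hd, regularPart, div_add' _ _ _ (sub_ne_zero.2 hz.symm)]
  congr 1
  linear_combination -hslope

theorem continuousOn_regularPart (ht : S.t < S.τ) (hd : S.lam * S.realSlope S.t = 1) :
    ContinuousOn (fun x : ℝ => S.regularPart x) (Set.Icc 1 S.r) := by
  intro x hx
  have hcont : ContinuousAt S.regularPart (x : ℂ) := by
    rcases hx.2.eq_or_lt with rfl | hlt
    · exact (S.analyticAt_regularPart_r ht).continuousAt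
    · refine (S.differentiableAt_regularPart hd ?_).continuousAt
      rwa [Complex.norm_real, Real.norm_of_nonneg (zero_le_one.trans hx.1)]
  exact (hcont.comp Complex.continuous_ofReal.continuousAt).continuousWithinAt

theorem regularPart_ofReal (ht : S.t < S.τ) (hd : S.lam * S.realSlope S.t = 1) {x : ℝ}
    (hx : x ∈ Set.Ioo 1 S.r) : S.regularPart x = S.integrand x := by
  have hx0 : 0 ≤ x := zero_le_one.trans hx.1.le
  have hxr : ‖(x : ℂ)‖ < S.r := by
    rw [Complex.norm_real, Real.norm_of_nonneg hx0]
    exact hx.2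
  have hx1 : (x : ℂ) ≠ 1 := by exact_mod_cast hx.1.ne'
  have hxR := hx.2.trans_le S.r_le_Rh
  have hne := S.ne_ofReal_r_of_norm_lt hxr
  have hf := S.f1Ext_eq_add_regularPart ht hd hne
  rw [S.f1Ext_eq (hxr.le.trans S.r_le_Rh) hx1
    (S.one_sub_lam_mul_slopeA_root_ne_zero hxr.le hne),
    S.nonnegCoeff_hExt.eq_ofReal S.differentiableOn_hExt hx0 hxR,
    ← S.nonnegCoeff_hExt.val_eq_re S.differentiableOn_hExt hx0 hxR] at hf
  rw [integrand]
  push_cast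
  rw [hf, add_sub_cancel_left]

theorem ae_regularPart_eq_integrand (ht : S.t < S.τ) (hd : S.lam * S.realSlope S.t = 1) :
    ∀ᵐ x : ℝ, x ∈ Set.uIoc 1 S.r → S.regularPart x = S.integrand x := by
  have hne : ∀ᵐ x : ℝ, x ≠ S.r := by simp [ae_iff]
  filter_upwards [hne] with x hx hx'
  rw [Set.uIoc_of_le S.one_lt_r.le] at hx'
  exact S.regularPart_ofReal ht hd ⟨hx'.1, hx'.2.lt_of_ne hx⟩

theorem intervalIntegrable_integrand (ht : S.t < S.τ) (hd : S.lam * S.realSlope S.t = 1) :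
    IntervalIntegrable S.integrand volume S.r 1 := by
  have hre : IntervalIntegrable (fun x : ℝ => (S.regularPart x).re) volume 1 S.r :=
    (Complex.continuous_re.comp_continuousOn
      (S.continuousOn_regularPart ht hd)).intervalIntegrable_of_Icc S.one_lt_r.le
  refine (hre.congr_ae ?_).symm
  rw [Filter.EventuallyEq, ae_restrict_iff' measurableSet_uIoc]
  filter_upwards [S.ae_regularPart_eq_integrand ht hd] with x hx hx'
  rw [hx hx', Complex.ofReal_re]

theorem integral_regularPart (ht : S.t < S.τ) (hd : S.lam * S.realSlope S.t = 1) :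
    ∫ x in (1 : ℝ)..S.r, S.regularPart x = ((-∫ x in S.r..1, S.integrand x : ℝ) : ℂ) := by
  rw [← intervalIntegral.integral_symm, ← intervalIntegral.integral_ofReal]
  exact intervalIntegral.integral_congr_ae (S.ae_regularPart_eq_integrand ht hd)

theorem exists_f1Primitive_eq_log (ht : S.t < S.τ) (hd : S.lam * S.realSlope S.t = 1) :
    ∃ Γ : ℂ → ℂ, AnalyticAt ℂ Γ S.r ∧ ∀ᶠ z in 𝓝[ball 0 S.r] (S.r : ℂ),
      S.f1Primitive z = -(S.residueConst * Complex.log (S.r - z)) + Γ z := by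
  obtain ⟨Γ, aΓ, hΓ⟩ := exists_analyticAt_primitive (S.analyticAt_regularPart_r ht)
  have hP : ∀ᶠ z in 𝓝[ball 0 S.r] (S.r : ℂ),
      HasDerivAt (fun z => -(S.residueConst * Complex.log (S.r - z)) + Γ z) (S.f1Ext z) z := by
    filter_upwards [self_mem_nhdsWithin, nhdsWithin_le_nhds hΓ] with z hz hΓz
    rw [S.f1Ext_eq_add_regularPart ht hd (S.ne_ofReal_r_of_norm_lt (mem_ball_zero_iff.1 hz))]
    exact (hasDerivAt_log_sub _ (ball_subset_slitPlaneAt _ hz)).add hΓz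
  obtain ⟨C, hC⟩ := S.exists_f1Primitive_eq_add_const hP
  refine ⟨fun z => Γ z + C, aΓ.add analyticAt_const, ?_⟩
  filter_upwards [hC] with z hz
  rw [hz, add_assoc]

/-- Integrate `f₁(x) - c_{f₁}^{(1)} / (r - x)` from `1` to `r`. -/
theorem log_constant_sub_f1Primitive_one (ht : S.t < S.τ) (hd : S.lam * S.realSlope S.t = 1)
    {Γ : ℂ → ℂ} (hΓ : ContinuousAt Γ S.r) (hP : ∀ᶠ z in 𝓝[ball 0 S.r] (S.r : ℂ),
      S.f1Primitive z = -(S.residueConst * Complex.log (S.r - z)) + Γ z) :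
    Γ S.r - S.f1Primitive 1 =
      ((Real.log (S.r - 1) * S.residueConst + -∫ x in S.r..1, S.integrand x : ℝ) : ℂ) := by
  let f : ℝ → ℂ := fun x => S.f1Primitive x - -(S.residueConst * Complex.log (S.r - (x : ℂ)))
  have hf : ∀ x : ℝ, 0 ≤ x → x < S.r → HasDerivAt f (S.regularPart x) x := by
    intro x hx0 hxr
    have hxn : ‖(x : ℂ)‖ < S.r := by rwa [Complex.norm_real, Real.norm_of_nonneg hx0]
    refine ((S.hasDerivAt_f1Primitive hxn).sub
      (hasDerivAt_log_sub _ (mem_slitPlaneAt_of_norm_lt hxn))).comp_ofReal.congr_deriv ?_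
    rw [S.f1Ext_eq_add_regularPart ht hd (S.ne_ofReal_r_of_norm_lt hxn), add_sub_cancel_left]
  have hlim : Tendsto f (𝓝[<] S.r) (𝓝 (Γ S.r)) := by
    have hΓlim : Tendsto (fun x : ℝ => Γ x) (𝓝[<] S.r) (𝓝 (Γ S.r)) :=
      (hΓ.tendsto.comp (Complex.continuous_ofReal.tendsto S.r)).mono_left nhdsWithin_le_nhds
    refine hΓlim.congr' ?_
    filter_upwards [(tendsto_ofReal_nhdsLT_nhdsWithin_ball S.r_pos).eventually hP] with x hx
    simp only [f, hx, add_sub_cancel_left]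
  have hintegral := intervalIntegral.integral_eq_sub_of_hasDerivAt_of_tendsto S.one_lt_r
    (fun x hx => hf x (zero_le_one.trans hx.1.le) hx.2)
    ((S.continuousOn_regularPart ht hd).intervalIntegrable_of_Icc S.one_lt_r.le)
    ((hf 1 zero_le_one S.one_lt_r).continuousAt.tendsto.mono_left nhdsWithin_le_nhds) hlim
  have hlog : Complex.log (S.r - 1) = (Real.log (S.r - 1) : ℂ) := by
    rw [Complex.ofReal_log (sub_pos.2 S.one_lt_r).le]
    push_cast
    rfl
  simp only [S.integral_regularPart ht hd, f, Complex.ofReal_one, hlog] at hintegral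
  push_cast at hintegral ⊢
  linear_combination -hintegral

theorem exists_Q_eq_cpow (ht : S.t < S.τ) (hd : S.lam * S.realSlope S.t = 1) :
    ∃ M : ℂ → ℂ, AnalyticAt ℂ M S.r ∧ M S.r = S.cQ ∧ ∀ᶠ z in 𝓝[ball 0 S.r] (S.r : ℂ),
      S.Q z = M z * ((S.r : ℂ) - z) ^ (-(S.c * S.residueConst : ℝ) : ℂ) := by
  obtain ⟨Γ, aΓ, hP⟩ := S.exists_f1Primitive_eq_log ht hd
  refine ⟨fun z => S.q0 * Complex.exp (S.c * (Γ z - S.f1Primitive 1)),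
    analyticAt_const.mul (analyticAt_const.mul (aΓ.sub analyticAt_const)).cexp, ?_, ?_⟩
  · have hexp : S.cQ = S.q0 * Real.exp (S.c * (Real.log (S.r - 1) * S.residueConst +
        -∫ x in S.r..1, S.integrand x)) := by
      rw [cQ, Real.rpow_def_of_pos (sub_pos.2 S.one_lt_r), mul_assoc, ← Real.exp_add]
      congr 2
      ring
    simp only [S.log_constant_sub_f1Primitive_one ht hd aΓ.continuousAt hP, hexp]
    push_cast
    rfl
  · filter_upwards [hP, self_mem_nhdsWithin] with z hz hzb
    have hne : (S.r : ℂ) - z ≠ 0 := Complex.slitPlane_ne_zero (ball_subset_slitPlaneAt _ hzb)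
    rw [Q, hz, Complex.cpow_def_of_ne_zero hne, mul_assoc, ← Complex.exp_add]
    congr 2
    push_cast
    ring

/-- The coefficient of `(r - z)^{-1 - (λ/ν) c_{f₁}^{(1)}}` in the relations for `R` and `P₂` at a
pole `r < R_h` of `f₁`. -/
noncomputable def poleCoeff : ℝ := S.lam / S.l2 * S.cQ * S.residueConst

theorem poleCoeff_ne_zero (ht : S.t < S.τ) (hd : S.lam * S.realSlope S.t = 1) :
    S.poleCoeff ≠ 0 :=
  mul_ne_zero (mul_ne_zero S.lam_div_l2_pos.ne' S.cQ_pos.ne') (S.residueConst_pos ht hd).ne'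

theorem exists_Q_R_eq_cpow (ht : S.t < S.τ) (hd : S.lam * S.realSlope S.t = 1) :
    ∃ M m : ℂ → ℂ, AnalyticAt ℂ M S.r ∧ AnalyticAt ℂ m S.r ∧ m S.r = S.poleCoeff ∧
      (∀ᶠ z in 𝓝[ball 0 S.r] (S.r : ℂ),
        S.Q z = (S.r - z) * M z * ((S.r : ℂ) - z) ^ ((-1 - S.c * S.residueConst : ℝ) : ℂ)) ∧
      ∀ᶠ z in 𝓝[ball 0 S.r] (S.r : ℂ),
        S.R z = m z * ((S.r : ℂ) - z) ^ ((-1 - S.c * S.residueConst : ℝ) : ℂ) := by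
  obtain ⟨M, aM, hM, hQ⟩ := S.exists_Q_eq_cpow ht hd
  have hpow : ∀ z ∈ ball (0 : ℂ) S.r, ((S.r : ℂ) - z) ^ (-(S.c * S.residueConst : ℝ) : ℂ) =
      (S.r - z) * ((S.r : ℂ) - z) ^ ((-1 - S.c * S.residueConst : ℝ) : ℂ) := by
    intro z hz
    have hexp : (-(S.c * S.residueConst : ℝ) : ℂ) =
        1 + ((-1 - S.c * S.residueConst : ℝ) : ℂ) := by
      push_cast
      ring
    rw [hexp, Complex.cpow_add _ _ (Complex.slitPlane_ne_zero (ball_subset_slitPlaneAt _ hz)),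
      Complex.cpow_one]
  refine ⟨M, fun z => (S.lam / S.l2 : ℝ) * (S.f1Numerator z * M z), aM,
    analyticAt_const.mul ((S.analyticAt_f1Numerator_r ht).mul aM), ?_, ?_, ?_⟩
  · simp only [S.f1Numerator_r ht hd, hM, poleCoeff]
    push_cast
    ring
  · filter_upwards [hQ, self_mem_nhdsWithin] with z hz hzb
    rw [hz, hpow z hzb]
    ring
  · filter_upwards [hQ, self_mem_nhdsWithin] with z hz hzb
    have hne : (S.r : ℂ) - z ≠ 0 := Complex.slitPlane_ne_zero (ball_subset_slitPlaneAt _ hzb)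
    rw [R, hz, S.f1Ext_eq_f1Numerator_div hd, hpow z hzb]
    field_simp

end RetrialModel

/-! ### The kernel of a type-1 law -/

/-- The moment `∫ xⁿ exp(t x) dμ(x)` of the exponentially tilted law, which is the `n`-th derivative
of `t ↦ B*(-t)`. -/
noncomputable def tiltedMoment (μ : Measure ℝ) (n : ℕ) (t : ℝ) : ℝ :=
  ∫ x, x ^ n * Real.exp (t * x) ∂μ

theorem tiltedMoment_zero (μ : Measure ℝ) (t : ℝ) : tiltedMoment μ 0 t = mgf id μ t := by
  simp [tiltedMoment, mgf]

section Moments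

variable {μ : Measure ℝ}

theorem hasDerivAt_tiltedMoment {t : ℝ} (ht : t ∈ interior (integrableExpSet id μ)) (n : ℕ) :
    HasDerivAt (tiltedMoment μ n) (tiltedMoment μ (n + 1) t) t :=
  hasDerivAt_integral_pow_mul_exp_real ht n

theorem integrable_tiltedMoment {t : ℝ} (ht : t ∈ interior (integrableExpSet id μ)) (n : ℕ) :
    Integrable (fun x => x ^ n * Real.exp (t * x)) μ :=
  integrable_pow_mul_exp_of_mem_interior_integrableExpSet ht n

theorem iteratedDeriv_complexMGF_ofReal {t : ℝ} (ht : t ∈ interior (integrableExpSet id μ))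
    (n : ℕ) : iteratedDeriv n (complexMGF id μ) t = (tiltedMoment μ n t : ℂ) := by
  rw [iteratedDeriv_complexMGF (by simpa using ht), tiltedMoment, ← integral_complex_ofReal]
  simp

theorem iteratedDeriv_complexMGF_sub_ofReal {x c : ℝ}
    (hx : x - c ∈ interior (integrableExpSet id μ)) (n : ℕ) :
    iteratedDeriv n (fun u : ℂ => complexMGF id μ (u - (c : ℂ))) x = tiltedMoment μ n (x - c) := by
  rw [iteratedDeriv_comp_sub_const, ← iteratedDeriv_complexMGF_ofReal hx, Complex.ofReal_sub]

theorem norm_deriv_complexMGF_le (hμ : ∀ᵐ x ∂μ, 0 ≤ x) {u : ℂ}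
    (hu : u.re ∈ interior (integrableExpSet id μ)) :
    ‖deriv (complexMGF id μ) u‖ ≤ tiltedMoment μ 1 u.re := by
  rw [(hasDerivAt_complexMGF hu).deriv]
  refine (norm_integral_le_integral_norm _).trans_eq (integral_congr_ae ?_)
  filter_upwards [hμ] with x hx
  simp [Complex.norm_exp, abs_of_nonneg hx]

theorem mem_interior_of_lt_lstRadius (hμ : ∀ᵐ x ∂μ, 0 ≤ x) {t : ℝ}
    (ht : (t : EReal) < lstRadius μ) : t ∈ interior (integrableExpSet id μ) := by
  obtain ⟨s, hs⟩ := lt_iSup_iff.1 ht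
  obtain ⟨hsμ, hts⟩ := lt_iSup_iff.1 hs
  refine mem_interior.2 ⟨Set.Iio s, fun y hy => ?_, isOpen_Iio, EReal.coe_lt_coe_iff.1 hts⟩
  have hintegr : Integrable (fun x => Real.exp (s * id x)) μ := hsμ
  refine hintegr.mono' (by fun_prop) ?_
  filter_upwards [hμ] with x hx
  rw [Real.norm_of_nonneg (Real.exp_pos _).le]
  exact Real.exp_le_exp.2 (mul_le_mul_of_nonneg_right (le_of_lt hy) hx)

theorem exists_le_mgf (htype : IsType1 μ) (M : ℝ) :
    ∃ t : ℝ, 0 < t ∧ (t : EReal) < lstRadius μ ∧ M ≤ mgf id μ t := by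
  obtain ⟨U, hU, hUM⟩ := mem_comap.1 (htype.2.eventually_ge_atTop M)
  obtain ⟨l, hl, hlU⟩ := (mem_nhdsLT_iff_exists_Ioo_subset' htype.1).1 hU
  obtain ⟨t, ht, htR⟩ := EReal.lt_iff_exists_real_btwn.1 (max_lt htype.1 hl)
  refine ⟨t, by exact_mod_cast (le_max_left _ _).trans_lt ht, htR, ?_⟩
  simpa [lstReal] using hUM (hlU ⟨(le_max_right _ _).trans_lt ht, htR⟩ : (t : EReal) ∈ U)

theorem measure_Ioi_pos [IsProbabilityMeasure μ] (hμ : ∀ᵐ x ∂μ, 0 ≤ x) (htype : IsType1 μ) :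
    0 < μ (Set.Ioi 0) := by
  rw [pos_iff_ne_zero]
  intro h0
  obtain ⟨t, -, -, ht⟩ := exists_le_mgf htype 2
  have hexp : ∀ᵐ x ∂μ, Real.exp (t * id x) = 1 := by
    filter_upwards [hμ, measure_eq_zero_iff_ae_notMem.1 h0] with x hx hx0
    have hx_eq : x = 0 := le_antisymm (not_lt.1 hx0) hx
    simp [hx_eq]
  have hmgf : mgf id μ t = 1 := by
    rw [mgf, integral_congr_ae hexp]
    simp
  linarith

theorem tiltedMoment_pos [IsProbabilityMeasure μ] (hμ : ∀ᵐ x ∂μ, 0 ≤ x) (htype : IsType1 μ)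
    {t : ℝ} (ht : t ∈ interior (integrableExpSet id μ)) (n : ℕ) : 0 < tiltedMoment μ n t := by
  refine (integral_pos_iff_support_of_nonneg_ae ?_ (integrable_tiltedMoment ht n)).2
    ((measure_Ioi_pos hμ htype).trans_le (measure_mono fun x hx => ?_))
  · filter_upwards [hμ] with x hx
    positivity
  · have hx0 : 0 < x := hx
    exact (by positivity : x ^ n * Real.exp (t * x) ≠ 0)
theorem zero_mem_interior_integrableExpSet (hμ : ∀ᵐ x ∂μ, 0 ≤ x) (htype : IsType1 μ) :
    (0 : ℝ) ∈ interior (integrableExpSet id μ) :=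
  mem_interior_of_lt_lstRadius hμ (by simpa using htype.1)

theorem tiltedMoment_one_add_mul_le (hμ : ∀ᵐ x ∂μ, 0 ≤ x) {t : ℝ}
    (h0 : (0 : ℝ) ∈ interior (integrableExpSet id μ))
    (ht : t ∈ interior (integrableExpSet id μ)) :
    tiltedMoment μ 1 0 + t * tiltedMoment μ 2 0 ≤ tiltedMoment μ 1 t := by
  have hintegr₁ := integrable_tiltedMoment h0 1
  have hintegr₂ := (integrable_tiltedMoment h0 2).const_mul t
  rw [tiltedMoment, tiltedMoment, tiltedMoment, ← integral_const_mul,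
    ← integral_add hintegr₁ hintegr₂]
  refine integral_mono_ae (hintegr₁.add hintegr₂) (integrable_tiltedMoment ht 1) ?_
  filter_upwards [hμ] with x hx
  have hexp := mul_le_mul_of_nonneg_left (Real.add_one_le_exp (t * x)) hx
  simp only [zero_mul, Real.exp_zero, pow_one]
  nlinarith

theorem tiltedMoment_zero_le [IsProbabilityMeasure μ] {t : ℝ}
    (ht : t ∈ interior (integrableExpSet id μ)) :
    tiltedMoment μ 0 t ≤ 1 + t * tiltedMoment μ 1 t := by
  have hintegr := (integrable_tiltedMoment ht 1).const_mul t
  have hone : (1 : ℝ) = ∫ _, (1 : ℝ) ∂μ := by simp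
  rw [hone, tiltedMoment, tiltedMoment, ← integral_const_mul,
    ← integral_add (integrable_const _) hintegr]
  refine integral_mono (integrable_tiltedMoment ht 0) ((integrable_const _).add hintegr) fun x => ?_
  have hexp := mul_le_mul_of_nonneg_right (Real.add_one_le_exp (-(t * x)))
    (Real.exp_pos (t * x)).le
  rw [← Real.exp_add, neg_add_cancel, Real.exp_zero] at hexp
  simp only [pow_zero, one_mul, pow_one]
  linarith

theorem exists_one_lt_mul_tiltedMoment_of_eq_top [IsProbabilityMeasure μ]
    (hμ : ∀ᵐ x ∂μ, 0 ≤ x) (htype : IsType1 μ) (htop : lstRadius μ = ⊤) {l : ℝ} (hl : 0 < l) :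
    ∃ t : ℝ, 0 < t ∧ 1 < l * tiltedMoment μ 1 t := by
  have h0 := zero_mem_interior_integrableExpSet hμ htype
  have hpos₁ := tiltedMoment_pos hμ htype h0 1
  have hpos₂ := tiltedMoment_pos hμ htype h0 2
  refine ⟨1 / (l * tiltedMoment μ 2 0), by positivity, ?_⟩
  have hle := mul_le_mul_of_nonneg_left (tiltedMoment_one_add_mul_le
    (t := 1 / (l * tiltedMoment μ 2 0)) hμ h0
    (mem_interior_of_lt_lstRadius hμ (htop ▸ EReal.coe_lt_top _))) hl.le
  have hone : l * (1 / (l * tiltedMoment μ 2 0) * tiltedMoment μ 2 0) = 1 := by field_simp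
  nlinarith [mul_pos hl hpos₁]

theorem exists_one_lt_mul_tiltedMoment_of_eq_coe [IsProbabilityMeasure μ]
    (hμ : ∀ᵐ x ∂μ, 0 ≤ x) (htype : IsType1 μ) {T : ℝ} (hT : lstRadius μ = T) {l : ℝ}
    (hl : 0 < l) : ∃ t : ℝ, 0 < t ∧ t < T ∧ 1 < l * tiltedMoment μ 1 t := by
  have hTpos : 0 < T := by
    have hpos := htype.1
    rw [hT] at hpos
    exact_mod_cast hpos
  obtain ⟨t, ht0, htR, hmgf⟩ := exists_le_mgf htype (1 + (T + 1) / l)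
  have ht := mem_interior_of_lt_lstRadius hμ htR
  have htT : t < T := by
    rw [hT] at htR
    exact_mod_cast htR
  refine ⟨t, ht0, htT, ?_⟩
  rw [← tiltedMoment_zero] at hmgf
  have hle : (T + 1) / l ≤ t * tiltedMoment μ 1 t := by linarith [tiltedMoment_zero_le ht]
  rw [div_le_iff₀ hl] at hle
  nlinarith [mul_lt_mul_of_pos_right htT (mul_pos hl (tiltedMoment_pos hμ htype ht 1))]

theorem exists_one_lt_mul_tiltedMoment [IsProbabilityMeasure μ] (hμ : ∀ᵐ x ∂μ, 0 ≤ x)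
    (htype : IsType1 μ) {l : ℝ} (hl : 0 < l) :
    ∃ t : ℝ, 0 < t ∧ (t : EReal) < lstRadius μ ∧ 1 < l * tiltedMoment μ 1 t := by
  rcases eq_or_ne (lstRadius μ) ⊤ with htop | htop
  · obtain ⟨t, ht0, ht⟩ := exists_one_lt_mul_tiltedMoment_of_eq_top hμ htype htop hl
    exact ⟨t, ht0, htop ▸ EReal.coe_lt_top t, ht⟩
  · have hT := (EReal.coe_toReal htop (ne_bot_of_gt htype.1)).symm
    obtain ⟨t, ht0, htT, ht⟩ := exists_one_lt_mul_tiltedMoment_of_eq_coe hμ htype hT hl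
    refine ⟨t, ht0, ?_, ht⟩
    rw [hT]
    exact_mod_cast htT

theorem exists_mul_tiltedMoment_eq_one [IsProbabilityMeasure μ] (hμ : ∀ᵐ x ∂μ, 0 ≤ x)
    (htype : IsType1 μ) {l : ℝ} (hl : 0 < l) (h0 : l * tiltedMoment μ 1 0 < 1) :
    ∃ t s : ℝ, 0 < t ∧ t < s ∧ (s : EReal) < lstRadius μ ∧ l * tiltedMoment μ 1 t = 1 := by
  obtain ⟨s, hs0, hsR, hs⟩ := exists_one_lt_mul_tiltedMoment hμ htype hl
  have hc : ContinuousOn (fun t => l * tiltedMoment μ 1 t) (Set.Icc 0 s) := fun t ht =>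
    ((hasDerivAt_tiltedMoment (mem_interior_of_lt_lstRadius hμ
      ((EReal.coe_le_coe_iff.2 ht.2).trans_lt hsR)) 1).continuousAt.const_mul
        l).continuousWithinAt
  obtain ⟨t, ht, hte⟩ := intermediate_value_Ioo hs0.le hc ⟨h0, hs⟩
  exact ⟨t, s, ht.1, ht.2, hsR, hte⟩

end Moments

/-- The kernel of a type-1 law `μ`: `A` is the moment generating function of `μ` translated by
`l1 + l2`. -/
noncomputable def BusyKernel.ofLaw {μ : Measure ℝ} [IsProbabilityMeasure μ]
    (hμ : ∀ᵐ x ∂μ, 0 ≤ x) (htype : IsType1 μ) {l1 l2 s t : ℝ} (hl1 : 0 < l1) (hl2 : 0 < l2)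
    (ht : 0 < t) (hts : t < s) (hs : (s : EReal) < lstRadius μ)
    (hload : (l1 + l2) * tiltedMoment μ 1 0 < 1) (htau : l1 * tiltedMoment μ 1 t = 1) :
    BusyKernel :=
  have hmem {x : ℝ} (hx : x < l1 + l2 + s) :
      x - (l1 + l2) ∈ interior (integrableExpSet id μ) :=
    mem_interior_of_lt_lstRadius hμ ((EReal.coe_lt_coe_iff.2 (by linarith)).trans hs)
  have hmem' {u : ℂ} (hu : u.re < l1 + l2 + s) :
      (u - ((l1 + l2 : ℝ) : ℂ)).re ∈ interior (integrableExpSet id μ) := by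
    simpa using hmem hu
  { A u := complexMGF id μ (u - ((l1 + l2 : ℝ) : ℂ))
    a x := tiltedMoment μ 0 (x - (l1 + l2))
    a1 x := tiltedMoment μ 1 (x - (l1 + l2))
    a2 x := tiltedMoment μ 2 (x - (l1 + l2))
    l1 := l1
    l2 := l2
    σ := l1 + l2 + s
    τ := l1 + l2 + t
    l1_pos := hl1
    l2_pos := hl2
    add_lt_tau := by linarith
    tau_lt_sigma := by linarith
    differentiableOn_A u hu := ((hasDerivAt_complexMGF (hmem' hu)).comp_sub_const
      u _).differentiableAt.differentiableWithinAt
    iteratedDeriv_nonneg n x hx := by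
      rw [iteratedDeriv_complexMGF_sub_ofReal (hmem hx)]
      exact Complex.zero_le_real.2 (tiltedMoment_pos hμ htype (hmem hx) n).le
    A_ofReal x hx := by simpa using iteratedDeriv_complexMGF_sub_ofReal (hmem hx) 0
    deriv_A_ofReal x hx := by simpa using iteratedDeriv_complexMGF_sub_ofReal (hmem hx) 1
    norm_A_le u _ := by
      simpa [tiltedMoment_zero] using
        norm_complexMGF_le_mgf (X := id) (μ := μ) (z := u - ((l1 + l2 : ℝ) : ℂ))
    norm_deriv_A_le u hu := by
      rw [deriv_comp_sub_const]
      simpa using norm_deriv_complexMGF_le hμ (hmem' hu)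
    hasDerivAt_a x hx := (hasDerivAt_tiltedMoment (hmem hx) 0).comp_sub_const x _
    hasDerivAt_a1 x hx := (hasDerivAt_tiltedMoment (hmem hx) 1).comp_sub_const x _
    a_pos x hx := tiltedMoment_pos hμ htype (hmem hx) 0
    a1_pos x hx := tiltedMoment_pos hμ htype (hmem hx) 1
    a2_pos x hx := tiltedMoment_pos hμ htype (hmem hx) 2
    a_add := by simp [tiltedMoment_zero]
    mul_a1_add_lt_one := by simpa using hload
    l1_mul_a1_tau := by simpa using htau }

/-- The kernel `K` is built from the transform of `μ`, with rates `l1` and `l2`. -/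
structure BusyKernel.IsFor (K : BusyKernel) (μ : Measure ℝ) (l1 l2 : ℝ) : Prop where
  l1_eq : K.l1 = l1
  l2_eq : K.l2 = l2
  A_eq : ∀ u, K.A u = complexMGF id μ (u - ((l1 + l2 : ℝ) : ℂ))
  a_eq : ∀ x, K.a x = mgf id μ (x - (l1 + l2))

theorem exists_busyKernel_isFor {μ : Measure ℝ} [IsProbabilityMeasure μ] (hμ : ∀ᵐ x ∂μ, 0 ≤ x)
    (htype : IsType1 μ) {l1 l2 : ℝ} (hl1 : 0 < l1) (hl2 : 0 < l2) (hload : load μ l1 l2 < 1) :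
    ∃ K : BusyKernel, K.IsFor μ l1 l2 := by
  have hload' : (l1 + l2) * tiltedMoment μ 1 0 < 1 := by simpa [load, tiltedMoment] using hload
  have hpos := tiltedMoment_pos hμ htype (zero_mem_interior_integrableExpSet hμ htype) 1
  obtain ⟨t, s, ht, hts, hs, htau⟩ :=
    exists_mul_tiltedMoment_eq_one hμ htype hl1 (by nlinarith [mul_pos hl2 hpos])
  exact ⟨.ofLaw hμ htype hl1 hl2 ht hts hs hload' htau, rfl, rfl, fun _ => rfl,
    fun _ => tiltedMoment_zero μ _⟩

/-! ### The generating functions of the retrial queue -/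

theorem eventuallyEq_nhds_zero_of_norm_lt_one {f g : ℂ → ℂ} (h : ∀ z, ‖z‖ < 1 → f z = g z) :
    f =ᶠ[𝓝 0] g := by
  filter_upwards [ball_mem_nhds (0 : ℂ) one_pos] with z hz
  exact h z (mem_ball_zero_iff.1 hz)

theorem val_congr {f g : ℂ → ℂ} (h : ∀ z, ‖z‖ < 1 → f z = g z) : val f = val g := by
  funext x
  simp only [val, coeff_congr (eventuallyEq_nhds_zero_of_norm_lt_one h)]

theorem convergesAt_congr {f g : ℂ → ℂ} (h : ∀ z, ‖z‖ < 1 → f z = g z) {x : ℝ} :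
    ConvergesAt f x ↔ ConvergesAt g x := by
  simp only [ConvergesAt, coeff_congr (eventuallyEq_nhds_zero_of_norm_lt_one h)]

theorem convergesAt_of_sqrt {f F H : ℂ → ℂ} {R : ℝ} (hR : 0 < R)
    (hF : DifferentiableOn ℂ F (ball 0 R)) (hFf : ∀ z, ‖z‖ < 1 → F z = f z)
    (hpos : NonnegCoeff F) (hH : ContinuousAt H 0)
    (hFH : ∀ᶠ z in 𝓝[ball 0 R] (R : ℂ), F z = H (sqrtSub R z)) :
    ConvergesAt f R ∧ (val f R : ℂ) = H 0 := by
  have hfF (z : ℂ) (hz : ‖z‖ < 1) : f z = F z := (hFf z hz).symm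
  rw [convergesAt_congr hfF, val_congr hfF]
  exact hpos.convergesAt_of_tendsto hR hF (tendsto_of_sqrt hR hH hFH)

theorem hasDeltaExpansion_val_of_sqrt {f F H : ℂ → ℂ} {R : ℝ} {c : ℂ} (hR : 1 ≤ R)
    (hF : DifferentiableOn ℂ F (ball 0 R)) (hFf : ∀ z, ‖z‖ < 1 → F z = f z)
    (hζ : ∀ ζ : ℂ, ‖ζ‖ = R → ζ ≠ R → ContinuesAcross F R ζ) (hpos : NonnegCoeff F)
    (hH : AnalyticAt ℂ H 0) (hc : c ≠ 0) (hH' : HasDerivAt H (-c) 0)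
    (hFH : ∀ᶠ z in 𝓝[ball 0 R] (R : ℂ), F z = H (sqrtSub R z)) :
    HasDeltaExpansion f R (fun z => (val f R : ℂ) - c * ((R : ℂ) - z) ^ (1 / 2 : ℂ))
      (fun z => c * ((R : ℂ) - z) ^ (1 / 2 : ℂ)) := by
  rw [(convergesAt_of_sqrt (zero_lt_one.trans_le hR) hF hFf hpos hH.continuousAt hFH).2]
  exact hasDeltaExpansion_of_sqrt hR hF hFf hζ
    (hH.eventually_analyticAt.filter_mono nhdsWithin_le_nhds) hFH (isLittleO_sub_linear hc hH')

theorem deltaEquivalent_of_div_sqrt {f F m : ℂ → ℂ} {R : ℝ} (hR : 1 ≤ R)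
    (hF : DifferentiableOn ℂ F (ball 0 R)) (hFf : ∀ z, ‖z‖ < 1 → F z = f z)
    (hζ : ∀ ζ : ℂ, ‖ζ‖ = R → ζ ≠ R → ContinuesAcross F R ζ) (hm : AnalyticAt ℂ m 0)
    (h0 : m 0 ≠ 0)
    (hFm : ∀ᶠ z in 𝓝[ball 0 R] (R : ℂ), F z = m (sqrtSub R z) / sqrtSub R z) :
    DeltaEquivalent f R (fun z => m 0 / ((R : ℂ) - z) ^ (1 / 2 : ℂ)) := by
  refine hasDeltaExpansion_of_sqrt (H := fun s => m s / s) hR hF hFf hζ ?_ hFm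
    (isLittleO_div_sub hm.continuousAt h0)
  filter_upwards [hm.eventually_analyticAt.filter_mono nhdsWithin_le_nhds, self_mem_nhdsWithin]
    with s hs hs0
  exact hs.div analyticAt_id hs0

namespace BusyKernel

variable {K : BusyKernel} {μ : Measure ℝ} {l1 l2 nu t : ℝ}

theorem exists_lam_mul_realSlope_eq_one (h : 1 < K.lam * K.realSlope K.τ) :
    ∃ t, K.lam < t ∧ t < K.τ ∧ K.lam * K.realSlope t = 1 := by
  have hcont : ContinuousOn (fun t => K.lam * K.realSlope t) (Set.Icc K.lam K.τ) :=
    (K.continuousOn_realSlope.mono fun t ht => ht.2.trans_lt K.tau_lt_sigma).const_mul K.lam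
  obtain ⟨t, ht, hd⟩ :=
    intermediate_value_Ioo K.lam_lt_tau.le hcont ⟨K.lam_mul_realSlope_lam_lt_one, h⟩
  exact ⟨t, ht.1, ht.2, hd⟩

theorem val_hExt_psi_sub_eq_zero_iff (ht0 : K.lam < t) (ht : t ≤ K.τ) :
    val K.hExt (K.psi t) - K.psi t = 0 ↔ K.lam * K.realSlope t = 1 := by
  have hid := K.l2_mul_a_sub_psi ht0.le ht
  rw [K.val_hExt_psi ht0.le ht, ← mul_eq_zero_iff_left K.l2_pos.ne', hid,
    mul_eq_zero_iff_left (sub_pos.2 ht0).ne', sub_eq_zero]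

theorem exists_psi_eq {x : ℝ} (hx1 : 1 < x) (hx : x ≤ K.Rh) :
    ∃ t, K.lam < t ∧ t ≤ K.τ ∧ K.psi t = x := by
  obtain ⟨t, -, ht, rfl, -⟩ := K.exists_root_ofReal (zero_le_one.trans hx1.le) hx
  refine ⟨t, (K.strictMonoOn_psi.lt_iff_lt K.lam_lt_tau.le ht).1 ?_, ht, rfl⟩
  rwa [K.psi_lam]

namespace IsFor

theorem lam_eq (hK : K.IsFor μ l1 l2) : K.lam = l1 + l2 := by rw [lam, hK.l1_eq, hK.l2_eq]

theorem lst_eq (hK : K.IsFor μ l1 l2) (w z : ℂ) :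
    lst μ ((l1 : ℂ) * (1 - w) + (l2 : ℂ) * (1 - z)) = K.A (K.l1 * w + K.l2 * z) := by
  rw [hK.A_eq, hK.l1_eq, hK.l2_eq, lst]
  congr 1
  push_cast
  ring

theorem h_eq (hK : K.IsFor μ l1 l2) {z : ℂ} (hz : ‖z‖ < 1) :
    PriorityRetrial.h μ l1 l2 z = K.hExt z := by
  have hspec := Classical.epsilon_spec (p := fun w : ℂ =>
    ‖w‖ < 1 ∧ w = lst μ ((l1 : ℂ) * (1 - w) + (l2 : ℂ) * (1 - z)))
    ⟨K.hExt z, K.norm_hExt_lt_one hz, by rw [hK.lst_eq]; exact K.hExt_eq_A hz⟩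
  exact K.eq_hExt_of_eq_A hz hspec.1 (hspec.2.trans (hK.lst_eq _ _))

theorem f1_eq (hK : K.IsFor μ l1 l2) {z : ℂ} (hz : ‖z‖ < 1) :
    PriorityRetrial.f1 μ l1 l2 z = K.f1Ext z := by
  rw [PriorityRetrial.f1, hK.h_eq hz, K.f1Ext_eq_of_lt_one hz]

theorem val_h (hK : K.IsFor μ l1 l2) : val (PriorityRetrial.h μ l1 l2) = val K.hExt :=
  val_congr fun _ hz => hK.h_eq hz

theorem isDominantSingularity_h (hK : K.IsFor μ l1 l2) :
    IsDominantSingularity (PriorityRetrial.h μ l1 l2) K.Rh :=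
  isDominantSingularity_of_not_continuesAcross K.Rh_pos K.differentiableOn_hExt
    (fun _ hz => (hK.h_eq hz).symm) (fun _ => K.continuesAcross_hExt) K.not_continuesAcross_hExt

theorem convergesAt_h (hK : K.IsFor μ l1 l2) : ConvergesAt (PriorityRetrial.h μ l1 l2) K.Rh :=
  (convergesAt_congr fun _ hz => hK.h_eq hz).2 K.convergesAt_hExt_Rh.1

theorem lstReal_eq (hK : K.IsFor μ l1 l2) : lstReal μ = fun s => K.a (l1 + l2 - s) := by
  funext s
  rw [hK.a_eq, lstReal, sub_sub_cancel_left]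

theorem deriv_lstReal (hK : K.IsFor μ l1 l2) {x : ℝ} (hx : x < K.σ) :
    deriv (lstReal μ) (l1 + l2 - x) = -K.a1 x := by
  rw [hK.lstReal_eq, deriv_comp_const_sub, sub_sub_cancel, (K.hasDerivAt_a x hx).deriv]

theorem iteratedDeriv_two_lstReal (hK : K.IsFor μ l1 l2) {x : ℝ} (hx : x < K.σ) :
    iteratedDeriv 2 (lstReal μ) (l1 + l2 - x) = K.a2 x := by
  rw [hK.lstReal_eq, iteratedDeriv_comp_const_sub]
  have hderiv : deriv K.a =ᶠ[𝓝 x] K.a1 := by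
    filter_upwards [gt_mem_nhds hx] with y hy using (K.hasDerivAt_a y hy).deriv
  simp [iteratedDeriv_succ', hderiv.deriv_eq, (K.hasDerivAt_a1 x hx).deriv]

theorem ch_eq (hK : K.IsFor μ l1 l2) : PriorityRetrial.ch μ l1 l2 K.Rh = K.ch := by
  have hval : val K.hExt K.Rh = K.a K.τ := K.val_hExt_psi K.lam_lt_tau.le le_rfl
  have harg : l1 * (1 - K.a K.τ) + l2 * (1 - K.Rh) = l1 + l2 - K.τ := by
    have hpsi := K.l2_mul_psi_add K.τ
    rw [Rh, ← hK.l1_eq, ← hK.l2_eq]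
    linarith
  rw [PriorityRetrial.ch, hK.val_h, hval, harg, hK.iteratedDeriv_two_lstReal K.tau_lt_sigma, ch,
    hK.l1_eq, hK.l2_eq]

theorem mem_zerosAboveOne_iff (hK : K.IsFor μ l1 l2) {x : ℝ} :
    x ∈ zerosAboveOne μ l1 l2 K.Rh ↔
      ∃ t, K.lam < t ∧ t ≤ K.τ ∧ K.lam * K.realSlope t = 1 ∧ x = K.psi t := by
  rw [zerosAboveOne, Set.mem_ofPred_eq, hK.val_h]
  constructor
  · rintro ⟨hx1, hx, hzero⟩
    obtain ⟨t, ht0, ht, rfl⟩ := exists_psi_eq hx1 hx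
    exact ⟨t, ht0, ht, (val_hExt_psi_sub_eq_zero_iff ht0 ht).1 hzero, rfl⟩
  · rintro ⟨t, ht0, ht, hd, rfl⟩
    exact ⟨K.one_lt_psi ht0 ht, K.psi_le_Rh ht, (val_hExt_psi_sub_eq_zero_iff ht0 ht).2 hd⟩

theorem zerosAboveOne_eq_empty (hK : K.IsFor μ l1 l2) (hd : K.lam * K.realSlope K.τ < 1) :
    zerosAboveOne μ l1 l2 K.Rh = ∅ := by
  refine Set.eq_empty_of_forall_notMem fun x hx => ?_
  obtain ⟨t, -, ht, hdt, -⟩ := hK.mem_zerosAboveOne_iff.1 hx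
  have hle := mul_le_mul_of_nonneg_left (K.strictMonoOn_realSlope.monotoneOn
    (ht.trans_lt K.tau_lt_sigma) K.tau_lt_sigma ht) K.lam_pos.le
  linarith

theorem isLeast_zerosAboveOne (hK : K.IsFor μ l1 l2) (ht0 : K.lam < t) (ht : t ≤ K.τ)
    (hd : K.lam * K.realSlope t = 1) : IsLeast (zerosAboveOne μ l1 l2 K.Rh) (K.psi t) := by
  refine ⟨hK.mem_zerosAboveOne_iff.2 ⟨t, ht0, ht, hd, rfl⟩, fun x hx => ?_⟩
  obtain ⟨s, -, hs, hds, rfl⟩ := hK.mem_zerosAboveOne_iff.1 hx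
  have hslope : K.realSlope s = K.realSlope t := mul_left_cancel₀ K.lam_pos.ne' (hds.trans hd.symm)
  rw [K.strictMonoOn_realSlope.injOn (hs.trans_lt K.tau_lt_sigma) (ht.trans_lt K.tau_lt_sigma)
    hslope]

end IsFor

end BusyKernel

/-- The model `S` is built from the transform of `μ`, with rates `l1`, `l2` and `nu`. -/
structure RetrialModel.IsFor (S : RetrialModel) (μ : Measure ℝ) (l1 l2 nu : ℝ) : Prop
    extends S.toBusyKernel.IsFor μ l1 l2 where
  c_eq : S.c = (l1 + l2) / nu
  q0_eq : S.q0 = 1 - load μ l1 l2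

theorem BusyKernel.IsFor.exists_retrialModel {K : BusyKernel} {μ : Measure ℝ} {l1 l2 nu t : ℝ}
    (hK : K.IsFor μ l1 l2) (hnu : 0 < nu) (hload : load μ l1 l2 < 1) (ht0 : K.lam < t)
    (ht : t ≤ K.τ) (hd : K.lam * K.realSlope t ≤ 1) :
    ∃ S : RetrialModel, S.toBusyKernel = K ∧ S.t = t ∧ S.IsFor μ l1 l2 nu :=
  ⟨{ toBusyKernel := K
     t := t
     c := (l1 + l2) / nu
     q0 := 1 - load μ l1 l2
     lam_lt_t := ht0
     t_le_tau := ht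
     lam_mul_realSlope_t_le_one := hd
     c_pos := div_pos (hK.lam_eq ▸ K.lam_pos) hnu
     q0_pos := sub_pos.2 hload }, rfl, rfl, hK, rfl, rfl⟩

theorem norm_add_mul_one_sub_le (z : ℂ) {t : ℝ} (ht : t ∈ Set.Icc (0 : ℝ) 1) :
    ‖z + (t : ℂ) * (1 - z)‖ ≤ (1 - t) * ‖z‖ + t := by
  have hconv : z + (t : ℂ) * (1 - z) = ((1 - t : ℝ) : ℂ) * z + t := by
    push_cast
    ring
  rw [hconv]
  refine (norm_add_le _ _).trans_eq ?_
  rw [norm_mul, Complex.norm_real, Complex.norm_real, Real.norm_of_nonneg ht.1,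
    Real.norm_of_nonneg (sub_nonneg.2 ht.2)]

namespace RetrialModel

variable {S : RetrialModel} {μ : Measure ℝ} {l1 l2 nu : ℝ}

theorem integral_f1Ext_segment (S : RetrialModel) {z : ℂ} (hz : ‖z‖ < 1) :
    ∫ t in (0 : ℝ)..1, S.f1Ext (z + (t : ℂ) * (1 - z)) * (1 - z) =
      S.f1Primitive 1 - S.f1Primitive z := by
  have hsegment {t : ℝ} (ht : t ∈ Set.Icc (0 : ℝ) 1) : ‖z + t • (1 - z)‖ < S.r := by
    have hmul := mul_le_mul_of_nonneg_left hz.le (sub_nonneg.2 ht.2)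
    have hle := norm_add_mul_one_sub_le z ht
    rw [Complex.real_smul]
    linarith [S.one_lt_r]
  have hintegral := intervalIntegral.integral_unitInterval_deriv_eq_sub (f := S.f1Primitive)
    (f' := S.f1Ext) (z₀ := z) (z₁ := 1 - z)
    (fun t ht => ((S.analyticAt_f1Ext_of_norm_lt_r (hsegment ht)).continuousAt.comp
      (f := fun t : ℝ => z + t • (1 - z)) (by fun_prop)).continuousWithinAt)
    fun t ht => S.hasDerivAt_f1Primitive (hsegment ht)
  rw [add_sub_cancel, smul_eq_mul, mul_comm, ← intervalIntegral.integral_mul_const] at hintegral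
  simpa only [Complex.real_smul] using hintegral

namespace IsFor

theorem integral_f1_segment (hS : S.IsFor μ l1 l2 nu) {z : ℂ} (hz : ‖z‖ < 1) :
    ∫ t in (0 : ℝ)..1, PriorityRetrial.f1 μ l1 l2 (z + (t : ℂ) * (1 - z)) * (1 - z) =
      S.f1Primitive 1 - S.f1Primitive z := by
  rw [← S.integral_f1Ext_segment hz]
  refine intervalIntegral.integral_congr_ae ?_
  filter_upwards [compl_mem_ae_iff.2 (measure_singleton (1 : ℝ))] with t ht_ne ht
  rw [Set.uIoc_of_le zero_le_one] at ht
  have hmul := mul_lt_mul_of_pos_left hz (sub_pos.2 (lt_of_le_of_ne ht.2 ht_ne))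
  rw [hS.f1_eq ((norm_add_mul_one_sub_le z ⟨ht.1.le, ht.2⟩).trans_lt (by linarith))]

theorem Q_eq (hS : S.IsFor μ l1 l2 nu) {z : ℂ} (hz : ‖z‖ < 1) :
    PriorityRetrial.Q μ l1 l2 nu z = S.Q z := by
  rw [PriorityRetrial.Q, hS.integral_f1_segment hz, RetrialModel.Q, hS.c_eq, hS.q0_eq]
  push_cast
  congr 2
  ring

theorem R_eq (hS : S.IsFor μ l1 l2 nu) {z : ℂ} (hz : ‖z‖ < 1) :
    PriorityRetrial.R μ l1 l2 nu z = S.R z := by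
  rw [PriorityRetrial.R, hS.Q_eq hz, hS.f1_eq hz, RetrialModel.R, hS.lam_eq, hS.l2_eq]
  ring

theorem P2_eq (hS : S.IsFor μ l1 l2 nu) {z : ℂ} (hz : ‖z‖ < 1) :
    PriorityRetrial.P2 μ l1 l2 nu z = S.P2 z := by
  rw [PriorityRetrial.P2, hS.Q_eq hz, hS.R_eq hz, RetrialModel.P2]

theorem val_Q (hS : S.IsFor μ l1 l2 nu) : val (PriorityRetrial.Q μ l1 l2 nu) = val S.Q :=
  val_congr fun _ hz => hS.Q_eq hz

theorem cf1_eq (hS : S.IsFor μ l1 l2 nu) (hd : S.lam * S.realSlope S.t = 1) :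
    cf1 μ l1 l2 S.r = S.residueConst := by
  have harg : (l1 + l2) * (1 - S.r) = l1 + l2 - S.t := by
    rw [← S.lam_mul_r hd, hS.lam_eq]
    ring
  rw [cf1, harg, hS.deriv_lstReal S.t_lt_sigma, residueConst, hS.lam_eq, hS.l1_eq]
  ring

theorem cQ1Integrand_eq (hS : S.IsFor μ l1 l2 nu) (hd : S.lam * S.realSlope S.t = 1) :
    cQ1Integrand μ l1 l2 S.r = S.integrand := by
  funext x
  rw [cQ1Integrand, PriorityRetrial.f1Real, hS.cf1_eq hd, hS.val_h, integrand]

theorem cQ1_eq (hS : S.IsFor μ l1 l2 nu) (hd : S.lam * S.realSlope S.t = 1) :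
    cQ1 μ l1 l2 nu S.r = S.cQ := by
  rw [cQ1, hS.cQ1Integrand_eq hd, hS.cf1_eq hd, cQ, hS.c_eq, hS.q0_eq]

theorem term1_eq (hS : S.IsFor μ l1 l2 nu) (hd : S.lam * S.realSlope S.t = 1) :
    term1 μ l1 l2 nu S.r =
      fun z => (S.poleCoeff : ℂ) * ((S.r : ℂ) - z) ^ ((-1 - S.c * S.residueConst : ℝ) : ℂ) := by
  funext z
  rw [term1, hS.cQ1_eq hd, hS.cf1_eq hd, poleCoeff, hS.lam_eq, hS.l2_eq, hS.c_eq]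

theorem term2_eq (hS : S.IsFor μ l1 l2 nu) (ht : S.t = S.τ) :
    term2 μ l1 l2 nu S.r = fun z => (S.sqrtCoeff : ℂ) * ((S.r : ℂ) - z) ^ (1 / 2 : ℂ) := by
  have hval : val S.hExt S.r = S.a S.τ := ht ▸ S.val_hExt_psi S.lam_lt_t.le S.t_le_tau
  funext z
  rw [term2, PriorityRetrial.cf2, hS.val_h, hval, hS.val_Q, sqrtCoeff, hS.lam_eq, hS.l2_eq,
    ← hS.ch_eq, ← S.r_eq_Rh ht, mul_assoc ((l1 + l2) / l2)]

theorem term3_eq (hS : S.IsFor μ l1 l2 nu) (ht : S.t = S.τ) :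
    term3 μ l1 l2 nu S.r = fun z => (S.invSqrtCoeff : ℂ) / ((S.r : ℂ) - z) ^ (1 / 2 : ℂ) := by
  funext z
  rw [term3, PriorityRetrial.cf3, hS.val_Q, invSqrtCoeff, hS.lam_eq, hS.l2_eq, ← hS.ch_eq,
    ← S.r_eq_Rh ht]

theorem isDominantSingularity_R (hS : S.IsFor μ l1 l2 nu) (h : ¬ ContinuesAcross S.R S.r S.r) :
    IsDominantSingularity (PriorityRetrial.R μ l1 l2 nu) S.r :=
  isDominantSingularity_of_not_continuesAcross S.r_pos S.differentiableOn_R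
    (fun _ hz => (hS.R_eq hz).symm) (fun _ => S.continuesAcross_R) h

theorem isDominantSingularity_P2 (hS : S.IsFor μ l1 l2 nu) (h : ¬ ContinuesAcross S.P2 S.r S.r) :
    IsDominantSingularity (PriorityRetrial.P2 μ l1 l2 nu) S.r :=
  isDominantSingularity_of_not_continuesAcross S.r_pos S.differentiableOn_P2
    (fun _ hz => (hS.P2_eq hz).symm) (fun _ => S.continuesAcross_P2) h

theorem isDominantSingularity_of_eq_one (hS : S.IsFor μ l1 l2 nu)
    (hd : S.lam * S.realSlope S.t = 1) :
    IsDominantSingularity (PriorityRetrial.R μ l1 l2 nu) S.r ∧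
      IsDominantSingularity (PriorityRetrial.P2 μ l1 l2 nu) S.r :=
  ⟨hS.isDominantSingularity_R
      (not_continuesAcross_of_tendsto_norm_atTop S.r_pos (S.tendsto_norm_R hd)),
    hS.isDominantSingularity_P2
      (not_continuesAcross_of_tendsto_norm_atTop S.r_pos (S.tendsto_norm_P2 hd))⟩

theorem deltaEquivalent_term1 (hS : S.IsFor μ l1 l2 nu) (ht : S.t < S.τ)
    (hd : S.lam * S.realSlope S.t = 1) :
    DeltaEquivalent (PriorityRetrial.R μ l1 l2 nu) S.r (term1 μ l1 l2 nu S.r) ∧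
      DeltaEquivalent (PriorityRetrial.P2 μ l1 l2 nu) S.r (term1 μ l1 l2 nu S.r) := by
  obtain ⟨M, m, hM, hm, hmr, hQ, hR⟩ := S.exists_Q_R_eq_cpow ht hd
  have hcoeff : (S.poleCoeff : ℂ) ≠ 0 := Complex.ofReal_ne_zero.2 (S.poleCoeff_ne_zero ht hd)
  have hP2r : (S.r - (S.r : ℂ)) * M S.r + m S.r = S.poleCoeff := by simp [hmr]
  rw [hS.term1_eq hd]
  constructor
  · rw [← hmr] at hcoeff ⊢
    exact deltaEquivalent_of_cpow S.one_lt_r.le S.differentiableOn_R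
      (fun _ hz => (hS.R_eq hz).symm) (fun _ => S.continuesAcross_R) hm hcoeff hR
  · rw [← hP2r] at hcoeff ⊢
    refine deltaEquivalent_of_cpow (m := fun z => (S.r - z) * M z + m z) S.one_lt_r.le
      S.differentiableOn_P2 (fun _ hz => (hS.P2_eq hz).symm) (fun _ => S.continuesAcross_P2)
      (((analyticAt_const.sub analyticAt_id).mul hM).add hm) hcoeff ?_
    filter_upwards [hQ, hR] with z hQz hRz
    rw [RetrialModel.P2, hQz, hRz, ← add_mul]

theorem convergesAt_Q (hS : S.IsFor μ l1 l2 nu) {q : ℂ → ℂ} (hq : AnalyticAt ℂ q 0)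
    (hQ : ∀ᶠ z in 𝓝[ball 0 S.r] (S.r : ℂ), S.Q z = q (sqrtSub S.r z)) :
    ConvergesAt (PriorityRetrial.Q μ l1 l2 nu) S.r :=
  (convergesAt_congr fun _ hz => hS.Q_eq hz).2 (S.convergesAt_Q_of_sqrt hq hQ).1

theorem isDominantSingularity_of_lt_one (hS : S.IsFor μ l1 l2 nu) (ht : S.t = S.τ)
    (hd : S.lam * S.realSlope S.τ < 1) :
    IsDominantSingularity (PriorityRetrial.R μ l1 l2 nu) S.r ∧
      IsDominantSingularity (PriorityRetrial.P2 μ l1 l2 nu) S.r := by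
  obtain ⟨q, H, hq, -, hq0, hq', hH', hQ, hR⟩ := S.exists_Q_R_eq_sqrt ht hd
  have hcoeff : -(S.sqrtCoeff : ℂ) ≠ 0 := neg_ne_zero.2 (Complex.ofReal_ne_zero.2
    (S.sqrtCoeff_ne_zero ht hd (S.val_Q_ne_zero_of_sqrt hq hq0 hQ)))
  exact ⟨hS.isDominantSingularity_R (not_continuesAcross_of_sqrt S.r_pos hcoeff hH' hR),
    hS.isDominantSingularity_P2 (not_continuesAcross_of_sqrt S.r_pos hcoeff
      (H := fun s => q s + H s) ((hq'.add hH').congr_deriv (zero_add _))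
      (S.eventually_P2_eq_sqrt hQ hR))⟩

theorem hasDeltaExpansion_term2 (hS : S.IsFor μ l1 l2 nu) (ht : S.t = S.τ)
    (hd : S.lam * S.realSlope S.τ < 1) :
    ConvergesAt (PriorityRetrial.Q μ l1 l2 nu) S.r ∧
    ConvergesAt (PriorityRetrial.R μ l1 l2 nu) S.r ∧
    ConvergesAt (PriorityRetrial.P2 μ l1 l2 nu) S.r ∧
    HasDeltaExpansion (PriorityRetrial.R μ l1 l2 nu) S.r
      (fun z => (val (PriorityRetrial.R μ l1 l2 nu) S.r : ℂ) - term2 μ l1 l2 nu S.r z)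
      (term2 μ l1 l2 nu S.r) ∧
    HasDeltaExpansion (PriorityRetrial.P2 μ l1 l2 nu) S.r
      (fun z => (val (PriorityRetrial.P2 μ l1 l2 nu) S.r : ℂ) - term2 μ l1 l2 nu S.r z)
      (term2 μ l1 l2 nu S.r) := by
  obtain ⟨q, H, hq, hH, hq0, hq', hH', hQ, hR⟩ := S.exists_Q_R_eq_sqrt ht hd
  have hcoeff : (S.sqrtCoeff : ℂ) ≠ 0 := Complex.ofReal_ne_zero.2
    (S.sqrtCoeff_ne_zero ht hd (S.val_Q_ne_zero_of_sqrt hq hq0 hQ))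
  have hsum : AnalyticAt ℂ (fun s => q s + H s) 0 := hq.add hH
  have hsum' : HasDerivAt (fun s => q s + H s) (-(S.sqrtCoeff : ℂ)) 0 :=
    (hq'.add hH').congr_deriv (zero_add _)
  have hP2 := S.eventually_P2_eq_sqrt hQ hR
  have hReq (z : ℂ) (hz : ‖z‖ < 1) := (hS.R_eq hz).symm
  have hP2eq (z : ℂ) (hz : ‖z‖ < 1) := (hS.P2_eq hz).symm
  rw [hS.term2_eq ht]
  exact ⟨hS.convergesAt_Q hq hQ,
    (convergesAt_of_sqrt S.r_pos S.differentiableOn_R hReq S.nonnegCoeff_R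
      hH.continuousAt hR).1,
    (convergesAt_of_sqrt S.r_pos S.differentiableOn_P2 hP2eq S.nonnegCoeff_P2
      hsum.continuousAt hP2).1,
    hasDeltaExpansion_val_of_sqrt S.one_lt_r.le S.differentiableOn_R hReq
      (fun _ => S.continuesAcross_R) S.nonnegCoeff_R hH hcoeff hH' hR,
    hasDeltaExpansion_val_of_sqrt S.one_lt_r.le S.differentiableOn_P2 hP2eq
      (fun _ => S.continuesAcross_P2) S.nonnegCoeff_P2 hsum hcoeff hsum' hP2⟩

theorem deltaEquivalent_term3 (hS : S.IsFor μ l1 l2 nu) (ht : S.t = S.τ)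
    (hd : S.lam * S.realSlope S.τ = 1) :
    ConvergesAt (PriorityRetrial.Q μ l1 l2 nu) S.r ∧
    DeltaEquivalent (PriorityRetrial.R μ l1 l2 nu) S.r (term3 μ l1 l2 nu S.r) ∧
    DeltaEquivalent (PriorityRetrial.P2 μ l1 l2 nu) S.r (term3 μ l1 l2 nu S.r) := by
  obtain ⟨q, m, hq, hm, hq0, hm0, hQ, hR⟩ := S.exists_Q_R_eq_div_sqrt ht hd
  have hcoeff : (S.invSqrtCoeff : ℂ) ≠ 0 := Complex.ofReal_ne_zero.2
    (S.invSqrtCoeff_ne_zero (S.val_Q_ne_zero_of_sqrt hq hq0 hQ))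
  have hP20 : 0 * q 0 + m 0 = S.invSqrtCoeff := by rw [zero_mul, zero_add, hm0]
  rw [hS.term3_eq ht]
  refine ⟨hS.convergesAt_Q hq hQ, ?_, ?_⟩
  · rw [← hm0] at hcoeff ⊢
    exact deltaEquivalent_of_div_sqrt S.one_lt_r.le S.differentiableOn_R
      (fun _ hz => (hS.R_eq hz).symm) (fun _ => S.continuesAcross_R) hm hcoeff hR
  · rw [← hP20] at hcoeff ⊢
    refine deltaEquivalent_of_div_sqrt (m := fun s => s * q s + m s) S.one_lt_r.le
      S.differentiableOn_P2 (fun _ hz => (hS.P2_eq hz).symm) (fun _ => S.continuesAcross_P2)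
      ((analyticAt_id.mul hq).add hm) hcoeff ?_
    filter_upwards [hQ, hR, self_mem_nhdsWithin] with z hQz hRz hz
    have hne := sqrtSub_ne_zero (ne_of_mem_slitPlaneAt (ball_subset_slitPlaneAt _ hz))
    rw [RetrialModel.P2, hQz, hRz]
    field_simp

end IsFor

end RetrialModel

end RetrialAnalysis

theorem mainTheorem5 (μ : Measure ℝ) [IsProbabilityMeasure μ] (hμ : ∀ᵐ x ∂μ, 0 ≤ x)
    (htype : PriorityRetrial.IsType1 μ) (l1 l2 nu : ℝ) (hl1 : 0 < l1) (hl2 : 0 < l2)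
    (hnu : 0 < nu) (hload : PriorityRetrial.load μ l1 l2 < 1) :
    ∃ Rh RR : ℝ,
      PriorityRetrial.IsDominantSingularity (PriorityRetrial.h μ l1 l2) Rh ∧
      PriorityRetrial.ConvergesAt (PriorityRetrial.h μ l1 l2) Rh ∧
      PriorityRetrial.IsDominantSingularity (PriorityRetrial.R μ l1 l2 nu) RR ∧
      PriorityRetrial.IsDominantSingularity (PriorityRetrial.P2 μ l1 l2 nu) RR ∧
      1 < RR ∧
      -- the three cases are exhaustive
      ((IsLeast (PriorityRetrial.zerosAboveOne μ l1 l2 Rh) RR ∧ RR < Rh) ∨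
        (PriorityRetrial.zerosAboveOne μ l1 l2 Rh = ∅ ∧ RR = Rh) ∨
        (IsLeast (PriorityRetrial.zerosAboveOne μ l1 l2 Rh) RR ∧ RR = Rh)) ∧
      -- first case
      (IsLeast (PriorityRetrial.zerosAboveOne μ l1 l2 Rh) RR → RR < Rh →
        IntervalIntegrable (PriorityRetrial.cQ1Integrand μ l1 l2 RR) volume RR 1 ∧
        PriorityRetrial.DeltaEquivalent (PriorityRetrial.R μ l1 l2 nu) RR
          (PriorityRetrial.term1 μ l1 l2 nu RR) ∧
        PriorityRetrial.DeltaEquivalent (PriorityRetrial.P2 μ l1 l2 nu) RR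
          (PriorityRetrial.term1 μ l1 l2 nu RR)) ∧
      -- second case
      (PriorityRetrial.zerosAboveOne μ l1 l2 Rh = ∅ → RR = Rh →
        PriorityRetrial.ConvergesAt (PriorityRetrial.Q μ l1 l2 nu) RR ∧
        PriorityRetrial.ConvergesAt (PriorityRetrial.R μ l1 l2 nu) RR ∧
        PriorityRetrial.ConvergesAt (PriorityRetrial.P2 μ l1 l2 nu) RR ∧
        PriorityRetrial.HasDeltaExpansion (PriorityRetrial.R μ l1 l2 nu) RR
          (fun z => (PriorityRetrial.val (PriorityRetrial.R μ l1 l2 nu) RR : ℂ)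
            - PriorityRetrial.term2 μ l1 l2 nu RR z)
          (PriorityRetrial.term2 μ l1 l2 nu RR) ∧
        PriorityRetrial.HasDeltaExpansion (PriorityRetrial.P2 μ l1 l2 nu) RR
          (fun z => (PriorityRetrial.val (PriorityRetrial.P2 μ l1 l2 nu) RR : ℂ)
            - PriorityRetrial.term2 μ l1 l2 nu RR z)
          (PriorityRetrial.term2 μ l1 l2 nu RR)) ∧
      -- third case
      (IsLeast (PriorityRetrial.zerosAboveOne μ l1 l2 Rh) RR → RR = Rh →
        PriorityRetrial.ConvergesAt (PriorityRetrial.Q μ l1 l2 nu) RR ∧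
        PriorityRetrial.DeltaEquivalent (PriorityRetrial.R μ l1 l2 nu) RR
          (PriorityRetrial.term3 μ l1 l2 nu RR) ∧
        PriorityRetrial.DeltaEquivalent (PriorityRetrial.P2 μ l1 l2 nu) RR
          (PriorityRetrial.term3 μ l1 l2 nu RR)) := by
  obtain ⟨K, hK⟩ := RetrialAnalysis.exists_busyKernel_isFor hμ htype hl1 hl2 hload
  have hh := hK.isDominantSingularity_h
  have hconv := hK.convergesAt_h
  rcases lt_trichotomy (K.lam * K.realSlope K.τ) 1 with hd | hd | hd
  · obtain ⟨S, rfl, ht, hS⟩ := hK.exists_retrialModel hnu hload K.lam_lt_tau le_rfl hd.le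
    have h0 := hK.zerosAboveOne_eq_empty hd
    obtain ⟨hR, hP⟩ := hS.isDominantSingularity_of_lt_one ht hd
    exact ⟨S.Rh, S.r, hh, hconv, hR, hP, S.one_lt_r, .inr (.inl ⟨h0, S.r_eq_Rh ht⟩),
      fun _ hlt => absurd (S.r_eq_Rh ht) hlt.ne, fun _ _ => hS.hasDeltaExpansion_term2 ht hd,
      fun hl => by simpa [h0] using hl.1⟩
  · obtain ⟨S, rfl, ht, hS⟩ := hK.exists_retrialModel hnu hload K.lam_lt_tau le_rfl hd.le
    have hl := hK.isLeast_zerosAboveOne S.lam_lt_t S.t_le_tau (ht ▸ hd)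
    obtain ⟨hR, hP⟩ := hS.isDominantSingularity_of_eq_one (ht ▸ hd)
    exact ⟨S.Rh, S.r, hh, hconv, hR, hP, S.one_lt_r, .inr (.inr ⟨hl, S.r_eq_Rh ht⟩),
      fun _ hlt => absurd (S.r_eq_Rh ht) hlt.ne, fun h0 => by simpa [h0] using hl.1,
      fun _ _ => hS.deltaEquivalent_term3 ht hd⟩
  · obtain ⟨t, ht0, htτ, hdt⟩ := RetrialAnalysis.BusyKernel.exists_lam_mul_realSlope_eq_one hd
    obtain ⟨S, rfl, rfl, hS⟩ := hK.exists_retrialModel hnu hload ht0 htτ.le hdt.le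
    have hl := hK.isLeast_zerosAboveOne S.lam_lt_t S.t_le_tau hdt
    obtain ⟨hR, hP⟩ := hS.isDominantSingularity_of_eq_one hdt
    have hlt := S.r_lt_Rh htτ
    exact ⟨S.Rh, S.r, hh, hconv, hR, hP, S.one_lt_r, .inl ⟨hl, hlt⟩,
      fun _ _ => ⟨hS.cQ1Integrand_eq hdt ▸ S.intervalIntegrable_integrand htτ hdt,
        hS.deltaEquivalent_term1 htτ hdt⟩,
      fun _ he => absurd he hlt.ne, fun _ he => absurd he hlt.ne⟩
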